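/- **Setting.** Let $V=\mathbb R^{11}$ with basis $e_+,e_-,e_1,\dots,e_9$ and Lorentzian inner product $\eta$ with $\eta(e_+,e_-)=1$, $\eta(e_i,e_j)=-\delta_{ij}$, all other products zero. Identify $\Lambda^2V\cong\mathfrak{so}(V)$ by $(v\wedge w)(x)=\eta(v,x)w-\eta(w,x)v$. Let $S=S_+\oplus S_-$, $S_\pm=\mathbb H^4=\mathbb R^{16}$, be the Clifford module with $v\cdot v=-\eta(v,v)$ given by $$\Gamma_+=\sqrt2\begin{pmatrix}0&1\\0&0\end{pmatrix},\quad \Gamma_-=-\sqrt2\begin{pmatrix}0&0\\1&0\end{pmatrix},\quad \Gamma_i=\begin{pmatrix}\gamma_i&0\\0&-\gamma_i\end{pmatrix},$$ where on $\mathbb H^4=\mathbb H^2\oplus\mathbb H^2$ one has $\gamma_i=\mathrm{diag}(A_i,-A_i)$ for $i\le5$, $\gamma_6=\begin{pmatrix}0&1\\1&0\end{pmatrix}$, $\gamma_7,\gamma_8,\gamma_9=\begin{pmatrix}0&R_q\\-R_q&0\end{pmatrix}$ for $q=i,j,k$, and on $\mathbb H^2$ one has $A_1=\mathrm{diag}(1,-1)$,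 $A_2=\begin{pmatrix}0&1\\1&0\end{pmatrix}$, $A_3,A_4,A_5=\begin{pmatrix}0&L_q\\-L_q&0\end{pmatrix}$ for $q=i,j,k$ ($L_q,R_q$ are left and right multiplication by $q$). Let $\sigma$ be the spinor representation of $\mathfrak{so}(V)$ and $\langle s,t\rangle=(s_+,t_-)-(s_-,t_+)$ the symplectic form on $S$, with $(\cdot,\cdot)$ the standard inner product of $\mathbb H^4$. The Dirac current $\kappa:\odot^2S\to V$ is defined by $\eta(\kappa(s,s),v)=\langle s,v\cdot s\rangle$. For $\varphi\in\Lambda^4V$ put $$\beta^\varphi(v,s)=\tfrac1{24}(v\cdot\varphi-3\varphi\cdot v)\cdot s,\qquad \gamma^\varphi(s,s)v=-2\kappa(\beta^\varphi(v,s),s).$$ For a subspace $S'\subset S$ let $\mathfrak h_{(\varphi,S')}=\{\gamma^\varphi(\omega): \omega\in\odot^2S',\ \kappa(\omega)=0\}$. The pair $(\varphi,S')$ is a *Lie pair* if $\dim S'>16$ and every $A\in\mathfrak h_{(\varphi,S')}$ satisfies $A\cdot\varphi=0$ and $\sigma(A)S'\subset S'$; it is *maximal* if no $(\varphi,S'')$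 with $S''\supsetneq S'$ is a Lie pair. **Statement.** Let $\varphi=e_+\wedge(e_{123}+e_{145})$ and $$S'_1=S_+\oplus(\mathbb H\oplus0\oplus\mathbb H\oplus0),\qquad S'_2=S_+\oplus(0\oplus\mathbb H\oplus0\oplus\mathbb H),$$ where the second summands are subspaces of $S_-=\mathbb H^4$. Put $\mathbb R^9=\langle e_1,\dots,e_9\rangle$, $E^\top=\langle e_2,\dots,e_5\rangle$, $E^\perp=\langle e_6,\dots,e_9\rangle$, $\mathfrak u(1)=\mathbb R(e_{23}+e_{45})$ and $\mathfrak{so}(E^\perp)=\Lambda^2E^\perp\cong\mathfrak{so}(4)$. Then: 1. $\dim S'_1=\dim S'_2=24$, and $(\varphi,S'_1)$ and $(\varphi,S'_2)$ are maximal Lie pairs. 2. As subalgebras of $\mathfrak{so}(V)$, $$\mathfrak h_{(\varphi,S'_1)}=\big(\mathfrak u(1)\oplus\mathfrak{so}(E^\perp)\big)\ltimes(e_+\wedge\mathbb R^9),\qquad \mathfrak h_{(\varphi,S'_2)}=\mathfrak u(1)\ltimes(e_+\wedge E^\top).$$ 3. Write $v=v_++v_-+v_1+v_\top+v_\perp$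 for $V=\mathbb Re_+\oplus\mathbb Re_-\oplus\mathbb Re_1\oplus E^\top\oplus E^\perp$ and let $$R_1(v,w)=-\eta(e_+,v_-)\big(\tfrac49w_1\wedge e_++\tfrac1{36}w_\top\wedge e_++\tfrac19w_\perp\wedge e_+\big)+\eta(e_+,w_-)\big(\tfrac49v_1\wedge e_++\tfrac1{36}v_\top\wedge e_++\tfrac19v_\perp\wedge e_+\big),$$ $$R_2(v,w)=-\tfrac14\eta(e_+,v_-)\,w_\top\wedge e_++\tfrac14\eta(e_+,w_-)\,v_\top\wedge e_+.$$ For $i=1,2$ and $\mathfrak h=\mathfrak h_{(\varphi,S'_i)}$, the brackets $$[A,B]=AB-BA,\quad[A,s]=\sigma(A)s,\quad[A,v]=Av,\quad[s,s]=\kappa(s,s)+\gamma^\varphi(s,s),\quad[v,s]=\beta^\varphi(v,s),\quad[v,w]=R_i(v,w)$$ ($A,B\in\mathfrak h$, $s\in S'_i$, $v,w\in V$) define a Lie superalgebra $\mathfrak g_i=(\mathfrak h\oplus V)\oplus S'_i$ with even part $\mathfrak h\oplus V$ and odd part $S'_i$, and $\mathfrak h\oplus V=[S'_i,S'_i]$.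 (So $\mathfrak g_i$ is an odd-generated filtered deformation of the graded subalgebra $\mathfrak h\oplus S'_i\oplus V$ of the Poincaré superalgebra $\mathfrak{so}(V)\oplus S\oplus V$, realised by the four-vector $\varphi$ and $X=0$.) Moreover there is a background of $D=11$ supergravity on $M=\mathbb R^{11}$, that is, a Lorentzian metric $g$ and a closed four-form $F$ with $$d\star F=\tfrac12F\wedge F,\qquad \mathrm{Ric}(X,Y)=\tfrac12g(\imath_XF,\imath_YF)-\tfrac16\|F\|^2g(X,Y)$$ (where $R(X,Y)=\nabla_{[X,Y]}-[\nabla_X,\nabla_Y]$ and $\mathrm{Ric}(X,Y)=\mathrm{tr}(Z\mapsto R(Z,X)Y)$), such that * $g=2\,dx^+dx^-+H\,(dx^-)^2-\sum_{j=1}^9(dx^j)^2$ for a function $H$ independent of $x^+$ (a pp-wave), and $\nabla R=0$ (the pp-wave is symmetric); * in a suitable global frame identifying the tangent spaces of $M$ with $V$, $F$ is $\varphi$ and the Riemann curvature is $R_i$ at every point; * the space $\mathfrak k_{\bar1}$ of Killing spinors, i.e. of the smooth solutions $\varepsilon$ of $\nabla_X\varepsilon=\tfrac1{24}(X\cdot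 F-3F\cdot X)\cdot\varepsilon$, has dimension exactly $N=24$, and the values of its elements at the origin $o$ form $S'_i$; * the Dirac currents $\kappa(\varepsilon,\varepsilon')$ of Killing spinors are Killing vector fields preserving $F$, and the transvection superalgebra $[\mathfrak k_{\bar1},\mathfrak k_{\bar1}]\oplus\mathfrak k_{\bar1}$, with brackets the Lie bracket of vector fields, the spinorial Lie derivative $L_K\varepsilon=\nabla_K\varepsilon-\sigma(\nabla K)\varepsilon$ and $[\varepsilon,\varepsilon']=\kappa(\varepsilon,\varepsilon')$, is isomorphic to $\mathfrak g_i$, by an isomorphism that sends $\varepsilon$ to $\varepsilon|_o$ and under which the $V$-component of $K$ is $K|_o$. -/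

import Mathlib

open scoped Quaternion TensorProduct ContDiff

noncomputable section

namespace Sugra

/-! ### The Lorentzian vector space and its Clifford module -/

/-- `V = ℝ¹¹` with its basis `e_+ = e 0`, `e 1, …, e 9`, `e_- = e 10`. -/
abbrev V := Fin 11 → ℝ

/-- The basis vectors. -/
def e (a : Fin 11) : V := Pi.single a 1

/-- The null vector `e_+`. -/
abbrev ePlus : V := e 0

/-- The null vector `e_-`. -/
abbrev eMinus : V := e 10

/-- The Lorentzian inner product of signature `(1,10)`: `η(e_+, e_-) = 1`, `η(e_i, e_j) = -δ_ij` for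
`1 ≤ i, j ≤ 9`, and all other products of basis vectors vanish. -/
def eta : LinearMap.BilinForm ℝ V :=
  LinearMap.mk₂ ℝ
    (fun v w => v 0 * w 10 + v 10 * w 0 - ∑ i ∈ Finset.Icc (1 : Fin 11) 9, v i * w i)
    (by intro v v' w; simp only [Pi.add_apply, add_mul, Finset.sum_add_distrib]; ring)
    (by
      intro c v w
      simp only [Pi.smul_apply, smul_eq_mul, mul_assoc, ← Finset.mul_sum]; ring)
    (by intro v w w'; simp only [Pi.add_apply, mul_add, Finset.sum_add_distrib]; ring)
    (by
      intro c v w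
      simp only [Pi.smul_apply, smul_eq_mul, mul_left_comm _ c, ← Finset.mul_sum]; ring)

/-- The `η`-dual basis: `η(eDual a, e b) = δ_ab`. -/
def eDual (a : Fin 11) : V := if a = 0 then e 10 else if a = 10 then e 0 else -e a

/-- The space `𝔰𝔬(V)` of `η`-skew endomorphisms. -/
abbrev so : Submodule ℝ (Module.End ℝ V) := eta.skewAdjointSubmodule

/-- The identification `Λ²V ≅ 𝔰𝔬(V)`: `(v ∧ w)(x) = η(v,x) w - η(w,x) v`. -/
def wedge (v w : V) : Module.End ℝ V := (eta v).smulRight w - (eta w).smulRight v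

/-- The spinor space `S = S_+ ⊕ S_-` with `S_± = ℍ⁴`. -/
abbrev S := (Fin 4 → ℍ[ℝ]) × (Fin 4 → ℍ[ℝ])

/-- The quaternion `v₂ + v₃ i + v₄ j + v₅ k`. -/
def quatA (v : V) : ℍ[ℝ] := ⟨v 2, v 3, v 4, v 5⟩

/-- The quaternion `v₆ + v₇ i + v₈ j + v₉ k`. -/
def quatB (v : V) : ℍ[ℝ] := ⟨v 6, v 7, v 8, v 9⟩

/-- `γ(v) = ∑_{i=1}^9 v_i γ_i` on `ℍ⁴ = ℍ² ⊕ ℍ²`, where, in block form,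
`γ_i = diag(A_i, -A_i)` for `i ≤ 5`, `γ_6 = [0, 1; 1, 0]`, `γ_{7,8,9} = [0, R_q; -R_q, 0]` for
`q = i, j, k`, `A_1 = diag(1, -1)`, `A_2 = [0, 1; 1, 0]`, `A_{3,4,5} = [0, L_q; -L_q, 0]` for
`q = i, j, k`; here `L_q` and `R_q` are left and right multiplication by `q`. Thus with
`a = quatA v` and `b = quatB v` one has `∑_{i ≤ 5} v_i A_i = [v₁, L_a; L_{a*}, -v₁]` and
`∑_{i ≥ 6} v_i γ_i = [0, R_b; R_{b*}, 0]`. -/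
def gammaNine (v : V) (x : Fin 4 → ℍ[ℝ]) : Fin 4 → ℍ[ℝ] :=
  ![v 1 • x 0 + quatA v * x 1 + x 2 * quatB v,
    star (quatA v) * x 0 - v 1 • x 1 + x 3 * quatB v,
    x 0 * star (quatB v) - v 1 • x 2 - quatA v * x 3,
    x 1 * star (quatB v) - star (quatA v) * x 2 + v 1 • x 3]

theorem quatA_add (v w : V) : quatA (v + w) = quatA v + quatA w := by
  ext <;> rfl

theorem quatA_smul (c : ℝ) (v : V) : quatA (c • v) = c • quatA v := by
  ext <;> rfl

theorem quatB_add (v w : V) : quatB (v + w) = quatB v + quatB w := by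
  ext <;> rfl

theorem quatB_smul (c : ℝ) (v : V) : quatB (c • v) = c • quatB v := by
  ext <;> rfl

theorem gammaNine_add_left (v w : V) (x : Fin 4 → ℍ[ℝ]) :
    gammaNine (v + w) x = gammaNine v x + gammaNine w x := by
  funext k
  fin_cases k <;>
    simp [gammaNine, quatA_add, quatB_add, add_mul, mul_add, add_smul] <;> abel

theorem gammaNine_smul_left (c : ℝ) (v : V) (x : Fin 4 → ℍ[ℝ]) :
    gammaNine (c • v) x = c • gammaNine v x := by
  funext k
  fin_cases k <;>
    simp [gammaNine, quatA_smul, quatB_smul, smul_add, smul_sub, mul_smul]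

theorem gammaNine_add_right (v : V) (x y : Fin 4 → ℍ[ℝ]) :
    gammaNine v (x + y) = gammaNine v x + gammaNine v y := by
  funext k
  fin_cases k <;>
    simp [gammaNine, add_mul, mul_add] <;> abel

theorem gammaNine_smul_right (c : ℝ) (v : V) (x : Fin 4 → ℍ[ℝ]) :
    gammaNine v (c • x) = c • gammaNine v x := by
  funext k
  fin_cases k <;>
    simp [gammaNine, smul_add, smul_sub, smul_comm (v 1) c]

/-- Clifford multiplication `Γ(v) = ∑ v_a Γ_a`, where, in block form with respect to `S_+ ⊕ S_-`,
`Γ_+ = √2 [0, 1; 0, 0]`, `Γ_- = -√2 [0, 0; 1, 0]` and `Γ_i = diag(γ_i, -γ_i)`. It satisfies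
`Γ(v)² = -η(v,v)`. -/
def Γ : V →ₗ[ℝ] Module.End ℝ S :=
  LinearMap.mk₂ ℝ
    (fun v s => (gammaNine v s.1 + (√2 * v 0) • s.2, -((√2 * v 10) • s.1) - gammaNine v s.2))
    (by
      intro v w s
      simp only [gammaNine_add_left, Pi.add_apply, Prod.mk_add_mk]
      congr 1 <;> module)
    (by
      intro c v s
      simp only [gammaNine_smul_left, Pi.smul_apply, Prod.smul_mk, smul_eq_mul]
      congr 1 <;> module)
    (by
      intro v s t
      simp only [gammaNine_add_right, Prod.fst_add, Prod.snd_add, Prod.mk_add_mk]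
      congr 1 <;> module)
    (by
      intro c v s
      simp only [gammaNine_smul_right, Prod.smul_fst, Prod.smul_snd, Prod.smul_mk]
      congr 1 <;> module)

/-- The symplectic form on `S`: `S_+` and `S_-` are isotropic and paired by the standard inner
product of `ℍ⁴ = ℝ¹⁶`. -/
def symp : LinearMap.BilinForm ℝ S :=
  LinearMap.mk₂ ℝ
    (fun s t => ∑ k, (inner ℝ (s.1 k) (t.2 k) - inner ℝ (s.2 k) (t.1 k)))
    (by
      intro s s' t
      rw [← Finset.sum_add_distrib]
      refine Finset.sum_congr rfl fun k _ => ?_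
      simp only [Prod.fst_add, Prod.snd_add, Pi.add_apply, inner_add_left]; ring)
    (by
      intro c s t
      rw [Finset.smul_sum]
      refine Finset.sum_congr rfl fun k _ => ?_
      simp only [Prod.smul_fst, Prod.smul_snd, Pi.smul_apply, real_inner_smul_left, smul_eq_mul]
      ring)
    (by
      intro s t t'
      rw [← Finset.sum_add_distrib]
      refine Finset.sum_congr rfl fun k _ => ?_
      simp only [Prod.fst_add, Prod.snd_add, Pi.add_apply, inner_add_right]; ring)
    (by
      intro c s t
      rw [Finset.smul_sum]
      refine Finset.sum_congr rfl fun k _ => ?_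
      simp only [Prod.smul_fst, Prod.smul_snd, Pi.smul_apply, real_inner_smul_right, smul_eq_mul]
      ring)

/-- The Clifford action of four-vectors: `v₁ ∧ v₂ ∧ v₃ ∧ v₄` acts as the antisymmetrised product
`(1/4!) ∑_τ sgn(τ) Γ(v_τ1) Γ(v_τ2) Γ(v_τ3) Γ(v_τ4)`. -/
def cliff4 : ⋀[ℝ]^4 V →ₗ[ℝ] Module.End ℝ S :=
  exteriorPower.alternatingMapLinearEquiv
    ((1 / 24 : ℝ) • MultilinearMap.alternatization
      ((MultilinearMap.mkPiAlgebraFin ℝ 4 (Module.End ℝ S)).compLinearMap fun _ => Γ))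

/-- The spinor representation `σ(A) = (1/4) ∑_a Γ(e^a) Γ(A e_a)` of `A ∈ 𝔰𝔬(V)`, normalised by
`[σ(A), Γ(v)] = Γ(A v)`. -/
def spinRep : Module.End ℝ V →ₗ[ℝ] Module.End ℝ S where
  toFun A := (1 / 4 : ℝ) • ∑ a, Γ (eDual a) * Γ (A (e a))
  map_add' A B := by
    simp only [LinearMap.add_apply, map_add, mul_add, Finset.sum_add_distrib, smul_add]
  map_smul' c A := by
    simp only [LinearMap.smul_apply, map_smul, mul_smul_comm, ← Finset.smul_sum, RingHom.id_apply]
    rw [smul_comm]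

/-- The Dirac current `κ(s,t)`, determined by `η(κ(s,t), v) = ⟨s, v · t⟩`. -/
def kappa : S →ₗ[ℝ] S →ₗ[ℝ] V :=
  LinearMap.mk₂ ℝ (fun s t => ∑ a, symp s (Γ (e a) t) • eDual a)
    (by intro s s' t; simp only [map_add, LinearMap.add_apply, add_smul, Finset.sum_add_distrib])
    (by
      intro c s t
      simp only [map_smul, LinearMap.smul_apply, smul_eq_mul, mul_smul, Finset.smul_sum])
    (by intro s t t'; simp only [map_add, add_smul, Finset.sum_add_distrib])
    (by intro c s t; simp only [map_smul, smul_eq_mul, mul_smul, Finset.smul_sum])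

/-- `β^φ(v,s) = (1/24) (v · φ - 3 φ · v) · s`. -/
def beta (φ : ⋀[ℝ]^4 V) : V →ₗ[ℝ] Module.End ℝ S where
  toFun v := (1 / 24 : ℝ) • (Γ v * cliff4 φ - (3 : ℝ) • (cliff4 φ * Γ v))
  map_add' v w := by
    simp only [map_add, add_mul, mul_add]
    module
  map_smul' c v := by
    simp only [map_smul, smul_mul_assoc, mul_smul_comm, RingHom.id_apply]
    module

/-- `γ^φ(s,t) v = -κ(β^φ(v,s),t) - κ(β^φ(v,t),s)`, the polarisation of
`γ^φ(s,s) v = -2 κ(β^φ(v,s),s)`. -/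
def gamma (φ : ⋀[ℝ]^4 V) : S →ₗ[ℝ] S →ₗ[ℝ] Module.End ℝ V :=
  LinearMap.mk₂ ℝ
    (fun s t =>
      -(kappa.flip t ∘ₗ (beta φ).flip s) - kappa.flip s ∘ₗ (beta φ).flip t)
    (by intro s s' t; refine LinearMap.ext fun v => ?_; simp; abel)
    (by intro c s t; refine LinearMap.ext fun v => ?_; simp [smul_sub])
    (by intro s t t'; refine LinearMap.ext fun v => ?_; simp; abel)
    (by intro c s t; refine LinearMap.ext fun v => ?_; simp [smul_sub])

/-- `A ∈ End(V)` acting on `⋀ᵏV` as a derivation: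
`A · (v₁ ∧ … ∧ v_k) = ∑_i v₁ ∧ … ∧ A v_i ∧ … ∧ v_k`. -/
def extAct (k : ℕ) (A : Module.End ℝ V) : ⋀[ℝ]^k V →ₗ[ℝ] ⋀[ℝ]^k V :=
  exteriorPower.alternatingMapLinearEquiv
    { toMultilinearMap :=
        ∑ i, (exteriorPower.ιMulti ℝ k (M := V)).toMultilinearMap.compLinearMap
          (fun j => if j = i then A else LinearMap.id)
      map_eq_zero_of_eq' := by
        intro v i j hv hij
        have hsum : ∀ l : Fin k, (fun m => (if m = l then A else LinearMap.id : Module.End ℝ V) (v m))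
            = Function.update v l (A (v l)) := by
          intro l
          funext m
          by_cases h : m = l
          · subst h; simp
          · simp [h]
        have key : ∑ l, exteriorPower.ιMulti ℝ k (Function.update v l (A (v l))) = 0 := by
          rw [← Finset.sum_subset (Finset.subset_univ {i, j})]
          · rw [Finset.sum_pair hij]
            have hswap : Function.update v j (A (v j)) =
                Function.update v i (A (v i)) ∘ Equiv.swap i j := by
              funext m
              by_cases hi : m = i
              · subst hi; simp [Function.update_of_ne hij, Function.update_of_ne hij.symm, hv]
              · by_cases hj : m = j
                · subst hj; simp [hv]
                · simp [Equiv.swap_apply_of_ne_of_ne hi hj, hi, hj]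
            rw [hswap, AlternatingMap.map_swap _ _ hij, add_neg_cancel]
          · intro l _ hl
            simp only [Finset.mem_insert, Finset.mem_singleton, not_or] at hl
            refine AlternatingMap.map_eq_zero_of_eq _ _ (i := i) (j := j) ?_ hij
            rw [Function.update_of_ne (Ne.symm hl.1), Function.update_of_ne (Ne.symm hl.2), hv]
        simpa [sum_apply, MultilinearMap.compLinearMap_apply, hsum] using key }

/-- The `k`-form associated with a `k`-vector by `η`:
`(v₁ ∧ … ∧ v_k)(w₁, …, w_k) = det (η(v_i, w_j))`. -/
def formOf (k : ℕ) (φ : ⋀[ℝ]^k V) : V [⋀^Fin k]→ₗ[ℝ] ℝ :=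
  exteriorPower.alternatingMapLinearEquiv.symm
    (exteriorPower.pairingDual ℝ V k (exteriorPower.map k eta φ))

/-! ### Lie pairs -/

/-- `⊙²S'`, as the space of symmetric tensors in `S ⊗ S` spanned by the squares of elements of
`S'`. -/
def symSq (S' : Submodule ℝ S) : Submodule ℝ (S ⊗[ℝ] S) :=
  Submodule.span ℝ {x | ∃ s ∈ S', x = s ⊗ₜ[ℝ] s}

/-- The Dirac kernel: the elements of `⊙²S'` with vanishing Dirac current. -/
def diracKernel (S' : Submodule ℝ S) : Submodule ℝ (S ⊗[ℝ] S) :=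
  symSq S' ⊓ LinearMap.ker (TensorProduct.lift kappa)

/-- The subspace `𝔥_(φ,S') = γ^φ(𝔇)` of `𝔰𝔬(V)`. -/
def isotropy (φ : ⋀[ℝ]^4 V) (S' : Submodule ℝ S) : Submodule ℝ (Module.End ℝ V) :=
  (diracKernel S').map (TensorProduct.lift (gamma φ))

/-- `(φ, S')` is a Lie pair: `dim S' > 16`, and `𝔥_(φ,S')` stabilises `φ` and `S'`. -/
def IsLiePair (φ : ⋀[ℝ]^4 V) (S' : Submodule ℝ S) : Prop :=
  16 < Module.finrank ℝ S' ∧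
    ∀ A ∈ isotropy φ S', extAct 4 A φ = 0 ∧ ∀ s ∈ S', spinRep A s ∈ S'

/-! ### Lie superalgebras and filtered subdeformations of the Poincaré superalgebra -/

/-- A real Lie superalgebra with even part `L₀` and odd part `L₁`. -/
structure LieSuperalgebra (L₀ L₁ : Type*) [AddCommGroup L₀] [Module ℝ L₀] [AddCommGroup L₁]
    [Module ℝ L₁] where
  /-- the bracket of two even elements -/
  b00 : L₀ →ₗ[ℝ] L₀ →ₗ[ℝ] L₀
  /-- the bracket of an even and an odd element -/
  b01 : L₀ →ₗ[ℝ] L₁ →ₗ[ℝ] L₁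
  /-- the bracket of two odd elements -/
  b11 : L₁ →ₗ[ℝ] L₁ →ₗ[ℝ] L₀
  alt00 : ∀ a, b00 a a = 0
  symm11 : ∀ s t, b11 s t = b11 t s
  jac000 : ∀ a b c, b00 a (b00 b c) = b00 (b00 a b) c + b00 b (b00 a c)
  jac001 : ∀ a b s, b01 a (b01 b s) = b01 (b00 a b) s + b01 b (b01 a s)
  jac011 : ∀ a s t, b00 a (b11 s t) = b11 (b01 a s) t + b11 s (b01 a t)
  jac111 : ∀ s t u, b01 (b11 s t) u + b01 (b11 t u) s + b01 (b11 u s) t = 0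

/-- A highly supersymmetric filtered deformation of the graded subalgebra `𝔞 = 𝔥 ⊕ S' ⊕ V` of the
Poincaré superalgebra `𝔰𝔬(V) ⊕ S ⊕ V`: a Lie superalgebra with even part `𝔥 ⊕ V`, odd part `S'` and
brackets
`[A,B] = AB - BA`, `[A,s] = σ(A)s`, `[A,v] = Av + δ(A,v)`, `[s,t] = κ(s,t) + γ(s,t)`,
`[v,s] = β(v,s)`, `[v,w] = α(v,w) + ρ(v,w)`, where `δ`, `γ`, `ρ` take values in `𝔥`, `β` in `S'` and
`α` in `V`. -/
structure FilteredSubdeformation (h : Submodule ℝ (Module.End ℝ V)) (S' : Submodule ℝ S) extends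
    LieSuperalgebra (h × V) S' where
  h_le_so : ∀ A ∈ h, A ∈ so
  h_lie : ∀ A ∈ h, ∀ B ∈ h, ⁅A, B⁆ ∈ h
  h_spin : ∀ A ∈ h, ∀ s ∈ S', spinRep A s ∈ S'
  dim_gt : 16 < Module.finrank ℝ S'
  bracket_h_h : ∀ A B : h, ((b00 (A, 0) (B, 0)).1 : Module.End ℝ V) = ⁅(A : Module.End ℝ V), ↑B⁆ ∧
    (b00 (A, 0) (B, 0)).2 = 0
  bracket_h_S : ∀ (A : h) (s : S'), (b01 (A, 0) s : S) = spinRep A s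
  bracket_h_V : ∀ (A : h) (v : V), (b00 (A, 0) (0, v)).2 = (A : Module.End ℝ V) v
  bracket_S_S : ∀ s t : S', (b11 s t).2 = kappa s t

namespace FilteredSubdeformation

variable {h : Submodule ℝ (Module.End ℝ V)} {S' : Submodule ℝ S}

/-- The component `α : Λ²V → V`. -/
def alpha (g : FilteredSubdeformation h S') (v w : V) : V := (g.b00 (0, v) (0, w)).2

/-- The component `ρ : Λ²V → 𝔥`. -/
def rho (g : FilteredSubdeformation h S') (v w : V) : Module.End ℝ V := (g.b00 (0, v) (0, w)).1

/-- The component `β : V ⊗ S' → S'`. -/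
def betaComp (g : FilteredSubdeformation h S') (v : V) (s : S') : S := g.b01 (0, v) s

/-- The component `γ : ⊙²S' → 𝔥`. -/
def gammaComp (g : FilteredSubdeformation h S') (s t : S') : Module.End ℝ V := (g.b11 s t).1

/-- The component `δ : 𝔥 ⊗ V → 𝔥`. -/
def deltaComp (g : FilteredSubdeformation h S') (A : h) (v : V) : Module.End ℝ V :=
  (g.b00 (A, 0) (0, v)).1

/-- `g` is realised by the four-vector `φ` and the linear map `X : V → 𝔰𝔬(V)`: `φ` is
`𝔥`-invariant; it is closed, that is, the sum over `i < j` of the numbers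
`(-1)^(i+j) φ(α(v_i,v_j), v_0, …, v̂_i, …, v̂_j, …, v_4)` vanishes for all `v_0, …, v_4`; and
`α(v,w) = X_v w - X_w v`, `β(v,s) = β^φ(v,s) + σ(X_v)s`, `γ(s,t) = γ^φ(s,t) - X_κ(s,t)`,
`δ(A,v) = [A,X_v] - X_{Av}`. -/
def RealizedBy (g : FilteredSubdeformation h S') (φ : ⋀[ℝ]^4 V) (X : V →ₗ[ℝ] Module.End ℝ V) :
    Prop :=
  (∀ v, X v ∈ so) ∧
  (∀ A ∈ h, extAct 4 A φ = 0) ∧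
  (∀ v : Fin 5 → V, ∑ j : Fin 5, ∑ i : Fin 4,
    (if i.val < j.val then
      (-1 : ℝ) ^ (i.val + j.val) * formOf 4 φ
        (Fin.cons (g.alpha (v i.castSucc) (v j)) (i.removeNth (j.removeNth v)) : Fin 4 → V)
    else 0) = 0) ∧
  (∀ v w, g.alpha v w = X v w - X w v) ∧
  (∀ v s, g.betaComp v s = beta φ v s + spinRep (X v) s) ∧
  (∀ s t : S', g.gammaComp s t = gamma φ s t - X (kappa s t)) ∧
  (∀ (A : h) (v : V), g.deltaComp A v = ⁅(A : Module.End ℝ V), X v⁆ - X ((A : Module.End ℝ V) v))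

/-- `g` is odd-generated: its even part is spanned by the brackets of odd elements. -/
def OddGenerated (g : FilteredSubdeformation h S') : Prop :=
  Submodule.span ℝ {a : h × V | ∃ s t : S', a = g.b11 s t} = ⊤

end FilteredSubdeformation

/-! ### Supergravity backgrounds on `ℝ¹¹` -/

/-- A Lorentzian metric on `M = ℝ¹¹` (with coordinates `x : V`), given by a global coframe `θ`
(`θ x u ∈ V` are the components of the tangent vector `u` at `x`), together with its Levi-Civita
connection form `conn` in that frame, that is, the `𝔰𝔬(V)`-valued one-form with vanishing torsion
`dθ + conn ∧ θ = 0`. The spinor bundle of `M` is trivialised by the frame, so spinor fields are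
functions `V → S`. -/
structure FramedSpacetime where
  /-- the coframe -/
  θ : V → (V ≃L[ℝ] V)
  /-- the connection form -/
  conn : V → V →L[ℝ] V →L[ℝ] V
  θ_smooth : ContDiff ℝ ∞ (fun x => (θ x : V →L[ℝ] V))
  conn_smooth : ContDiff ℝ ∞ conn
  conn_skew : ∀ x u, ((conn x u : V →L[ℝ] V) : Module.End ℝ V) ∈ so
  torsion_free : ∀ x u w,
    fderiv ℝ (fun y => (θ y : V →L[ℝ] V)) x u w - fderiv ℝ (fun y => (θ y : V →L[ℝ] V)) x w u
      + conn x u (θ x w) - conn x w (θ x u) = 0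

/-- The exterior derivative of a `k`-form in coordinates. -/
def extD {k : ℕ} (F : V → (Fin k → V) → ℝ) (x : V) (u : Fin (k + 1) → V) : ℝ :=
  ∑ i : Fin (k + 1), (-1 : ℝ) ^ (i : ℕ) * fderiv ℝ (fun y => F y (i.removeNth u)) x (u i)

namespace FramedSpacetime

variable (B : FramedSpacetime)

/-- The metric. -/
def metric (x u w : V) : ℝ := eta (B.θ x u) (B.θ x w)

/-- The curvature form of `conn`, `d conn + [conn, conn]`, on coordinate tangent vectors: the
endomorphism `[∇_u, ∇_w] - ∇_[u,w]` in the frame. -/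
def curvatureForm (x u w : V) : V →L[ℝ] V :=
  fderiv ℝ B.conn x u w - fderiv ℝ B.conn x w u + (B.conn x u).comp (B.conn x w)
    - (B.conn x w).comp (B.conn x u)

/-- The Riemann curvature `R(v,w) = ∇_[v,w] - [∇_v, ∇_w]` at `x`, in the frame. -/
def curvature (x v w : V) : Module.End ℝ V :=
  -(B.curvatureForm x ((B.θ x).symm v) ((B.θ x).symm w) : V →ₗ[ℝ] V)

/-- The Ricci curvature `Ric(v,w) = tr (z ↦ R(z,v)w)` in the frame. -/
def ricci (x v w : V) : ℝ := ∑ a, eta (B.curvature x (e a) v w) (eDual a)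

/-- The curvature is parallel: `(∇_u R)(v,w)y = 0`. -/
def IsLocallySymmetric : Prop :=
  ∀ x u v w y,
    fderiv ℝ (fun x' => B.curvature x' v w y) x u + B.conn x u (B.curvature x v w y)
      - B.curvature x (B.conn x u v) w y - B.curvature x v (B.conn x u w) y
      - B.curvature x v w (B.conn x u y) = 0

/-- The metric is a pp-wave, `g = 2 dx⁺ dx⁻ + H (dx⁻)² - ∑_{i=1}^9 (dxⁱ)²` for some function `H`
independent of `x⁺ = x 0` (with `x⁻ = x 10`): it is a Brinkmann metric with flat transverse geometry,
and `∂_+` is a parallel null vector field. -/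
def IsPPWave : Prop :=
  ∃ H : V → ℝ, (∀ (x : V) (t : ℝ), H (x + t • ePlus) = H x) ∧
    ∀ x u w, B.metric x u w =
      u 0 * w 10 + u 10 * w 0 + H x * u 10 * w 10 - ∑ i ∈ Finset.Icc (1 : Fin 11) 9, u i * w i

/-- The endomorphism `∇K` at `x`, in the frame, for a vector field `K` on `ℝ¹¹`. -/
def nablaField (K : V → V) (x : V) : Module.End ℝ V :=
  ((fderiv ℝ (fun y => B.θ y (K y)) x + (B.conn x).flip (B.θ x (K x))).comp
    ((B.θ x).symm : V →L[ℝ] V) : V →L[ℝ] V)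

/-- The covariant derivative of a spinor field. -/
def nablaSpinor (ε : V → S) (x u : V) : S := fderiv ℝ ε x u + spinRep (B.conn x u) (ε x)

/-- The spinorial Lie derivative `L_K ε = ∇_K ε - σ(∇K) ε`. -/
def lieSpinor (K : V → V) (ε : V → S) (x : V) : S :=
  B.nablaSpinor ε x (K x) - spinRep (B.nablaField K x) (ε x)

/-- The Dirac current of two spinor fields, as a vector field. -/
def diracField (ε ε' : V → S) (x : V) : V := (B.θ x).symm (kappa (ε x) (ε' x))

end FramedSpacetime

/-- `⋆φ = ι_φ vol`, that is `(⋆φ)(v₁, …, v₇) = vol(φ ∧ v₁ ∧ … ∧ v₇)`, for the volume form `vol` with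
`vol(e_+, e_1, …, e_9, e_-) = 1`. -/
def hodge (φ : ⋀[ℝ]^4 V) (v : Fin 7 → V) : ℝ :=
  exteriorPower.alternatingMapLinearEquiv (n := 11) (Pi.basisFun ℝ (Fin 11)).det
    ⟨(φ : ExteriorAlgebra ℝ V) * (exteriorPower.ιMulti ℝ 7 v : ⋀[ℝ]^7 V),
      SetLike.mul_mem_graded (A := fun n : ℕ => ⋀[ℝ]^n V) φ.2 (exteriorPower.ιMulti ℝ 7 v).2⟩

/-- `φ ∧ φ`, as an `8`-form. -/
def wedgeSq (φ : ⋀[ℝ]^4 V) : V [⋀^Fin 8]→ₗ[ℝ] ℝ :=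
  formOf 8 ⟨(φ : ExteriorAlgebra ℝ V) * (φ : ExteriorAlgebra ℝ V),
    SetLike.mul_mem_graded (A := fun n : ℕ => ⋀[ℝ]^n V) φ.2 φ.2⟩

/-- A background of `D = 11` supergravity on `ℝ¹¹`: a Lorentzian metric and a closed four-form `F`
satisfying the bosonic field equations `d ⋆ F = (1/2) F ∧ F` and
`Ric(v,w) = (1/2) g(ι_v F, ι_w F) - (1/6) ‖F‖² g(v,w)`. The four-form is given by the components
`φ x` of `F` at `x` in the frame, as a four-vector. -/
structure SugraBackground extends FramedSpacetime where
  /-- the four-form, in the frame, as a four-vector -/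
  φ : V → ⋀[ℝ]^4 V
  φ_smooth : ∀ u, ContDiff ℝ ∞ (fun x => formOf 4 (φ x) u)
  closed : ∀ x u, extD (fun y (w : Fin 4 → V) => formOf 4 (φ y) (fun i => θ y (w i))) x u = 0
  maxwell : ∀ x u, extD (fun y (w : Fin 7 → V) => hodge (φ y) (fun i => θ y (w i))) x u
    = (1 / 2 : ℝ) * wedgeSq (φ x) (fun i => θ x (u i))
  einstein : ∀ x v w, toFramedSpacetime.ricci x v w =
    (1 / 2 : ℝ) * ((1 / 6 : ℝ) * ∑ a : Fin 3 → Fin 11,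
        formOf 4 (φ x) (Fin.cons v (fun k => e (a k)) : Fin 4 → V)
          * formOf 4 (φ x) (Fin.cons w (fun k => eDual (a k)) : Fin 4 → V))
      - (1 / 6 : ℝ) * ((1 / 24 : ℝ) * ∑ a : Fin 4 → Fin 11,
        formOf 4 (φ x) (fun k => e (a k)) * formOf 4 (φ x) (fun k => eDual (a k))) * eta v w

namespace SugraBackground

variable (B : SugraBackground)

/-- The four-form `F` on coordinate tangent vectors. -/
def F (x : V) (u : Fin 4 → V) : ℝ := formOf 4 (B.φ x) (fun i => B.θ x (u i))

/-- The space `𝔨₁` of Killing spinors: smooth solutions of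
`∇_u ε - (1/24) (u · F - 3 F · u) · ε = 0`. -/
def killingSpinors : Submodule ℝ (V → S) where
  carrier := {ε | ContDiff ℝ ∞ ε ∧ ∀ x u, B.nablaSpinor ε x u - beta (B.φ x) (B.θ x u) (ε x) = 0}
  zero_mem' := by
    refine ⟨contDiff_const, fun x u => ?_⟩
    simp [FramedSpacetime.nablaSpinor, Pi.zero_def]
  add_mem' := by
    rintro ε ε' ⟨h1, h2⟩ ⟨h1', h2'⟩
    refine ⟨h1.add h1', fun x u => ?_⟩
    have d : DifferentiableAt ℝ ε x := (h1.differentiable (by simp)).differentiableAt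
    have d' : DifferentiableAt ℝ ε' x := (h1'.differentiable (by simp)).differentiableAt
    have e1 := h2 x u
    have e2 := h2' x u
    simp only [FramedSpacetime.nablaSpinor] at e1 e2 ⊢
    rw [fderiv_add d d', Pi.add_apply, map_add, map_add, add_apply, ← add_zero (0 : S)]
    nth_rewrite 1 [← e1]
    rw [← e2]
    abel
  smul_mem' := by
    rintro c ε ⟨h1, h2⟩
    refine ⟨h1.const_smul c, fun x u => ?_⟩
    have d : DifferentiableAt ℝ ε x := (h1.differentiable (by simp)).differentiableAt
    have e1 := h2 x u
    simp only [FramedSpacetime.nablaSpinor] at e1 ⊢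
    rw [fderiv_const_smul d, Pi.smul_apply, map_smul, map_smul, smul_apply, ← smul_add,
      ← smul_sub, e1, smul_zero]

/-- `K ∈ 𝔨₀`: `K` is a Killing vector field that preserves `F`, that is `L_K g = 0` and
`L_K F = 0`. -/
def IsKillingField (K : V → V) : Prop :=
  ContDiff ℝ ∞ K ∧
  (∀ x u w, fderiv ℝ (fun y => B.metric y u w) x (K x) + B.metric x (fderiv ℝ K x u) w
    + B.metric x u (fderiv ℝ K x w) = 0) ∧
  (∀ (x : V) (u : Fin 4 → V), fderiv ℝ (fun y => B.F y u) x (K x)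
    + ∑ i, B.F x (Function.update u i (fderiv ℝ K x (u i))) = 0)

/-- The even part `[𝔨₁, 𝔨₁]` of the transvection superalgebra, spanned by the Dirac currents of
Killing spinors. Its odd part is `𝔨₁`. -/
def transvectionEven : Submodule ℝ (V → V) :=
  Submodule.span ℝ {K | ∃ ε ∈ B.killingSpinors, ∃ ε' ∈ B.killingSpinors, K = B.diracField ε ε'}

/-- The Killing superalgebra of `B` has brackets `[K,K']` (Lie bracket of vector fields),
`[K,ε] = L_K ε` and `[ε,ε'] = κ(ε,ε')`. Its ideal `[𝔨₁,𝔨₁] ⊕ 𝔨₁` is the transvection superalgebra.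
The statement is that `g` is isomorphic to it, by an isomorphism whose inverse identifies a Killing
spinor with its value at the origin, and whose inverse followed by the projection to `V` is the value
of a vector field at the origin. -/
def HasTransvectionSuperalgebra {h : Submodule ℝ (Module.End ℝ V)} {S' : Submodule ℝ S}
    (g : FilteredSubdeformation h S') : Prop :=
  ∃ (f₀ : (h × V) ≃ₗ[ℝ] B.transvectionEven) (f₁ : S' ≃ₗ[ℝ] B.killingSpinors),
    (∀ a b, (f₀ (g.b00 a b) : V → V) = VectorField.lieBracket ℝ (f₀ a : V → V) (f₀ b)) ∧
    (∀ a s, (f₁ (g.b01 a s) : V → S) = B.lieSpinor (f₀ a) (f₁ s)) ∧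
    (∀ s t, (f₀ (g.b11 s t) : V → V) = B.diracField (f₁ s) (f₁ t)) ∧
    (∀ s : S', (f₁ s : V → S) 0 = s) ∧
    (∀ a, B.θ 0 ((f₀ a : V → V) 0) = a.2)

end SugraBackground

/-! ### The example -/

/-- `φ = e_+ ∧ (e_123 + e_145)`. -/
def phi0 : ⋀[ℝ]^4 V :=
  exteriorPower.ιMulti ℝ 4 ![ePlus, e 1, e 2, e 3] + exteriorPower.ιMulti ℝ 4 ![ePlus, e 1, e 4, e 5]

/-- `S'_1 = S_+ ⊕ ℍ ⊕ 0 ⊕ ℍ ⊕ 0`. -/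
def S1 : Submodule ℝ S where
  carrier := {s | s.2 1 = 0 ∧ s.2 3 = 0}
  zero_mem' := by simp
  add_mem' := by rintro s t ⟨h1, h2⟩ ⟨h1', h2'⟩; simp [h1, h2, h1', h2']
  smul_mem' := by rintro c s ⟨h1, h2⟩; simp [h1, h2]

/-- `S'_2 = S_+ ⊕ 0 ⊕ ℍ ⊕ 0 ⊕ ℍ`. -/
def S2 : Submodule ℝ S where
  carrier := {s | s.2 0 = 0 ∧ s.2 2 = 0}
  zero_mem' := by simp
  add_mem' := by rintro s t ⟨h1, h2⟩ ⟨h1', h2'⟩; simp [h1, h2, h1', h2']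
  smul_mem' := by rintro c s ⟨h1, h2⟩; simp [h1, h2]

/-- `𝔲(1) = ℝ (e_23 + e_45)`. -/
def u1 : Submodule ℝ (Module.End ℝ V) := Submodule.span ℝ {wedge (e 2) (e 3) + wedge (e 4) (e 5)}

/-- The span `⟨e_a, …, e_b⟩`. -/
def spanIcc (a b : Fin 11) : Submodule ℝ V := Submodule.span ℝ (e '' Set.Icc a b)

/-- `𝔰𝔬(W) = Λ²W ⊂ 𝔰𝔬(V)`, for a subspace `W` of `V`. -/
def soOf (W : Submodule ℝ V) : Submodule ℝ (Module.End ℝ V) :=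
  Submodule.span ℝ {A | ∃ v ∈ W, ∃ w ∈ W, A = wedge v w}

/-- `e_+ ∧ W`, for a subspace `W` of `V`. -/
def plusWedge (W : Submodule ℝ V) : Submodule ℝ (Module.End ℝ V) :=
  Submodule.span ℝ {A | ∃ w ∈ W, A = wedge ePlus w}

/-- `l` is the direct sum of the Lie subalgebras `a` and `b`, which commute. -/
def IsLieDirectSum (l a b : Submodule ℝ (Module.End ℝ V)) : Prop :=
  l = a ⊔ b ∧ Disjoint a b ∧ (∀ A ∈ a, ∀ B ∈ a, ⁅A, B⁆ ∈ a) ∧ (∀ A ∈ b, ∀ B ∈ b, ⁅A, B⁆ ∈ b) ∧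
    ∀ A ∈ a, ∀ B ∈ b, ⁅A, B⁆ = 0

/-- `l` is the semidirect sum `a ⋉ n` of the Lie subalgebra `a` and the ideal `n`. -/
def IsSemidirectSum (l a n : Submodule ℝ (Module.End ℝ V)) : Prop :=
  l = a ⊔ n ∧ Disjoint a n ∧ (∀ A ∈ a, ∀ B ∈ a, ⁅A, B⁆ ∈ a) ∧ ∀ A ∈ l, ∀ B ∈ n, ⁅A, B⁆ ∈ n

/-- The components `v_1`, `v_⊤`, `v_⊥` of `v`, for `V = ℝe_+ ⊕ ℝe_- ⊕ ℝe_1 ⊕ E^⊤ ⊕ E^⊥` with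
`E^⊤ = ⟨e_2, …, e_5⟩` and `E^⊥ = ⟨e_6, …, e_9⟩`, are `part 1 1 v`, `part 2 5 v` and `part 6 9 v`; the
component `v_-` is `part 10 10 v`. -/
def part (a b : Fin 11) (v : V) : V := ∑ i ∈ Finset.Icc a b, v i • e i

/-- The curvature tensor of the first pp-wave. -/
def R1 (v w : V) : Module.End ℝ V :=
  -(eta ePlus (part 10 10 v) •
      ((4 / 9 : ℝ) • wedge (part 1 1 w) ePlus + (1 / 36 : ℝ) • wedge (part 2 5 w) ePlus
        + (1 / 9 : ℝ) • wedge (part 6 9 w) ePlus))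
    + eta ePlus (part 10 10 w) •
      ((4 / 9 : ℝ) • wedge (part 1 1 v) ePlus + (1 / 36 : ℝ) • wedge (part 2 5 v) ePlus
        + (1 / 9 : ℝ) • wedge (part 6 9 v) ePlus)

/-- The curvature tensor of the second pp-wave. -/
def R2 (v w : V) : Module.End ℝ V :=
  -(((1 / 4 : ℝ) * eta ePlus (part 10 10 v)) • wedge (part 2 5 w) ePlus)
    + ((1 / 4 : ℝ) * eta ePlus (part 10 10 w)) • wedge (part 2 5 v) ePlus

/-- `(φ, S')` is the geometric symbol of a symmetric pp-wave background of `D = 11` supergravity with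
exactly `N` Killing spinors, whose transvection superalgebra is the odd-generated filtered
subdeformation with isotropy `𝔥_(φ,S')`, realised by `φ` and `X = 0`, with `ρ = R`; and `R` is the
curvature tensor of the background. -/
def GivesSymmetricPPWave (φ : ⋀[ℝ]^4 V) (S' : Submodule ℝ S) (R : V → V → Module.End ℝ V) (N : ℕ) :
    Prop :=
  ∃ g : FilteredSubdeformation (isotropy φ S') S',
    g.RealizedBy φ 0 ∧ g.OddGenerated ∧ (∀ v w, g.rho v w = R v w) ∧
    ∃ B : SugraBackground,
      B.IsPPWave ∧ B.IsLocallySymmetric ∧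
      (∀ x, B.φ x = φ) ∧
      (∀ x v w, B.curvature x v w = R v w) ∧
      Module.finrank ℝ B.killingSpinors = N ∧
      (∀ K ∈ B.transvectionEven, B.IsKillingField K) ∧
      B.HasTransvectionSuperalgebra g

end Sugra

end

open Sugra

open scoped Quaternion TensorProduct ContDiff

noncomputable section

namespace Sugra

/-! ### Coordinates -/

/-! Write S_± = ℍ⁴ and J = diag(L_i, 0, -L_i, 0). Because φ has the factor e_+, its Clifford action
is nilpotent: s goes to (2√2 J s_-, 0) (`cliff4_phi0`). Since J² = -1 on components 0, 2 and J = 0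
on components 1, 3, S'_1 and S'_2 consist of the s with s_- in the image, respectively in the
kernel, of J. The rest follows from how J meets γ(v): γ(e_1) commutes with J, γ(v) anticommutes with
J for v in E^⊥, and γ(v) exchanges image and kernel of J for v in E^⊤.

Isotropy. On S'_i every γ^φ(s,t) has the form `nf l y x w`: a rotation l L_i of E^⊤, a rotation L_y
+ R_x of E^⊥ and a null rotation e_+ ∧ w (`gamma_of_mem_S1`, `gamma_of_mem_S2`). This bounds 𝔥 from
above; explicit pairs of spinors with vanishing Dirac current give the lower bound (`isotropy_S1`,
`isotropy_S2`). For maximality, a spinor outside S'_i in a larger Lie pair can be taken to be (0, x)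
with x orthogonal to the S_- part of S'_i. Its γ^φ with that part then lies in the isotropy and must
annihilate φ, and one coefficient of this equation forces x = 0.

Superalgebra. Clifford multiplication, κ and σ are 𝔰𝔬(V)-equivariant and 𝔥 fixes φ, which disposes
of the Jacobi identities whose content is 𝔥-invariance. What remains is collected in
`IsSymmetricSymbol`: [β_v, β_w] = σ(R(v,w)), a formula for R(v, κ(s,t)), invariance of R, the
Bianchi identity and a cubic identity in s. Here R(v,w) = e_+ ∧ (v_- C w - w_- C v), with C scalar
on each of e_1, E^⊤, E^⊥. As β(e_-) acts by J/2 on S_+ and by -J/6 on S_-, the eigenvalues of C are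
squares of frequencies: (1/2 + 1/6)², (1/6)², (1/2 - 1/6)² for S'_1, and 0, (1/2)², 0 for S'_2.

Geometry. Take the metric with H(x) = (Cx, x), the coframe u ↦ u + (H/2) u_- e_+ and the connection
form u_- e_+ ∧ Cx. The curvature is constant in the frame. The coframe differs from the coordinate
one only along e_+, which neither φ nor ⋆φ detects, so F and ⋆F have constant coefficients; φ ∧ φ =
0 and φ is null, so the field equations reduce to tr C = 1.

Killing spinors and transvections. Killing spinors are the parallel sections for the one-form ω =
(-conn, θ) acting through the brackets of the superalgebra (`mem_killingSpinors`). On S'_i they are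
written down with exp(tJ) (`exists_killingSpinor`); integrability in the direction e_1 excludes all
other initial values (`killingSpinor_components`). The Jacobi identities make pointwise brackets of
parallel sections parallel, the vector field of an even parallel section is Killing, and evaluation
at the origin is the required isomorphism (`transvection`). -/

theorem V_ext {v w : V} (h0 : v 0 = w 0) (h10 : v 10 = w 10) (h1 : v 1 = w 1)
    (hA : quatA v = quatA w) (hB : quatB v = quatB w) : v = w := by
  have h2 : v 2 = w 2 := congrArg QuaternionAlgebra.re hA
  have h3 : v 3 = w 3 := congrArg QuaternionAlgebra.imI hA
  have h4 : v 4 = w 4 := congrArg QuaternionAlgebra.imJ hA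
  have h5 : v 5 = w 5 := congrArg QuaternionAlgebra.imK hA
  have h6 : v 6 = w 6 := congrArg QuaternionAlgebra.re hB
  have h7 : v 7 = w 7 := congrArg QuaternionAlgebra.imI hB
  have h8 : v 8 = w 8 := congrArg QuaternionAlgebra.imJ hB
  have h9 : v 9 = w 9 := congrArg QuaternionAlgebra.imK hB
  funext i
  fin_cases i <;> assumption

@[simp] theorem quatA_re (v : V) : (quatA v).re = v 2 := rfl

@[simp] theorem quatA_imI (v : V) : (quatA v).imI = v 3 := rfl

@[simp] theorem quatA_imJ (v : V) : (quatA v).imJ = v 4 := rfl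

@[simp] theorem quatA_imK (v : V) : (quatA v).imK = v 5 := rfl

@[simp] theorem quatB_re (v : V) : (quatB v).re = v 6 := rfl

@[simp] theorem quatB_imI (v : V) : (quatB v).imI = v 7 := rfl

@[simp] theorem quatB_imJ (v : V) : (quatB v).imJ = v 8 := rfl

@[simp] theorem quatB_imK (v : V) : (quatB v).imK = v 9 := rfl

theorem Icc_one_nine : Finset.Icc (1 : Fin 11) 9 = {1, 2, 3, 4, 5, 6, 7, 8, 9} := by decide

theorem eta_apply (v w : V) : eta v w = v 0 * w 10 + v 10 * w 0
    - (v 1 * w 1 + (v 2 * w 2 + v 3 * w 3 + v 4 * w 4 + v 5 * w 5)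
      + (v 6 * w 6 + v 7 * w 7 + v 8 * w 8 + v 9 * w 9)) := by
  simp only [eta, LinearMap.mk₂_apply, Icc_one_nine]
  simp
  ring

theorem eta_comm (v w : V) : eta v w = eta w v := by
  simp only [eta_apply]; ring

theorem eta_e_left (a : Fin 11) (v : V) : eta (eDual a) v = v a := by
  fin_cases a <;> simp [eta_apply, eDual, e]

theorem eta_e_right (a : Fin 11) (v : V) : eta v (eDual a) = v a := by
  rw [eta_comm, eta_e_left]

theorem sum_apply_smul_e (v : V) : ∑ a, v a • e a = v := by
  funext i
  simp [e, Finset.sum_apply, Pi.single_apply]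

theorem sum_eta_eDual_smul_e (v : V) : ∑ a, eta (eDual a) v • e a = v := by
  simp only [eta_e_left, sum_apply_smul_e]

theorem sum_eta_e_smul_eDual (v : V) : ∑ a, eta (e a) v • eDual a = v := by
  funext i
  simp only [Fin.sum_univ_succ, eta_apply, eDual, e, Finset.sum_apply, Pi.smul_apply]
  fin_cases i <;> simp

theorem eta_left_ext {v w : V} (h : ∀ u, eta v u = eta w u) : v = w := by
  funext a
  rw [← eta_e_right a v, ← eta_e_right a w, h]

theorem so_iff {A : Module.End ℝ V} : A ∈ so ↔ ∀ v w, eta (A v) w = -eta v (A w) := by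
  simp only [so, LinearMap.mem_skewAdjointSubmodule, LinearMap.IsSkewAdjoint,
    LinearMap.IsAdjointPair, Pi.neg_apply, map_neg]

theorem wedge_apply (v w x : V) : wedge v w x = eta v x • w - eta w x • v := rfl

theorem wedge_mem_so (v w : V) : wedge v w ∈ so := by
  rw [so_iff]
  intro x y
  simp only [wedge_apply, map_sub, map_smul, LinearMap.sub_apply, LinearMap.smul_apply,
    smul_eq_mul, eta_comm x]
  ring

/-! ### The Clifford relation and the symplectic form -/

theorem Γ_apply (v : V) (s : S) : Γ v s =
    (gammaNine v s.1 + (√2 * v 0) • s.2, -((√2 * v 10) • s.1) - gammaNine v s.2) := rfl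

/-- Cross terms between E^⊤ and E^⊥ cancel because left and right multiplications commute and enter
with opposite signs; the squares give q q* = |q|². -/
theorem gammaNine_gammaNine (v : V) (x : Fin 4 → ℍ[ℝ]) :
    gammaNine v (gammaNine v x) = (v 1 * v 1 + (v 2 * v 2 + v 3 * v 3 + v 4 * v 4 + v 5 * v 5)
      + (v 6 * v 6 + v 7 * v 7 + v 8 * v 8 + v 9 * v 9)) • x := by
  funext k
  fin_cases k <;> ext <;>
    simp only [gammaNine, Fin.zero_eta, Fin.mk_one, Fin.reduceFinMk, Fin.isValue, Pi.smul_apply,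
      Matrix.cons_val_zero, Matrix.cons_val_one, Matrix.cons_val, Quaternion.re_add,
      Quaternion.imI_add, Quaternion.imJ_add, Quaternion.imK_add, Quaternion.re_sub,
      Quaternion.imI_sub, Quaternion.imJ_sub, Quaternion.imK_sub, Quaternion.re_mul,
      Quaternion.imI_mul, Quaternion.imJ_mul, Quaternion.imK_mul, Quaternion.re_smul,
      Quaternion.imI_smul, Quaternion.imJ_smul, Quaternion.imK_smul, Quaternion.re_star,
      Quaternion.imI_star, Quaternion.imJ_star, Quaternion.imK_star, smul_eq_mul, quatA_re,
      quatA_imI, quatA_imJ, quatA_imK, quatB_re, quatB_imI, quatB_imJ, quatB_imK] <;> ring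

/-- The two diagonal blocks are γ(v) and -γ(v), so the off-diagonal blocks of the square cancel,
while the product of the null entries contributes -2 v_+ v_- to each diagonal block. -/
theorem Γ_mul_self (v : V) : Γ v * Γ v = -eta v v • (1 : Module.End ℝ S) := by
  refine LinearMap.ext fun s => ?_
  have h2 : √2 * √2 = 2 := Real.mul_self_sqrt (by norm_num)
  have e1 : gammaNine v (-((√2 * v 10) • s.1) - gammaNine v s.2) =
      -((√2 * v 10) • gammaNine v s.1) - gammaNine v (gammaNine v s.2) := by
    rw [sub_eq_add_neg, gammaNine_add_right, ← neg_smul, gammaNine_smul_right,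
      ← neg_one_smul ℝ (gammaNine v s.2), gammaNine_smul_right]
    module
  simp only [Module.End.mul_apply, Γ_apply, e1, gammaNine_add_right, gammaNine_smul_right,
    gammaNine_gammaNine, LinearMap.smul_apply, Module.End.one_apply, eta_apply]
  ext1
  · simp only [Prod.smul_fst]
    linear_combination (norm := module) (-(v 0 * v 10) * h2) • s.1
  · simp only [Prod.smul_snd]
    linear_combination (norm := module) (-(v 0 * v 10) * h2) • s.2

theorem Γ_mul_Γ (v w : V) : Γ v * Γ w = (-2 * eta v w) • (1 : Module.End ℝ S) - Γ w * Γ v := by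
  have h := Γ_mul_self (v + w)
  simp only [map_add, add_mul, mul_add, Γ_mul_self, LinearMap.add_apply, eta_comm w v] at h
  linear_combination (norm := module) h

theorem inner_quat (a b : ℍ[ℝ]) :
    inner ℝ a b = a.re * b.re + a.imI * b.imI + a.imJ * b.imJ + a.imK * b.imK := by
  simp [Quaternion.inner_def]

theorem symp_apply (s t : S) :
    symp s t = ∑ k, (inner ℝ (s.1 k) (t.2 k) - inner ℝ (s.2 k) (t.1 k)) := rfl

theorem symp_comm (s t : S) : symp s t = -symp t s := by
  simp only [symp_apply, ← Finset.sum_neg_distrib]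
  refine Finset.sum_congr rfl fun k _ => ?_
  rw [real_inner_comm (t.2 k), real_inner_comm (t.1 k)]
  ring

/-- This skewness is what makes the Dirac current symmetric. -/
theorem symp_Γ_left (v : V) (s t : S) : symp (Γ v s) t = -symp s (Γ v t) := by
  simp only [symp_apply, Γ_apply, Fin.sum_univ_four, inner_quat, gammaNine]
  simp
  ring

/-! ### The spinor representation and equivariance -/

theorem spinRep_apply (A : Module.End ℝ V) :
    spinRep A = (1 / 4 : ℝ) • ∑ a, Γ (eDual a) * Γ (A (e a)) := rfl

theorem smul_mul_sub_mul_smul (c : ℝ) (x y : Module.End ℝ S) :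
    (c • x) * y - y * (c • x) = c • (x * y - y * x) := by
  refine LinearMap.ext fun s => ?_
  simp [smul_sub]

theorem mul_smul_sub_smul_mul (c : ℝ) (x y : Module.End ℝ S) :
    y * (c • x) - (c • x) * y = c • (y * x - x * y) := by
  refine LinearMap.ext fun s => ?_
  simp [smul_sub]

theorem mul_zsmul_sub_zsmul_mul (c : ℤˣ) (x y : Module.End ℝ S) :
    y * (c • x) - (c • x) * y = c • (y * x - x * y) := by
  rcases Int.units_eq_one_or c with rfl | rfl
  · simp
  · refine LinearMap.ext fun s => ?_
    simp only [Units.neg_smul, one_smul, LinearMap.sub_apply, Module.End.mul_apply,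
      LinearMap.neg_apply, map_neg]
    abel

theorem sum_mul_sub_mul_sum {ι : Type*} (t : Finset ι) (x : ι → Module.End ℝ S)
    (y : Module.End ℝ S) :
    (∑ i ∈ t, x i) * y - y * ∑ i ∈ t, x i = ∑ i ∈ t, (x i * y - y * x i) := by
  rw [Finset.sum_mul, Finset.mul_sum, Finset.sum_sub_distrib]

theorem mul_sum_sub_sum_mul {ι : Type*} (t : Finset ι) (x : ι → Module.End ℝ S)
    (y : Module.End ℝ S) :
    y * ∑ i ∈ t, x i - (∑ i ∈ t, x i) * y = ∑ i ∈ t, (y * x i - x i * y) := by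
  rw [Finset.sum_mul, Finset.mul_sum, Finset.sum_sub_distrib]

theorem mul_sub_mul_leibniz (a b c : Module.End ℝ S) :
    a * (b * c) - b * c * a = (a * b - b * a) * c + b * (a * c - c * a) := by
  refine LinearMap.ext fun s => ?_
  simp

theorem ΓΓ_comm_Γ (x y v : V) : Γ x * Γ y * Γ v - Γ v * (Γ x * Γ y) =
    (2 * eta x v) • Γ y - (2 * eta y v) • Γ x := by
  have h1 := Γ_mul_Γ y v
  have h2 := Γ_mul_Γ x v
  rw [mul_assoc, h1, mul_sub, ← mul_assoc, ← mul_assoc, h2, sub_mul]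
  simp only [smul_mul_assoc, one_mul, mul_smul_comm, mul_one]
  module

/-- Commuting Γ(v) past each summand of σ(A) leaves two contractions over the dual bases. Each
equals 2 Γ(Av), the second one through the skewness of A, and the factor 1/4 normalises the total.
-/
theorem spinRep_mul_Γ {A : Module.End ℝ V} (hA : A ∈ so) (v : V) :
    spinRep A * Γ v - Γ v * spinRep A = Γ (A v) := by
  rw [so_iff] at hA
  have h1 : ∑ a, (2 * eta (eDual a) v) • Γ (A (e a)) = (2 : ℝ) • Γ (A v) := by
    conv_rhs => rw [← sum_eta_eDual_smul_e v]
    simp only [map_sum, map_smul, Finset.smul_sum, mul_smul]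
  have h2 : ∑ a, (2 * eta (A (e a)) v) • Γ (eDual a) = -((2 : ℝ) • Γ (A v)) := by
    conv_rhs => rw [← sum_eta_e_smul_eDual (A v)]
    simp only [map_sum, map_smul, Finset.smul_sum, mul_smul, hA, neg_smul, smul_neg,
      Finset.sum_neg_distrib]
  rw [spinRep_apply, smul_mul_sub_mul_smul, sum_mul_sub_mul_sum]
  simp only [ΓΓ_comm_Γ]
  rw [Finset.sum_sub_distrib, h1, h2]
  module

/-- The commutator with σ(A) is a derivation, so it acts on both factors of each term of σ(B).
Invariance of the tensor ∑ eᵃ ⊗ e_a under A transfers A from the first factor to the argument of B,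
with a sign; only the skewness of A enters. -/
theorem spinRep_lie {A : Module.End ℝ V} (hA : A ∈ so) (B : Module.End ℝ V) :
    spinRep ⁅A, B⁆ = spinRep A * spinRep B - spinRep B * spinRep A := by
  have hA' := so_iff.1 hA
  have h1 : ∑ a, Γ (A (eDual a)) * Γ (B (e a)) = -∑ a, Γ (eDual a) * Γ (B (A (e a))) := by
    have e1 : ∀ a, A (eDual a) = -∑ b, eta (eDual a) (A (e b)) • eDual b := by
      intro a
      conv_lhs => rw [← sum_eta_e_smul_eDual (A (eDual a))]
      rw [← Finset.sum_neg_distrib]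
      refine Finset.sum_congr rfl fun b _ => ?_
      rw [eta_comm, hA', neg_smul]
    have e2 : ∀ b, A (e b) = ∑ a, eta (eDual a) (A (e b)) • e a := fun b =>
      (sum_eta_eDual_smul_e _).symm
    have e3 : ∀ b, Γ (B (A (e b))) = ∑ a, eta (eDual a) (A (e b)) • Γ (B (e a)) := by
      intro b
      conv_lhs => rw [e2 b]
      simp only [map_sum, map_smul]
    have e4 : ∀ a, Γ (A (eDual a)) * Γ (B (e a)) =
        -∑ b, eta (eDual a) (A (e b)) • (Γ (eDual b) * Γ (B (e a))) := by
      intro a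
      refine LinearMap.ext fun s => ?_
      simp only [e1, map_neg, map_sum, map_smul, Module.End.mul_apply, LinearMap.neg_apply,
        LinearMap.sum_apply, LinearMap.smul_apply]
    simp only [e3, e4, Finset.mul_sum, mul_smul_comm]
    rw [Finset.sum_neg_distrib, Finset.sum_comm]
  have h2 : ∀ a, spinRep A * (Γ (eDual a) * Γ (B (e a))) - Γ (eDual a) * Γ (B (e a)) * spinRep A
      = Γ (A (eDual a)) * Γ (B (e a)) + Γ (eDual a) * Γ (A (B (e a))) := by
    intro a
    rw [← spinRep_mul_Γ hA, ← spinRep_mul_Γ hA]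
    exact mul_sub_mul_leibniz _ _ _
  rw [spinRep_apply B, mul_smul_sub_smul_mul, mul_sum_sub_sum_mul]
  simp only [h2]
  rw [Finset.sum_add_distrib, h1, spinRep_apply, neg_add_eq_sub, ← Finset.sum_sub_distrib]
  simp only [← mul_sub, ← map_sub]
  rfl

theorem sum_eta_skew {A : Module.End ℝ V} (hA : A ∈ so) : ∑ a, eta (eDual a) (A (e a)) = 0 := by
  rw [so_iff] at hA
  have h0 : ∀ a, eta (e a) (A (e a)) = 0 := by
    intro a
    have := hA (e a) (e a)
    rw [eta_comm] at this
    linarith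
  have h1 : eta (e 10) (A (e 0)) = -eta (e 0) (A (e 10)) := by rw [← hA, eta_comm]
  simp [Fin.sum_univ_succ, eDual, h1]
  have h2 := h0 1
  have h3 := h0 2
  have h4 := h0 3
  have h5 := h0 4
  have h6 := h0 5
  have h7 := h0 6
  have h8 := h0 7
  have h9 := h0 8
  have h10 := h0 9
  simp_all

/-- Moving two Clifford factors across the form reverses their order. Reversing the sum that defines
σ(A) only changes its sign, because the contraction term is the trace of A, which is zero. -/
theorem symp_spinRep_left {A : Module.End ℝ V} (hA : A ∈ so) (s t : S) :
    symp (spinRep A s) t = -symp s (spinRep A t) := by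
  have h1 : ∑ a, Γ (A (e a)) * Γ (eDual a) = -∑ a, Γ (eDual a) * Γ (A (e a)) := by
    have : ∀ a, Γ (A (e a)) * Γ (eDual a) =
        (-2 * eta (eDual a) (A (e a))) • (1 : Module.End ℝ S) - Γ (eDual a) * Γ (A (e a)) := by
      intro a
      rw [Γ_mul_Γ, eta_comm]
    simp only [this]
    rw [Finset.sum_sub_distrib, ← Finset.sum_smul, ← Finset.mul_sum, sum_eta_skew hA]
    simp
  have h2 := congrArg (fun T => symp s (T t)) h1
  simp only [LinearMap.neg_apply, LinearMap.sum_apply, map_neg, map_sum, Module.End.mul_apply] at h2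
  simp only [spinRep_apply, LinearMap.smul_apply, LinearMap.sum_apply, map_smul, map_sum,
    Module.End.mul_apply, symp_Γ_left, neg_neg, smul_eq_mul, h2]
  ring

theorem kappa_apply (s t : S) : kappa s t = ∑ a, symp s (Γ (e a) t) • eDual a := rfl

theorem eta_kappa (s t : S) (v : V) : eta (kappa s t) v = symp s (Γ v t) := by
  conv_rhs => rw [← sum_apply_smul_e v]
  simp only [kappa_apply, map_sum, map_smul, LinearMap.sum_apply, LinearMap.smul_apply, eta_e_left,
    smul_eq_mul]
  exact Finset.sum_congr rfl fun a _ => mul_comm _ _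

theorem kappa_comm (s t : S) : kappa s t = kappa t s := by
  refine eta_left_ext fun u => ?_
  rw [eta_kappa, eta_kappa, symp_comm t, symp_Γ_left, neg_neg]

theorem kappa_spinRep {A : Module.End ℝ V} (hA : A ∈ so) (s t : S) :
    A (kappa s t) = kappa (spinRep A s) t + kappa s (spinRep A t) := by
  refine eta_left_ext fun u => ?_
  rw [map_add, LinearMap.add_apply, so_iff.1 hA, eta_kappa, eta_kappa, eta_kappa,
    symp_spinRep_left hA, ← spinRep_mul_Γ hA]
  simp only [LinearMap.sub_apply, Module.End.mul_apply, map_sub]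
  ring

/-! ### Equivariance of the Clifford action of four-vectors, of β and of γ -/

theorem cliff4_ιMulti (v : Fin 4 → V) : cliff4 (exteriorPower.ιMulti ℝ 4 v) = (1 / 24 : ℝ) •
    ∑ τ : Equiv.Perm (Fin 4), Equiv.Perm.sign τ •
      (Γ (v (τ 0)) * (Γ (v (τ 1)) * (Γ (v (τ 2)) * Γ (v (τ 3))))) := by
  simp [cliff4, MultilinearMap.alternatization_apply]

theorem extAct_ιMulti (k : ℕ) (A : Module.End ℝ V) (v : Fin k → V) :
    extAct k A (exteriorPower.ιMulti ℝ k v) =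
      ∑ i, exteriorPower.ιMulti ℝ k (fun j => if j = i then A (v j) else v j) := by
  simp only [extAct, exteriorPower.alternatingMapLinearEquiv_apply_ιMulti, AlternatingMap.coe_mk,
    sum_apply, MultilinearMap.compLinearMap_apply]
  refine Finset.sum_congr rfl fun i _ => congrArg _ (funext fun j => ?_)
  split_ifs <;> rfl

theorem cliff4_extAct {A : Module.End ℝ V} (hA : A ∈ so) (φ : ⋀[ℝ]^4 V) :
    cliff4 (extAct 4 A φ) = spinRep A * cliff4 φ - cliff4 φ * spinRep A := by
  have key : cliff4 ∘ₗ extAct 4 A =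
      (LinearMap.mulLeft ℝ (spinRep A) - LinearMap.mulRight ℝ (spinRep A)) ∘ₗ cliff4 := by
    refine exteriorPower.linearMap_ext (AlternatingMap.ext fun v => ?_)
    simp only [LinearMap.compAlternatingMap_apply, LinearMap.comp_apply, extAct_ιMulti, map_sum,
      cliff4_ιMulti, LinearMap.sub_apply, LinearMap.mulLeft_apply, LinearMap.mulRight_apply]
    rw [← Finset.smul_sum, Finset.sum_comm, mul_smul_sub_smul_mul, mul_sum_sub_sum_mul]
    refine congrArg _ (Finset.sum_congr rfl fun τ _ => ?_)
    -- Reindexing by τ turns "A acts on the vector i" into "A acts on the factor in position i of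
    -- the permuted product", which is the Leibniz rule.
    rw [← Finset.smul_sum, mul_zsmul_sub_zsmul_mul, ← Equiv.sum_comp τ]
    refine congrArg _ ?_
    simp only [EmbeddingLike.apply_eq_iff_eq, Fin.sum_univ_four]
    simp only [Fin.isValue, Fin.reduceEq, if_true, if_false, ← spinRep_mul_Γ hA]
    rw [mul_sub_mul_leibniz, mul_sub_mul_leibniz (spinRep A) (Γ (v (τ 1))),
      mul_sub_mul_leibniz (spinRep A) (Γ (v (τ 2)))]
    simp only [mul_add, add_assoc]
  exact LinearMap.congr_fun key φ

theorem beta_apply (φ : ⋀[ℝ]^4 V) (v : V) :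
    beta φ v = (1 / 24 : ℝ) • (Γ v * cliff4 φ - (3 : ℝ) • (cliff4 φ * Γ v)) := rfl

/-- If A annihilates φ then σ(A) commutes with the Clifford action of φ, so only the factor Γ(v) of
β feels A. -/
theorem spinRep_mul_beta {A : Module.End ℝ V} (hA : A ∈ so) {φ : ⋀[ℝ]^4 V}
    (hφ : extAct 4 A φ = 0) (v : V) :
    spinRep A * beta φ v = beta φ (A v) + beta φ v * spinRep A := by
  have h := cliff4_extAct hA φ
  rw [hφ, map_zero] at h
  have h' : spinRep A * cliff4 φ = cliff4 φ * spinRep A := (sub_eq_zero.1 h.symm)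
  have h'' : spinRep A * Γ v = Γ (A v) + Γ v * spinRep A := by rw [← spinRep_mul_Γ hA]; abel
  have e1 : spinRep A * (Γ v * cliff4 φ) =
      Γ (A v) * cliff4 φ + Γ v * cliff4 φ * spinRep A := by
    rw [← mul_assoc, h'', add_mul, mul_assoc, h', ← mul_assoc]
  have e2 : spinRep A * (cliff4 φ * Γ v) =
      cliff4 φ * Γ (A v) + cliff4 φ * Γ v * spinRep A := by
    rw [← mul_assoc, h', mul_assoc, h'', mul_add, ← mul_assoc]
  simp only [beta_apply, mul_smul_comm, smul_mul_assoc, mul_sub, sub_mul, e1, e2]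
  module

theorem gamma_apply (φ : ⋀[ℝ]^4 V) (s t : S) (v : V) :
    gamma φ s t v = -kappa (beta φ v s) t - kappa (beta φ v t) s := rfl

theorem gamma_comm (φ : ⋀[ℝ]^4 V) (s t : S) : gamma φ s t = gamma φ t s := by
  refine LinearMap.ext fun v => ?_
  rw [gamma_apply, gamma_apply]
  abel

theorem lie_gamma {A : Module.End ℝ V} (hA : A ∈ so) {φ : ⋀[ℝ]^4 V}
    (hφ : extAct 4 A φ = 0) (s t : S) :
    ⁅A, gamma φ s t⁆ = gamma φ (spinRep A s) t + gamma φ s (spinRep A t) := by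
  refine LinearMap.ext fun v => ?_
  have h : ∀ u, spinRep A (beta φ v u) = beta φ (A v) u + beta φ v (spinRep A u) := fun u =>
    LinearMap.congr_fun (spinRep_mul_beta hA hφ v) u
  simp only [Ring.lie_def, LinearMap.sub_apply, LinearMap.add_apply, Module.End.mul_apply,
    gamma_apply, map_sub, map_neg, kappa_spinRep hA, h, map_add]
  abel

/-! ### Forms attached to multivectors -/

theorem formOf_ιMulti (k : ℕ) (v w : Fin k → V) :
    formOf k (exteriorPower.ιMulti ℝ k v) w = (Matrix.of fun i j => eta (v j) (w i)).det := by
  have h : ∀ (f : ⋀[ℝ]^k V →ₗ[ℝ] ℝ), exteriorPower.alternatingMapLinearEquiv.symm f w =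
      f (exteriorPower.ιMulti ℝ k w) := fun f => by
    simp
  rw [formOf, h, exteriorPower.map_apply_ιMulti, exteriorPower.pairingDual_ιMulti_ιMulti]
  rfl

theorem formOf_add (k : ℕ) (φ ψ : ⋀[ℝ]^k V) : formOf k (φ + ψ) = formOf k φ + formOf k ψ := by
  simp [formOf]

theorem formOf_smul (k : ℕ) (c : ℝ) (φ : ⋀[ℝ]^k V) : formOf k (c • φ) = c • formOf k φ := by
  simp [formOf]

theorem formOf_zero (k : ℕ) : formOf k 0 = 0 := by
  simp [formOf]

theorem formOf_sum {ι : Type*} (t : Finset ι) (k : ℕ) (φ : ι → ⋀[ℝ]^k V) :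
    formOf k (∑ i ∈ t, φ i) = ∑ i ∈ t, formOf k (φ i) := by
  simp [formOf]

theorem alternatingMap_sum_apply {ι : Type*} (t : Finset ι) {k : ℕ} (f : ι → V [⋀^Fin k]→ₗ[ℝ] ℝ)
    (v : Fin k → V) : (∑ i ∈ t, f i) v = ∑ i ∈ t, f i v := by
  classical
  induction t using Finset.induction_on with
  | empty => simp
  | insert a t ha ih => rw [Finset.sum_insert ha, Finset.sum_insert ha, AlternatingMap.add_apply, ih]

/-- The action of `𝔰𝔬(V)` on forms is dual to the action on multivectors. -/
theorem sum_formOf_update {A : Module.End ℝ V} (hA : A ∈ so) {k : ℕ} (φ : ⋀[ℝ]^k V)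
    (w : Fin k → V) :
    ∑ i, formOf k φ (Function.update w i (A (w i))) = -formOf k (extAct k A φ) w := by
  have hφ : φ ∈ Submodule.span ℝ (Set.range (exteriorPower.ιMulti ℝ k (M := V))) := by
    rw [exteriorPower.ιMulti_span]; trivial
  induction hφ using Submodule.span_induction with
  | mem x hx =>
    obtain ⟨v, rfl⟩ := hx
    rw [extAct_ιMulti, formOf_sum, alternatingMap_sum_apply]
    simp only [formOf_ιMulti, Matrix.det_apply, Matrix.of_apply]
    rw [Finset.sum_comm, Finset.sum_comm (s := Finset.univ) (t := Finset.univ)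
      (f := fun (i : Fin k) (σ : Equiv.Perm (Fin k)) => Equiv.Perm.sign σ •
        ∏ j, eta (if j = i then A (v j) else v j) (w (σ j))), ← Finset.sum_neg_distrib]
    refine Finset.sum_congr rfl fun σ _ => ?_
    -- In the Leibniz term of σ the vector v m is paired with the argument in slot σ m; skewness
    -- moves A from one to the other at the price of a sign.
    rw [← Finset.smul_sum, ← Finset.smul_sum, ← smul_neg, ← Equiv.sum_comp σ,
      ← Finset.sum_neg_distrib]
    refine congrArg _ (Finset.sum_congr rfl fun m _ => ?_)
    rw [← Finset.mul_prod_erase _ _ (Finset.mem_univ m),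
      ← Finset.mul_prod_erase _ _ (Finset.mem_univ m)]
    simp only [Function.update_self, if_true, so_iff.1 hA, neg_mul, neg_neg]
    refine congrArg _ (Finset.prod_congr rfl fun j hj => ?_)
    have hj' := Finset.ne_of_mem_erase hj
    rw [Function.update_of_ne (fun h => hj' (σ.injective h)), if_neg hj']
  | zero => simp [formOf_zero]
  | add x y _ _ hx hy =>
    simp only [formOf_add, AlternatingMap.add_apply, map_add, Finset.sum_add_distrib, hx, hy]
    ring
  | smul c x _ hx =>
    simp only [formOf_smul, AlternatingMap.smul_apply, map_smul, ← Finset.smul_sum, hx, smul_neg]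

/-! ### The Clifford action of `φ` and the maps `β`, `κ` in quaternionic coordinates -/

theorem Γ_anticomm {v w : V} (h : eta v w = 0) : Γ v * Γ w = -(Γ w * Γ v) := by
  rw [Γ_mul_Γ, h]
  simp

/-- Orthogonal vectors anticommute in the Clifford algebra, so an adjacent transposition changes the
sign of the product. The adjacent transpositions generate the symmetric group, and the general case
is an induction on words in them. -/
theorem sign_smul_prod_Γ (τ : Equiv.Perm (Fin 4)) :
    ∀ v : Fin 4 → V, (∀ i j, i ≠ j → eta (v i) (v j) = 0) →
      Equiv.Perm.sign τ • (Γ (v (τ 0)) * (Γ (v (τ 1)) * (Γ (v (τ 2)) * Γ (v (τ 3))))) =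
        Γ (v 0) * (Γ (v 1) * (Γ (v 2) * Γ (v 3))) := by
  have key : ∀ (i : Fin 3) (v : Fin 4 → V), (∀ i j, i ≠ j → eta (v i) (v j) = 0) →
      Γ (v (Equiv.swap i.castSucc i.succ 0)) * (Γ (v (Equiv.swap i.castSucc i.succ 1)) *
        (Γ (v (Equiv.swap i.castSucc i.succ 2)) * Γ (v (Equiv.swap i.castSucc i.succ 3)))) =
      -(Γ (v 0) * (Γ (v 1) * (Γ (v 2) * Γ (v 3)))) := by
    intro i v hv
    have h01 := Γ_anticomm (hv 0 1 (by decide))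
    have h12 := Γ_anticomm (hv 1 2 (by decide))
    have h23 := Γ_anticomm (hv 2 3 (by decide))
    refine LinearMap.ext fun s => ?_
    have h01' : ∀ s, Γ (v 0) (Γ (v 1) s) = -Γ (v 1) (Γ (v 0) s) := LinearMap.congr_fun h01
    have h12' : ∀ s, Γ (v 1) (Γ (v 2) s) = -Γ (v 2) (Γ (v 1) s) := LinearMap.congr_fun h12
    have h23' : ∀ s, Γ (v 2) (Γ (v 3) s) = -Γ (v 3) (Γ (v 2) s) := LinearMap.congr_fun h23
    simp only [Module.End.mul_apply, LinearMap.neg_apply]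
    have d : ∀ (a b c : Fin 4), c ≠ a → c ≠ b → Equiv.swap a b c = c := fun a b c h h' =>
      Equiv.swap_apply_of_ne_of_ne h h'
    have e01 : Equiv.swap (0 : Fin 4) 1 2 = 2 ∧ Equiv.swap (0 : Fin 4) 1 3 = 3 := by decide
    have e12 : Equiv.swap (1 : Fin 4) 2 0 = 0 ∧ Equiv.swap (1 : Fin 4) 2 3 = 3 := by decide
    have e23 : Equiv.swap (2 : Fin 4) 3 0 = 0 ∧ Equiv.swap (2 : Fin 4) 3 1 = 1 := by decide
    fin_cases i
    · simp [e01, h01']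
    · simp [e12, h12']
    · simp [e23, h23']
  have hτ : τ ∈ Submonoid.closure
      (Set.range fun i : Fin 3 => Equiv.swap i.castSucc i.succ) := by
    rw [Equiv.Perm.mclosure_swap_castSucc_succ]; trivial
  induction hτ using Submonoid.closure_induction_right with
  | one => simp
  | mul_right x hx y hy ih =>
    obtain ⟨i, rfl⟩ := hy
    intro v hv
    have h := key i (fun j => v (x j)) (fun a b hab => hv _ _ fun h => hab (x.injective h))
    simp only [Equiv.Perm.mul_apply, map_mul] at h ⊢
    rw [h, Equiv.Perm.sign_swap (by simp [Fin.ext_iff]), ← ih v hv]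
    simp

/-- All 24 terms of the antisymmetrisation coincide, cancelling the factor 1/24. -/
theorem cliff4_of_orthogonal (v : Fin 4 → V) (hv : ∀ i j, i ≠ j → eta (v i) (v j) = 0) :
    cliff4 (exteriorPower.ιMulti ℝ 4 v) = Γ (v 0) * (Γ (v 1) * (Γ (v 2) * Γ (v 3))) := by
  rw [cliff4_ιMulti, Finset.sum_congr rfl fun τ _ => sign_smul_prod_Γ τ v hv, Finset.sum_const,
    Finset.card_univ, Fintype.card_perm, Fintype.card_fin]
  simp only [Nat.factorial]
  refine LinearMap.ext fun s => ?_
  simp only [LinearMap.smul_apply, ← Nat.cast_smul_eq_nsmul ℝ]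
  module

/-- The space `ℍ⁴`. -/
abbrev H4 := Fin 4 → ℍ[ℝ]

/-- The quaternion `i`. -/
def qI : ℍ[ℝ] := ⟨0, 1, 0, 0⟩

@[simp] theorem qI_re : qI.re = 0 := rfl

@[simp] theorem qI_imI : qI.imI = 1 := rfl

@[simp] theorem qI_imJ : qI.imJ = 0 := rfl

@[simp] theorem qI_imK : qI.imK = 0 := rfl

/-- The endomorphism `diag(L_i, 0, -L_i, 0)` of `ℍ⁴`, which is half of `γ₁(γ₂γ₃ + γ₄γ₅)` up to
sign. -/
def JJ : H4 →ₗ[ℝ] H4 where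
  toFun x := ![qI * x 0, 0, -(qI * x 2), 0]
  map_add' x y := by
    funext k
    fin_cases k <;> simp [mul_add]
    abel
  map_smul' c x := by
    funext k
    fin_cases k <;> simp

/-- Clifford multiplication on `ℍ⁴` as a bilinear map. -/
def gam : V →ₗ[ℝ] H4 →ₗ[ℝ] H4 :=
  LinearMap.mk₂ ℝ gammaNine gammaNine_add_left gammaNine_smul_left gammaNine_add_right
    gammaNine_smul_right

theorem Γ_eq (v : V) (s : S) : Γ v s =
    (gam v s.1 + (√2 * v 0) • s.2, -((√2 * v 10) • s.1) - gam v s.2) := rfl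

theorem H4_ext {x y : H4} (h0 : x 0 = y 0) (h1 : x 1 = y 1) (h2 : x 2 = y 2) (h3 : x 3 = y 3) :
    x = y := by
  funext k
  fin_cases k <;> assumption

@[simp] theorem gam_apply_zero (v : V) (x : H4) :
    gam v x 0 = v 1 • x 0 + quatA v * x 1 + x 2 * quatB v := rfl

@[simp] theorem gam_apply_one (v : V) (x : H4) :
    gam v x 1 = star (quatA v) * x 0 - v 1 • x 1 + x 3 * quatB v := rfl

@[simp] theorem gam_apply_two (v : V) (x : H4) :
    gam v x 2 = x 0 * star (quatB v) - v 1 • x 2 - quatA v * x 3 := rfl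

@[simp] theorem gam_apply_three (v : V) (x : H4) :
    gam v x 3 = x 1 * star (quatB v) - star (quatA v) * x 2 + v 1 • x 3 := rfl

@[simp] theorem JJ_apply_zero (x : H4) : JJ x 0 = qI * x 0 := rfl

@[simp] theorem JJ_apply_one (x : H4) : JJ x 1 = 0 := rfl

@[simp] theorem JJ_apply_two (x : H4) : JJ x 2 = -(qI * x 2) := rfl

@[simp] theorem JJ_apply_three (x : H4) : JJ x 3 = 0 := rfl

theorem e_apply (a b : Fin 11) : e a b = if b = a then 1 else 0 := by
  simp [e, Pi.single_apply]

/-- The quaternion `j`. -/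
def qJ : ℍ[ℝ] := ⟨0, 0, 1, 0⟩

@[simp] theorem qJ_re : qJ.re = 0 := rfl

@[simp] theorem qJ_imI : qJ.imI = 0 := rfl

@[simp] theorem qJ_imJ : qJ.imJ = 1 := rfl

@[simp] theorem qJ_imK : qJ.imK = 0 := rfl

/-- The quaternion `k`. -/
def qK : ℍ[ℝ] := ⟨0, 0, 0, 1⟩

@[simp] theorem qK_re : qK.re = 0 := rfl

@[simp] theorem qK_imI : qK.imI = 0 := rfl

@[simp] theorem qK_imJ : qK.imJ = 0 := rfl

@[simp] theorem qK_imK : qK.imK = 1 := rfl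

theorem gam_e_one (x : H4) : gam (e 1) x = ![x 0, -x 1, -x 2, x 3] := by
  have hA : quatA (e 1) = 0 := by ext <;> simp [e_apply]
  have hB : quatB (e 1) = 0 := by ext <;> simp [e_apply]
  refine H4_ext ?_ ?_ ?_ ?_ <;> simp [hA, hB, e_apply]

theorem gam_of_quatA {v : V} (h : v 1 = 0) (hB : quatB v = 0) (x : H4) :
    gam v x = ![quatA v * x 1, star (quatA v) * x 0, -(quatA v * x 3),
      -(star (quatA v) * x 2)] := by
  refine H4_ext ?_ ?_ ?_ ?_ <;> simp [h, hB]

/-- Because jk = i, the bivectors e_23 and e_45 act in the same way on components 0 and 2 and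
oppositely on components 1 and 3. The sum therefore kills components 1, 3, and γ_1 gives components
0 and 2 opposite signs. -/
theorem gam_triples (x : H4) :
    gam (e 1) (gam (e 2) (gam (e 3) x)) + gam (e 1) (gam (e 4) (gam (e 5) x)) =
      -((2 : ℝ) • JJ x) := by
  have h2 : quatA (e 2) = 1 := by ext <;> simp [e_apply]
  have h3 : quatA (e 3) = qI := by ext <;> simp [e_apply]
  have h4 : quatA (e 4) = qJ := by ext <;> simp [e_apply]
  have h5 : quatA (e 5) = qK := by ext <;> simp [e_apply]
  have b2 : quatB (e 2) = 0 := by ext <;> simp [e_apply]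
  have b3 : quatB (e 3) = 0 := by ext <;> simp [e_apply]
  have b4 : quatB (e 4) = 0 := by ext <;> simp [e_apply]
  have b5 : quatB (e 5) = 0 := by ext <;> simp [e_apply]
  have sI : star qI = -qI := by ext <;> simp
  have sJ : star qJ = -qJ := by ext <;> simp
  have sK : star qK = -qK := by ext <;> simp
  have hJK : ∀ y, qJ * (qK * y) = qI * y := by
    intro y
    rw [← mul_assoc]
    congr 1
    ext <;> simp
  rw [gam_of_quatA (by simp [e_apply]) b2, gam_of_quatA (by simp [e_apply]) b3,
    gam_of_quatA (by simp [e_apply]) b4, gam_of_quatA (by simp [e_apply]) b5, gam_e_one,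
    gam_e_one, h2, h3, h4, h5, sI, sJ, sK]
  refine H4_ext ?_ ?_ ?_ ?_ <;> simp [hJK, two_smul]

theorem Γ_ePlus (s : S) : Γ ePlus s = (√2 • s.2, 0) := by
  have h : gam ePlus = 0 := by
    refine LinearMap.ext fun x => H4_ext ?_ ?_ ?_ ?_ <;> ext <;> simp [e_apply]
  rw [Γ_eq, h]
  simp [e_apply]

theorem Γ_transverse {v : V} (h0 : v 0 = 0) (h10 : v 10 = 0) (s : S) :
    Γ v s = (gam v s.1, -gam v s.2) := by
  rw [Γ_eq, h0, h10]
  simp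

/-- Γ_+ reads only s_-, on which the three transverse factors carry the sign (-1)³; this turns the
-2J of `gam_triples` into +2√2 J. -/
theorem cliff4_phi0 (s : S) : cliff4 phi0 s = ((2 * √2) • JJ s.2, 0) := by
  have h1 : cliff4 (exteriorPower.ιMulti ℝ 4 ![ePlus, e 1, e 2, e 3]) =
      Γ ePlus * (Γ (e 1) * (Γ (e 2) * Γ (e 3))) := by
    refine cliff4_of_orthogonal _ fun i j hij => ?_
    fin_cases i <;> fin_cases j <;> simp [eta_apply, e_apply] at hij ⊢
  have h2 : cliff4 (exteriorPower.ιMulti ℝ 4 ![ePlus, e 1, e 4, e 5]) =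
      Γ ePlus * (Γ (e 1) * (Γ (e 4) * Γ (e 5))) := by
    refine cliff4_of_orthogonal _ fun i j hij => ?_
    fin_cases i <;> fin_cases j <;> simp [eta_apply, e_apply] at hij ⊢
  have h3 : ∀ i ∈ Set.Icc (1 : Fin 11) 9, ∀ s : S, Γ (e i) s = (gam (e i) s.1, -gam (e i) s.2) := by
    intro i hi s
    exact Γ_transverse (by rw [e_apply, if_neg (by rintro rfl; simp at hi)])
      (by rw [e_apply, if_neg (by rintro rfl; simp at hi)]) s
  have g1 := h3 1 (by simp)
  have g2 := h3 2 (by simp)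
  have g3 := h3 3 (by simp)
  have g4 := h3 4 (by simp)
  have g5 := h3 5 (by simp)
  rw [phi0, map_add, h1, h2]
  simp only [LinearMap.add_apply, Module.End.mul_apply, g1, g2, g3, g4, g5, Γ_ePlus, map_neg]
  ext1
  · have := gam_triples s.2
    simp only [Prod.mk_add_mk, neg_neg]
    linear_combination (norm := module) (-√2) • this
  · simp

/-- The transverse part of `β^φ(v, ·)`, up to a factor. -/
def BB (v : V) : H4 →ₗ[ℝ] H4 := gam v ∘ₗ JJ + (3 : ℝ) • JJ ∘ₗ gam v

theorem BB_apply (v : V) (x : H4) : BB v x = gam v (JJ x) + (3 : ℝ) • JJ (gam v x) := rfl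

theorem sqrt2_mul : √2 * √2 = 2 := Real.mul_self_sqrt (by norm_num)

/-- The component of v along e_+ disappears, as e_+ annihilates φ on both sides. The weights 1/2 and
-1/6 of J reflect the coefficients -3 and 1 in β; they become the frequencies of the Killing spinors
and determine the curvature. -/
theorem beta_phi0 (v : V) (s : S) : beta phi0 v s =
    ((√2 / 12) • BB v s.2 + (v 10 / 2) • JJ s.1, -((v 10 / 6) • JJ s.2)) := by
  simp only [beta_apply, LinearMap.smul_apply, LinearMap.sub_apply, Module.End.mul_apply,
    cliff4_phi0, Γ_eq, BB_apply, map_smul, map_sub, map_neg, map_zero]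
  ext1
  · simp only [Prod.smul_fst, Prod.fst_sub]
    linear_combination (norm := module) (v 10 / 4 * sqrt2_mul) • JJ s.1
  · simp only [Prod.smul_snd, Prod.snd_sub]
    linear_combination (norm := module) (-v 10 / 12 * sqrt2_mul) • JJ s.2

/-- The standard inner product of `ℍ⁴ = ℝ¹⁶`. -/
def dot (x y : H4) : ℝ := ∑ k, inner ℝ (x k) (y k)

theorem dot_apply (x y : H4) : dot x y = inner ℝ (x 0) (y 0) + inner ℝ (x 1) (y 1) +
    inner ℝ (x 2) (y 2) + inner ℝ (x 3) (y 3) := by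
  rw [dot, Fin.sum_univ_four]

theorem kappa_coord (s t : S) (a : Fin 11) : kappa s t a = symp s (Γ (eDual a) t) := by
  rw [← eta_kappa, eta_e_right]

theorem symp_eq (s t : S) : symp s t = dot s.1 t.2 - dot s.2 t.1 := by
  rw [symp_apply, Finset.sum_sub_distrib, dot, dot]

theorem dot_smul_right (c : ℝ) (x y : H4) : dot x (c • y) = c * dot x y := by
  simp [dot, Finset.mul_sum, real_inner_smul_right]

theorem dot_add_right (x y z : H4) : dot x (y + z) = dot x y + dot x z := by
  simp [dot, inner_add_right, Finset.sum_add_distrib]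

theorem dot_comm (x y : H4) : dot x y = dot y x := by
  simp [dot, real_inner_comm]

theorem dot_neg_right (x y : H4) : dot x (-y) = -dot x y := by
  simp [dot]

theorem symp_Γ (v : V) (s t : S) : symp s (Γ v t) = -√2 * v 10 * dot s.1 t.1
    - √2 * v 0 * dot s.2 t.2 - dot s.1 (gam v t.2) - dot s.2 (gam v t.1) := by
  rw [symp_eq, Γ_eq]
  simp only [sub_eq_add_neg, dot_add_right, dot_neg_right, dot_smul_right]
  ring

theorem dot_gam_comm (v : V) (x y : H4) : dot x (gam v y) = dot y (gam v x) := by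
  simp [dot_apply, inner_quat]
  ring

theorem gam_e_zero : gam (e 0) = 0 := by
  refine LinearMap.ext fun x => H4_ext ?_ ?_ ?_ ?_ <;> ext <;> simp [e_apply]

theorem gam_e_ten : gam (e 10) = 0 := by
  refine LinearMap.ext fun x => H4_ext ?_ ?_ ?_ ?_ <;> ext <;> simp [e_apply]

theorem dot_zero_right (x : H4) : dot x 0 = 0 := by
  simp [dot]

theorem kappa_zero_coord (s t : S) : kappa s t 0 = -√2 * dot s.1 t.1 := by
  rw [kappa_coord, symp_Γ]
  simp [eDual, e_apply, gam_e_ten, dot_zero_right]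

theorem kappa_ten_coord (s t : S) : kappa s t 10 = -√2 * dot s.2 t.2 := by
  rw [kappa_coord, symp_Γ]
  simp [eDual, e_apply, gam_e_zero, dot_zero_right]

theorem kappa_transverse_coord {a : Fin 11} (h0 : a ≠ 0) (h10 : a ≠ 10) (s t : S) :
    kappa s t a = dot s.1 (gam (e a) t.2) + dot t.1 (gam (e a) s.2) := by
  rw [kappa_coord, symp_Γ, dot_gam_comm (eDual a) s.2]
  simp [eDual, e_apply, h0, h10, Ne.symm h0, Ne.symm h10, dot_neg_right]

/-- The components of the transverse part of the Dirac current. -/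
def kap1 (x y : H4) : ℝ :=
  inner ℝ (x 0) (y 0) - inner ℝ (x 1) (y 1) - inner ℝ (x 2) (y 2) + inner ℝ (x 3) (y 3)

/-- The components of the transverse part of the Dirac current. -/
def kapA (x y : H4) : ℍ[ℝ] :=
  x 0 * star (y 1) + y 0 * star (x 1) - x 2 * star (y 3) - y 2 * star (x 3)

/-- The components of the transverse part of the Dirac current. -/
def kapB (x y : H4) : ℍ[ℝ] :=
  star (y 2) * x 0 + star (y 3) * x 1 + star (x 2) * y 0 + star (x 3) * y 1

theorem kap1_eq (x y : H4) : kap1 x y = dot x (gam (e 1) y) := by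
  simp [kap1, dot_apply, inner_quat, e_apply]
  ring

theorem kapA_re (x y : H4) : (kapA x y).re = dot x (gam (e 2) y) := by
  simp [kapA, dot_apply, inner_quat, e_apply]
  ring

theorem kapA_imI (x y : H4) : (kapA x y).imI = dot x (gam (e 3) y) := by
  simp [kapA, dot_apply, inner_quat, e_apply]
  ring

theorem kapA_imJ (x y : H4) : (kapA x y).imJ = dot x (gam (e 4) y) := by
  simp [kapA, dot_apply, inner_quat, e_apply]
  ring

theorem kapA_imK (x y : H4) : (kapA x y).imK = dot x (gam (e 5) y) := by
  simp [kapA, dot_apply, inner_quat, e_apply]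
  ring

theorem kapB_re (x y : H4) : (kapB x y).re = dot x (gam (e 6) y) := by
  simp [kapB, dot_apply, inner_quat, e_apply]
  ring

theorem kapB_imI (x y : H4) : (kapB x y).imI = dot x (gam (e 7) y) := by
  simp [kapB, dot_apply, inner_quat, e_apply]
  ring

theorem kapB_imJ (x y : H4) : (kapB x y).imJ = dot x (gam (e 8) y) := by
  simp [kapB, dot_apply, inner_quat, e_apply]
  ring

theorem kapB_imK (x y : H4) : (kapB x y).imK = dot x (gam (e 9) y) := by
  simp [kapB, dot_apply, inner_quat, e_apply]
  ring

theorem kappa_one_coord (s t : S) : kappa s t 1 = kap1 s.1 t.2 + kap1 t.1 s.2 := by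
  rw [kappa_transverse_coord (by decide) (by decide), kap1_eq, kap1_eq]

theorem quatA_kappa (s t : S) : quatA (kappa s t) = kapA s.1 t.2 + kapA t.1 s.2 := by
  ext
  · simp [kapA_re, kappa_transverse_coord]
  · simp [kapA_imI, kappa_transverse_coord]
  · simp [kapA_imJ, kappa_transverse_coord]
  · simp [kapA_imK, kappa_transverse_coord]

theorem quatB_kappa (s t : S) : quatB (kappa s t) = kapB s.1 t.2 + kapB t.1 s.2 := by
  ext
  · simp [kapB_re, kappa_transverse_coord]
  · simp [kapB_imI, kappa_transverse_coord]
  · simp [kapB_imJ, kappa_transverse_coord]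
  · simp [kapB_imK, kappa_transverse_coord]

/-! ### Normal forms for the isotropy algebra -/

/-- The vector with given components along `e_+`, `e_1`, `E^⊤`, `E^⊥`, `e_-`. -/
def mkV (r₀ r₁ : ℝ) (a b : ℍ[ℝ]) (r₁₀ : ℝ) : V :=
  ![r₀, r₁, a.re, a.imI, a.imJ, a.imK, b.re, b.imI, b.imJ, b.imK, r₁₀]

section

variable (r₀ r₁ : ℝ) (a b : ℍ[ℝ]) (r₁₀ : ℝ)

@[simp] theorem mkV_zero : mkV r₀ r₁ a b r₁₀ 0 = r₀ := rfl

@[simp] theorem mkV_one : mkV r₀ r₁ a b r₁₀ 1 = r₁ := rfl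

@[simp] theorem mkV_two : mkV r₀ r₁ a b r₁₀ 2 = a.re := rfl

@[simp] theorem mkV_three : mkV r₀ r₁ a b r₁₀ 3 = a.imI := rfl

@[simp] theorem mkV_four : mkV r₀ r₁ a b r₁₀ 4 = a.imJ := rfl

@[simp] theorem mkV_five : mkV r₀ r₁ a b r₁₀ 5 = a.imK := rfl

@[simp] theorem mkV_six : mkV r₀ r₁ a b r₁₀ 6 = b.re := rfl

@[simp] theorem mkV_seven : mkV r₀ r₁ a b r₁₀ 7 = b.imI := rfl

@[simp] theorem mkV_eight : mkV r₀ r₁ a b r₁₀ 8 = b.imJ := rfl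

@[simp] theorem mkV_nine : mkV r₀ r₁ a b r₁₀ 9 = b.imK := rfl

@[simp] theorem mkV_ten : mkV r₀ r₁ a b r₁₀ 10 = r₁₀ := rfl

@[simp] theorem quatA_mkV : quatA (mkV r₀ r₁ a b r₁₀) = a := rfl

@[simp] theorem quatB_mkV : quatB (mkV r₀ r₁ a b r₁₀) = b := rfl

end

@[simp] theorem quatA_zero : quatA 0 = 0 := rfl

@[simp] theorem quatB_zero : quatB 0 = 0 := rfl

theorem quatA_neg (v : V) : quatA (-v) = -quatA v := rfl

theorem quatB_neg (v : V) : quatB (-v) = -quatB v := rfl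

theorem quatA_sub (v w : V) : quatA (v - w) = quatA v - quatA w := rfl

theorem quatB_sub (v w : V) : quatB (v - w) = quatB v - quatB w := rfl

/-- The endomorphism of `V` given by `l L_i` on `E^⊤`, by `L_y + R_x` on `E^⊥`, and by `e_+ ∧ w`. -/
def nf (l : ℝ) (y x : ℍ[ℝ]) (w : V) : Module.End ℝ V where
  toFun v := mkV (w 1 * v 1 + (w 2 * v 2 + w 3 * v 3 + w 4 * v 4 + w 5 * v 5)
      + (w 6 * v 6 + w 7 * v 7 + w 8 * v 8 + w 9 * v 9)) (v 10 * w 1)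
    (l • (qI * quatA v) + v 10 • quatA w) (y * quatB v + quatB v * x + v 10 • quatB w) 0
  map_add' v v' := by
    refine V_ext ?_ ?_ ?_ ?_ ?_ <;> simp [quatA_add, quatB_add, mul_add, add_mul, add_smul]
    · ring
    · abel
    · abel
  map_smul' c v := by
    refine V_ext ?_ ?_ ?_ ?_ ?_ <;> simp [quatA_smul, quatB_smul, smul_add, mul_smul]
    · ring
    · ring
    · rw [smul_comm]

theorem nf_apply (l : ℝ) (y x : ℍ[ℝ]) (w v : V) : nf l y x w v =
    mkV (w 1 * v 1 + (w 2 * v 2 + w 3 * v 3 + w 4 * v 4 + w 5 * v 5)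
      + (w 6 * v 6 + w 7 * v 7 + w 8 * v 8 + w 9 * v 9)) (v 10 * w 1)
    (l • (qI * quatA v) + v 10 • quatA w) (y * quatB v + quatB v * x + v 10 • quatB w) 0 := rfl

theorem wedge_ePlus {w : V} (h0 : w 0 = 0) (h10 : w 10 = 0) : wedge ePlus w = nf 0 0 0 w := by
  refine LinearMap.ext fun v => ?_
  refine V_ext ?_ ?_ ?_ ?_ ?_
  · simp [wedge_apply, nf_apply, eta_apply, e_apply, h0, h10]
  · simp [wedge_apply, nf_apply, eta_apply, e_apply, h10]
  · simp [wedge_apply, nf_apply, eta_apply, e_apply]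
  · ext <;> simp [wedge_apply, nf_apply, eta_apply, e_apply]
  · ext <;> simp [wedge_apply, nf_apply, eta_apply, e_apply]

/-- L_y and R_x with y, x imaginary span the two commuting 𝔰𝔲(2) ideals of 𝔰𝔬(E^⊥); the combinations
of y and x are the coordinates of L_y + R_x in the basis of bivectors e_ab. -/
theorem nf_eq_wedges (l : ℝ) {y x : ℍ[ℝ]} (hy : y.re = 0) (hx : x.re = 0) {w : V} (h0 : w 0 = 0)
    (h10 : w 10 = 0) : nf l y x w = -(l • (wedge (e 2) (e 3) + wedge (e 4) (e 5)))
      - ((y.imI + x.imI) • wedge (e 6) (e 7) + (y.imI - x.imI) • wedge (e 8) (e 9)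
        + (y.imJ + x.imJ) • wedge (e 6) (e 8) - (y.imJ - x.imJ) • wedge (e 7) (e 9)
        + (y.imK + x.imK) • wedge (e 6) (e 9) + (y.imK - x.imK) • wedge (e 7) (e 8))
      + wedge ePlus w := by
  rw [wedge_ePlus h0 h10]
  refine LinearMap.ext fun v => ?_
  refine V_ext ?_ ?_ ?_ ?_ ?_
  · simp [wedge_apply, nf_apply, eta_apply, e_apply]
  · simp [wedge_apply, nf_apply, eta_apply, e_apply]
  · simp [wedge_apply, nf_apply, eta_apply, e_apply]
  · ext <;> simp [wedge_apply, nf_apply, eta_apply, e_apply]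
  · ext <;> simp [wedge_apply, nf_apply, eta_apply, e_apply, hx, hy] <;> ring

theorem spinRep_wedge (v w : V) :
    spinRep (wedge v w) = (1 / 4 : ℝ) • (Γ v * Γ w - Γ w * Γ v) := by
  have h : ∀ a, Γ (eDual a) * Γ (wedge v w (e a)) =
      eta (e a) v • (Γ (eDual a) * Γ w) - eta (e a) w • (Γ (eDual a) * Γ v) := by
    intro a
    rw [wedge_apply, map_sub, map_smul, map_smul, eta_comm v, eta_comm w]
    refine LinearMap.ext fun s => ?_
    simp
  have h' : ∀ x y : V, ∑ a, eta (e a) x • (Γ (eDual a) * Γ y) = Γ x * Γ y := by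
    intro x y
    conv_rhs => rw [← sum_eta_e_smul_eDual x]
    rw [map_sum, Finset.sum_mul]
    refine Finset.sum_congr rfl fun a _ => ?_
    rw [map_smul, smul_mul_assoc]
  rw [spinRep_apply, Finset.sum_congr rfl fun a _ => h a, Finset.sum_sub_distrib, h', h']

theorem spinRep_wedge_e {i j : Fin 11} (hij : i ≠ j) (hi : i ∈ Set.Icc (1 : Fin 11) 9)
    (hj : j ∈ Set.Icc (1 : Fin 11) 9) (s : S) : spinRep (wedge (e i) (e j)) s =
    (1 / 2 : ℝ) • (gam (e i) (gam (e j) s.1), gam (e i) (gam (e j) s.2)) := by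
  have hi0 : e i 0 = 0 := by rw [e_apply, if_neg (by rintro rfl; simp at hi)]
  have hi10 : e i 10 = 0 := by rw [e_apply, if_neg (by rintro rfl; simp at hi)]
  have hj0 : e j 0 = 0 := by rw [e_apply, if_neg (by rintro rfl; simp at hj)]
  have hj10 : e j 10 = 0 := by rw [e_apply, if_neg (by rintro rfl; simp at hj)]
  have h : eta (e j) (e i) = 0 := by
    simp only [eta_apply, hj0, hj10, e_apply]
    clear hi0 hi10 hj0 hj10 hi hj
    fin_cases i <;> fin_cases j <;> simp at hij ⊢
  rw [spinRep_wedge, Γ_anticomm h]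
  simp only [LinearMap.smul_apply, LinearMap.sub_apply, LinearMap.neg_apply, Module.End.mul_apply,
    Γ_transverse hi0 hi10, Γ_transverse hj0 hj10, map_neg, neg_neg]
  module

theorem spinRep_wedge_ePlus {w : V} (h0 : w 0 = 0) (h10 : w 10 = 0) (s : S) :
    spinRep (wedge ePlus w) s = (-(√2 / 2) • gam w s.2, 0) := by
  have h : eta w ePlus = 0 := by simp [eta_apply, e_apply, h10]
  rw [spinRep_wedge, Γ_anticomm h]
  simp only [LinearMap.smul_apply, LinearMap.sub_apply, LinearMap.neg_apply, Module.End.mul_apply,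
    Γ_transverse h0 h10, Γ_ePlus]
  ext1
  · simp only [Prod.smul_fst, Prod.fst_sub, Prod.fst_neg, smul_neg]
    module
  · simp

/-- The action of `nf l y x 0` on each of the two halves of the spinor space. -/
def sigH (l : ℝ) (y x : ℍ[ℝ]) (h : H4) : H4 :=
  ![l • (qI * h 0) + h 0 * x, h 1 * x, l • (qI * h 2) - h 2 * y, -(h 3 * y)]

theorem gam_of_quatB {v : V} (h : v 1 = 0) (hA : quatA v = 0) (x : H4) :
    gam v x = ![x 2 * quatB v, x 3 * quatB v, x 0 * star (quatB v), x 1 * star (quatB v)] := by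
  refine H4_ext ?_ ?_ ?_ ?_ <;> simp [h, hA]

theorem sigH_eq (l : ℝ) {y x : ℍ[ℝ]} (hy : y.re = 0) (hx : x.re = 0) (h : H4) :
    sigH l y x h = -((l / 2) • (gam (e 2) (gam (e 3) h) + gam (e 4) (gam (e 5) h)))
      - (1 / 2 : ℝ) • ((y.imI + x.imI) • gam (e 6) (gam (e 7) h)
        + (y.imI - x.imI) • gam (e 8) (gam (e 9) h)
        + (y.imJ + x.imJ) • gam (e 6) (gam (e 8) h) - (y.imJ - x.imJ) • gam (e 7) (gam (e 9) h)
        + (y.imK + x.imK) • gam (e 6) (gam (e 9) h)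
        + (y.imK - x.imK) • gam (e 7) (gam (e 8) h)) := by
  have h2 : quatA (e 2) = 1 := by ext <;> simp [e_apply]
  have h3 : quatA (e 3) = qI := by ext <;> simp [e_apply]
  have h4 : quatA (e 4) = qJ := by ext <;> simp [e_apply]
  have h5 : quatA (e 5) = qK := by ext <;> simp [e_apply]
  have h6 : quatB (e 6) = 1 := by ext <;> simp [e_apply]
  have h7 : quatB (e 7) = qI := by ext <;> simp [e_apply]
  have h8 : quatB (e 8) = qJ := by ext <;> simp [e_apply]
  have h9 : quatB (e 9) = qK := by ext <;> simp [e_apply]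
  have b2 : quatB (e 2) = 0 := by ext <;> simp [e_apply]
  have b3 : quatB (e 3) = 0 := by ext <;> simp [e_apply]
  have b4 : quatB (e 4) = 0 := by ext <;> simp [e_apply]
  have b5 : quatB (e 5) = 0 := by ext <;> simp [e_apply]
  have b6 : quatA (e 6) = 0 := by ext <;> simp [e_apply]
  have b7 : quatA (e 7) = 0 := by ext <;> simp [e_apply]
  have b8 : quatA (e 8) = 0 := by ext <;> simp [e_apply]
  have b9 : quatA (e 9) = 0 := by ext <;> simp [e_apply]
  have sI : star qI = -qI := by ext <;> simp
  have sJ : star qJ = -qJ := by ext <;> simp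
  have sK : star qK = -qK := by ext <;> simp
  rw [gam_of_quatA (by simp [e_apply]) b2, gam_of_quatA (by simp [e_apply]) b3,
    gam_of_quatA (by simp [e_apply]) b4, gam_of_quatA (by simp [e_apply]) b5]
  simp only [gam_of_quatB (show e 6 1 = 0 by simp [e_apply]) b6,
    gam_of_quatB (show e 7 1 = 0 by simp [e_apply]) b7,
    gam_of_quatB (show e 8 1 = 0 by simp [e_apply]) b8,
    gam_of_quatB (show e 9 1 = 0 by simp [e_apply]) b9, h2, h3, h4, h5, h6, h7, h8, h9, sI, sJ, sK]
  refine H4_ext ?_ ?_ ?_ ?_ <;> ext <;>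
    simp only [sigH, hx, hy, Pi.add_apply, Pi.sub_apply, Pi.neg_apply, Pi.smul_apply,
      Matrix.cons_val_zero, Matrix.cons_val_one, Matrix.cons_val, Quaternion.re_add,
      Quaternion.imI_add, Quaternion.imJ_add, Quaternion.imK_add, Quaternion.re_sub,
      Quaternion.imI_sub, Quaternion.imJ_sub, Quaternion.imK_sub, Quaternion.re_neg,
      Quaternion.imI_neg, Quaternion.imJ_neg, Quaternion.imK_neg, Quaternion.re_mul,
      Quaternion.imI_mul, Quaternion.imJ_mul, Quaternion.imK_mul, Quaternion.re_smul,
      Quaternion.imI_smul, Quaternion.imJ_smul, Quaternion.imK_smul, qI_re, qI_imI, qI_imJ,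
      qI_imK, smul_eq_mul, qJ_re, qJ_imI, qJ_imJ, qJ_imK, qK_re, qK_imI, qK_imJ, qK_imK,
      Quaternion.re_one, Quaternion.imI_one, Quaternion.imJ_one, Quaternion.imK_one, star_one] <;> ring

theorem spinRep_nf (l : ℝ) {y x : ℍ[ℝ]} (hy : y.re = 0) (hx : x.re = 0) {w : V} (h0 : w 0 = 0)
    (h10 : w 10 = 0) (s : S) : spinRep (nf l y x w) s =
    (sigH l y x s.1 - (√2 / 2) • gam w s.2, sigH l y x s.2) := by
  have g : ∀ i j : Fin 11, i ≠ j → i ∈ Set.Icc (1 : Fin 11) 9 → j ∈ Set.Icc (1 : Fin 11) 9 →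
    spinRep (wedge (e i) (e j)) s =
    (1 / 2 : ℝ) • (gam (e i) (gam (e j) s.1), gam (e i) (gam (e j) s.2)) := fun i j a b c =>
      spinRep_wedge_e a b c s
  rw [nf_eq_wedges l hy hx h0 h10, sigH_eq l hy hx, sigH_eq l hy hx]
  simp only [map_add, map_sub, map_neg, map_smul, LinearMap.add_apply, LinearMap.sub_apply,
    LinearMap.neg_apply, LinearMap.smul_apply, spinRep_wedge_ePlus h0 h10]
  rw [g 2 3 (by decide) (by simp) (by simp), g 4 5 (by decide) (by simp) (by simp),
    g 6 7 (by decide) (by simp) (by simp), g 8 9 (by decide) (by simp) (by simp),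
    g 6 8 (by decide) (by simp) (by simp), g 7 9 (by decide) (by simp) (by simp),
    g 6 9 (by decide) (by simp) (by simp), g 7 8 (by decide) (by simp) (by simp)]
  ext1
  · simp only [Prod.smul_fst, Prod.fst_sub, Prod.fst_neg, Prod.fst_add]
    module
  · simp only [Prod.smul_snd, Prod.snd_sub, Prod.snd_neg, Prod.snd_add]
    module

/-! ### The map `γ^φ` -/

/-- The transverse vector `K` with `(K, v) = (x, γ(v) y)`. -/
def Kv : H4 →ₗ[ℝ] H4 →ₗ[ℝ] V :=
  LinearMap.mk₂ ℝ (fun x y => mkV 0 (kap1 x y) (kapA x y) (kapB x y) 0)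
    (by
      intro x x' y
      refine V_ext ?_ ?_ ?_ ?_ ?_
      · simp
      · simp
      · simp [kap1, inner_add_left]; ring
      · simp [quatA_add, kapA, add_mul, mul_add]; abel
      · simp [quatB_add, kapB, add_mul, mul_add]; abel)
    (by
      intro c x y
      refine V_ext ?_ ?_ ?_ ?_ ?_
      · simp
      · simp
      · simp [kap1, real_inner_smul_left]; ring
      · simp [quatA_smul, kapA, smul_sub, smul_add]
      · simp [quatB_smul, kapB, smul_add])
    (by
      intro x x' y
      refine V_ext ?_ ?_ ?_ ?_ ?_
      · simp
      · simp
      · simp [kap1, inner_add_right]; ring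
      · simp [quatA_add, kapA, add_mul, mul_add]; abel
      · simp [quatB_add, kapB, add_mul, mul_add]; abel)
    (by
      intro c x y
      refine V_ext ?_ ?_ ?_ ?_ ?_
      · simp
      · simp
      · simp [kap1, real_inner_smul_right]; ring
      · simp [quatA_smul, kapA, smul_sub, smul_add]
      · simp [quatB_smul, kapB, smul_add])

theorem Kv_apply (x y : H4) : Kv x y = mkV 0 (kap1 x y) (kapA x y) (kapB x y) 0 := rfl

theorem kappa_eq (s t : S) : kappa s t = -(√2 * dot s.1 t.1) • e 0 - (√2 * dot s.2 t.2) • e 10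
    + Kv s.1 t.2 + Kv t.1 s.2 := by
  refine V_ext ?_ ?_ ?_ ?_ ?_
  · simp [kappa_zero_coord, e_apply, Kv_apply]
  · simp [kappa_ten_coord, e_apply, Kv_apply]
  · simp [kappa_one_coord, e_apply, Kv_apply]
  · rw [quatA_kappa]
    ext <;> simp [e_apply, Kv_apply]
  · rw [quatB_kappa]
    ext <;> simp [e_apply, Kv_apply]

/-- The inner product of the transverse parts. -/
def tdot (w v : V) : ℝ := w 1 * v 1 + (w 2 * v 2 + w 3 * v 3 + w 4 * v 4 + w 5 * v 5)
  + (w 6 * v 6 + w 7 * v 7 + w 8 * v 8 + w 9 * v 9)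

theorem tdot_Kv_left (x y : H4) (v : V) : tdot (Kv x y) v = dot x (gam v y) := by
  simp [tdot, Kv_apply, kap1, kapA, kapB, dot_apply, inner_quat]
  ring

theorem tdot_add_left (w w' v : V) : tdot (w + w') v = tdot w v + tdot w' v := by
  simp [tdot]; ring

theorem tdot_smul_left (c : ℝ) (w v : V) : tdot (c • w) v = c * tdot w v := by
  simp [tdot]; ring

theorem nf_zero_apply (w v : V) (h0 : w 0 = 0) (h10 : w 10 = 0) :
    nf 0 0 0 w v = tdot w v • e 0 + v 10 • w := by
  refine V_ext ?_ ?_ ?_ ?_ ?_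
  · simp [nf_apply, tdot, e_apply, h0]
  · simp [nf_apply, e_apply, h10]
  · simp [nf_apply, e_apply]
  · ext <;> simp [nf_apply, e_apply]
  · ext <;> simp [nf_apply, e_apply]

theorem dot_JJ (x y : H4) : dot (JJ x) y = -dot x (JJ y) := by
  simp [dot_apply, inner_quat]
  ring

/-- The vector `w` for which `e_+ ∧ w` is the `e_+ ∧ ℝ⁹`-part of `γ^φ(s,t)`. -/
def wv (s t : S) : V := (1 / 6 : ℝ) • (Kv t.1 (JJ s.2) + Kv s.1 (JJ t.2))
  - (1 / 2 : ℝ) • (Kv (JJ s.1) t.2 + Kv (JJ t.1) s.2)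

@[simp] theorem wv_zero_coord (s t : S) : wv s t 0 = 0 := by
  simp [wv, Kv_apply]

@[simp] theorem wv_ten_coord (s t : S) : wv s t 10 = 0 := by
  simp [wv, Kv_apply]

/-- The weights of J in β on S_- and S_+ yield the coefficients 1/6 and -1/2 of `wv`. The remaining
term involves s_- and t_- only and gives the rotations. -/
theorem gamma_phi0_apply (s t : S) (v : V) : gamma phi0 s t v = nf 0 0 0 (wv s t) v
    - (√2 / 12) • (Kv (BB v s.2) t.2 + Kv (BB v t.2) s.2) := by
  -- Skewness of J rewrites the e_+-component of e_+ ∧ w in terms of `BB`. The coefficient agrees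
  -- with that of γ because √2 · √2/12 = 1/6.
  have h0 : tdot (wv s t) v = (1 / 6 : ℝ) * (dot (BB v s.2) t.1 + dot (BB v t.2) s.1) := by
    have e1 : wv s t = (1 / 6 : ℝ) • (Kv t.1 (JJ s.2) + Kv s.1 (JJ t.2))
      + (-1 / 2 : ℝ) • (Kv (JJ s.1) t.2 + Kv (JJ t.1) s.2) := by rw [wv]; module
    rw [e1]
    simp only [tdot_add_left, tdot_smul_left, tdot_Kv_left, BB_apply, dot_comm _ s.1,
      dot_comm _ t.1, dot_add_right, dot_smul_right, dot_JJ]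
    ring
  rw [nf_zero_apply _ _ (wv_zero_coord s t) (wv_ten_coord s t), h0, gamma_apply, kappa_eq, kappa_eq,
    beta_phi0, beta_phi0]
  simp only [dot_comm _ t.1, dot_comm _ s.1, dot_comm _ t.2, dot_comm _ s.2, dot_add_right,
    dot_smul_right, dot_neg_right, map_add, map_smul, map_neg, LinearMap.add_apply,
    LinearMap.smul_apply, wv]
  have j1 : dot s.1 (JJ t.1) = -dot t.1 (JJ s.1) := by rw [dot_comm, dot_JJ]
  have j2 : dot s.2 (JJ t.2) = -dot t.2 (JJ s.2) := by rw [dot_comm, dot_JJ]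
  rw [j1, j2]
  linear_combination (norm := module)
    ((1 / 12 : ℝ) * (dot t.1 (BB v s.2) + dot s.1 (BB v t.2)) * sqrt2_mul) • e 0

theorem mem_S1 {s : S} : s ∈ S1 ↔ s.2 1 = 0 ∧ s.2 3 = 0 := Iff.rfl

theorem mem_S2 {s : S} : s ∈ S2 ↔ s.2 0 = 0 ∧ s.2 2 = 0 := Iff.rfl

theorem gamma_eq_nf {s t : S} {l : ℝ} {y x : ℍ[ℝ]}
    (h : ∀ v, -((√2 / 12) • (Kv (BB v s.2) t.2 + Kv (BB v t.2) s.2)) =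
      mkV 0 0 (l • (qI * quatA v)) (y * quatB v + quatB v * x) 0) :
    gamma phi0 s t = nf l y x (wv s t) := by
  refine LinearMap.ext fun v => ?_
  rw [gamma_phi0_apply, sub_eq_add_neg, h]
  refine V_ext ?_ ?_ ?_ ?_ ?_
  · simp [nf_apply]
  · simp [nf_apply]
  · simp [nf_apply]
  · simp [nf_apply, quatA_add, add_comm]
  · simp [nf_apply, quatB_add]; abel

theorem star_qI : star qI = -qI := by ext <;> simp

theorem BB_of_mem_S1 (v : V) {x : H4} (h1 : x 1 = 0) (h3 : x 3 = 0) : BB v x =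
    ![(4 * v 1) • (qI * x 0) + (2 : ℝ) • (qI * x 2 * quatB v), star (quatA v) * qI * x 0,
      (4 * v 1) • (qI * x 2) - (2 : ℝ) • (qI * x 0 * star (quatB v)),
      star (quatA v) * qI * x 2] := by
  refine H4_ext ?_ ?_ ?_ ?_ <;>
    simp [BB_apply, h1, h3, mul_add, mul_sub, mul_assoc, smul_sub, smul_add]
  · module
  · module

/-- Component 0 of the S_- part feeds one 𝔰𝔲(2) factor of 𝔰𝔬(E^⊥) and component 2 the other; both
feed 𝔲(1), with opposite signs. -/
theorem gamma_of_mem_S1 {s t : S} (hs : s ∈ S1) (ht : t ∈ S1) : gamma phi0 s t =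
    nf ((√2 / 6) * (inner ℝ (s.2 0) (t.2 0) - inner ℝ (s.2 2) (t.2 2)))
      (-(√2 / 6) • (star (s.2 2) * qI * t.2 2 + star (t.2 2) * qI * s.2 2))
      (-(√2 / 6) • (star (s.2 0) * qI * t.2 0 + star (t.2 0) * qI * s.2 0)) (wv s t) := by
  refine gamma_eq_nf fun v => ?_
  obtain ⟨s1, s3⟩ := mem_S1.1 hs
  obtain ⟨t1, t3⟩ := mem_S1.1 ht
  rw [BB_of_mem_S1 v s1 s3, BB_of_mem_S1 v t1 t3]
  refine V_ext ?_ ?_ ?_ ?_ ?_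
  · simp [Kv_apply]
  · simp [Kv_apply]
  · simp [Kv_apply, kap1, s1, s3, t1, t3, inner_quat]
    ring
  · rw [quatA_mkV, quatA_neg, quatA_smul, quatA_add]
    ext <;> simp [Kv_apply, kapA, s1, s3, t1, t3, inner_quat] <;> ring
  · rw [quatB_mkV, quatB_neg, quatB_smul, quatB_add]
    simp [Kv_apply, kapB, s1, s3, t1, t3, star_qI, mul_add, add_mul, mul_assoc,
      -QuaternionAlgebra.star_smul]
    module

/-- On ker J one has `BB v x` = 3 J γ(v) x, and only the E^⊤ part of γ(v) leads from components 1, 3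
to components 0, 2. Pairing the result with components 1, 3 again gives a vector in E^⊤, so E^⊥ is
not rotated. -/
theorem gamma_of_mem_S2 {s t : S} (hs : s ∈ S2) (ht : t ∈ S2) : gamma phi0 s t =
    nf (-(√2 / 2) * (inner ℝ (s.2 1) (t.2 1) - inner ℝ (s.2 3) (t.2 3))) 0 0 (wv s t) := by
  refine gamma_eq_nf fun v => ?_
  obtain ⟨s1, s3⟩ := mem_S2.1 hs
  obtain ⟨t1, t3⟩ := mem_S2.1 ht
  refine V_ext ?_ ?_ ?_ ?_ ?_
  · simp [Kv_apply]
  · simp [Kv_apply]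
  · simp [Kv_apply, kap1, BB_apply, s1, s3, t1, t3]
  · rw [quatA_mkV, quatA_neg, quatA_smul, quatA_add]
    ext <;> simp [Kv_apply, kapA, BB_apply, s1, s3, t1, t3, inner_quat] <;> ring
  · rw [quatB_mkV, quatB_neg, quatB_smul, quatB_add]
    ext <;> simp [Kv_apply, kapB, BB_apply, s1, s3, t1, t3]

/-! ### The isotropy algebras -/

theorem nf_add (l l' : ℝ) (y y' x x' : ℍ[ℝ]) (w w' : V) :
    nf l y x w + nf l' y' x' w' = nf (l + l') (y + y') (x + x') (w + w') := by
  refine LinearMap.ext fun v => ?_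
  refine V_ext ?_ ?_ ?_ ?_ ?_
  · simp [nf_apply]; ring
  · simp [nf_apply]
  · simp [nf_apply]; ring
  · simp [nf_apply, quatA_add]; module
  · simp [nf_apply, quatB_add, add_mul, mul_add]; abel

theorem smul_nf (c l : ℝ) (y x : ℍ[ℝ]) (w : V) :
    c • nf l y x w = nf (c * l) (c • y) (c • x) (c • w) := by
  refine LinearMap.ext fun v => ?_
  refine V_ext ?_ ?_ ?_ ?_ ?_
  · simp [nf_apply]; ring
  · simp [nf_apply]
  · simp [nf_apply]; ring
  · simp [nf_apply, quatA_smul]; module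
  · simp [nf_apply, quatB_smul, smul_add]; module

theorem nf_zero : nf 0 0 0 0 = 0 := by
  refine LinearMap.ext fun v => ?_
  refine V_ext ?_ ?_ ?_ ?_ ?_ <;> simp [nf_apply]

/-- Right multiplication reverses products, hence the opposite order in the x-slot. The null
rotations commute, so w and w' meet only the rotations. -/
theorem lie_nf (l l' : ℝ) {y y' x x' : ℍ[ℝ]} (hy : y.re = 0) (hy' : y'.re = 0) (hx : x.re = 0)
    (hx' : x'.re = 0) (w w' : V) :
    ⁅nf l y x w, nf l' y' x' w'⁆ = nf 0 (y * y' - y' * y) (x' * x - x * x')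
      (mkV 0 0 (l • (qI * quatA w') - l' • (qI * quatA w))
        (y * quatB w' + quatB w' * x - (y' * quatB w + quatB w * x')) 0) := by
  refine LinearMap.ext fun v => ?_
  rw [Ring.lie_def, LinearMap.sub_apply, Module.End.mul_apply, Module.End.mul_apply]
  refine V_ext ?_ ?_ ?_ ?_ ?_
  · simp [nf_apply, hy, hy', hx, hx']
    ring
  · simp [nf_apply]
  · simp [nf_apply]
  · simp [nf_apply, quatA_sub, mul_add]; module
  · simp [nf_apply, quatB_sub, mul_add, add_mul, sub_mul, mul_sub, mul_assoc, smul_sub]; module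

/-- The subspace of the `nf l y x w` with `y`, `x` imaginary and `w ∈ ℝ⁹`. -/
def N1 : Submodule ℝ (Module.End ℝ V) where
  carrier := {A | ∃ (l : ℝ) (y x : ℍ[ℝ]) (w : V), y.re = 0 ∧ x.re = 0 ∧ w 0 = 0 ∧ w 10 = 0 ∧
    A = nf l y x w}
  zero_mem' := ⟨0, 0, 0, 0, rfl, rfl, rfl, rfl, nf_zero.symm⟩
  add_mem' := by
    rintro _ _ ⟨l, y, x, w, hy, hx, h0, h10, rfl⟩ ⟨l', y', x', w', hy', hx', h0', h10', rfl⟩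
    exact ⟨_, _, _, _, by simp [hy, hy'], by simp [hx, hx'], by simp [h0, h0'],
      by simp [h10, h10'], nf_add ..⟩
  smul_mem' := by
    rintro c _ ⟨l, y, x, w, hy, hx, h0, h10, rfl⟩
    exact ⟨_, _, _, _, by simp [hy], by simp [hx], by simp [h0], by simp [h10], smul_nf ..⟩

/-- The subspace of the `nf l 0 0 w` with `w ∈ E^⊤`. -/
def N2 : Submodule ℝ (Module.End ℝ V) where
  carrier := {A | ∃ (l : ℝ) (a : ℍ[ℝ]), A = nf l 0 0 (mkV 0 0 a 0 0)}
  zero_mem' := ⟨0, 0, by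
    rw [show mkV 0 0 0 0 0 = 0 by refine V_ext ?_ ?_ ?_ ?_ ?_ <;> simp, nf_zero]⟩
  add_mem' := by
    rintro _ _ ⟨l, a, rfl⟩ ⟨l', a', rfl⟩
    refine ⟨l + l', a + a', ?_⟩
    rw [nf_add]
    congr 1 <;> try simp
    refine V_ext ?_ ?_ ?_ ?_ ?_ <;> simp [quatA_add, quatB_add]
  smul_mem' := by
    rintro c _ ⟨l, a, rfl⟩
    refine ⟨c * l, c • a, ?_⟩
    rw [smul_nf]
    congr 1 <;> try simp
    refine V_ext ?_ ?_ ?_ ?_ ?_ <;> simp [quatA_smul, quatB_smul]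

theorem N2_le_N1 : N2 ≤ N1 := by
  rintro _ ⟨l, a, rfl⟩
  exact ⟨l, 0, 0, _, rfl, rfl, rfl, rfl, rfl⟩

theorem mem_N1_so {A : Module.End ℝ V} (hA : A ∈ N1) : A ∈ so := by
  obtain ⟨l, y, x, w, hy, hx, h0, h10, rfl⟩ := hA
  rw [nf_eq_wedges l hy hx h0 h10]
  have m : ∀ a b, wedge a b ∈ so := wedge_mem_so
  have m' : ∀ (c : ℝ) a b, c • wedge a b ∈ so := fun c a b => so.smul_mem c (m a b)
  exact so.add_mem (so.sub_mem (so.neg_mem (so.smul_mem _ (so.add_mem (m _ _) (m _ _))))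
    (so.add_mem (so.add_mem (so.sub_mem (so.add_mem (so.add_mem (m' _ _ _) (m' _ _ _)) (m' _ _ _))
      (m' _ _ _)) (m' _ _ _)) (m' _ _ _))) (m _ _)

/-- Each Leibniz term replaces a factor by a combination of other factors of the same wedge product,
so a vector is repeated. -/
theorem extAct_ιMulti_eq_zero {A : Module.End ℝ V} {v : Fin 4 → V}
    (h : ∀ i, ∃ j k, j ≠ i ∧ k ≠ i ∧ ∃ c d : ℝ, A (v i) = c • v j + d • v k) :
    extAct 4 A (exteriorPower.ιMulti ℝ 4 v) = 0 := by
  rw [extAct_ιMulti]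
  refine Finset.sum_eq_zero fun i _ => ?_
  obtain ⟨j, k, hj, hk, c, d, hA⟩ := h i
  have : (fun m => if m = i then A (v m) else v m) =
      Function.update v i (c • v j + d • v k) := by
    funext m
    by_cases hm : m = i
    · subst hm; simp [hA]
    · simp [hm]
  rw [this, AlternatingMap.map_update_add, AlternatingMap.map_update_smul,
    AlternatingMap.map_update_smul, AlternatingMap.map_update_self _ _ hj.symm,
    AlternatingMap.map_update_self _ _ hk.symm]
  simp

theorem extAct_phi0_of_mem_N1 {A : Module.End ℝ V} (hA : A ∈ N1) : extAct 4 A phi0 = 0 := by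
  obtain ⟨l, y, x, w, hy, hx, h0, h10, rfl⟩ := hA
  -- The zero coefficients only bring A e_+ = 0 into the shape "combination of two other factors".
  -- The remaining vectors go to a multiple of e_+ plus, for E^⊤, a multiple of the partner under
  -- L_i; the partners are 2, 3 and 4, 5, so each summand of φ is invariant.
  have a0 : nf l y x w (e 0) = (0 : ℝ) • e 1 + (0 : ℝ) • e 2 := by
    refine V_ext ?_ ?_ ?_ ?_ ?_
    all_goals first | simp [nf_apply, e_apply]; done | (ext <;> simp [nf_apply, e_apply])
  have a0' : nf l y x w (e 0) = (0 : ℝ) • e 1 + (0 : ℝ) • e 4 := by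
    rw [a0]; simp
  have a1 : nf l y x w (e 1) = w 1 • e 0 + (0 : ℝ) • e 2 := by
    refine V_ext ?_ ?_ ?_ ?_ ?_
    all_goals first | simp [nf_apply, e_apply]; done | (ext <;> simp [nf_apply, e_apply])
  have a1' : nf l y x w (e 1) = w 1 • e 0 + (0 : ℝ) • e 4 := by
    rw [a1]; simp
  have a2 : nf l y x w (e 2) = w 2 • e 0 + l • e 3 := by
    refine V_ext ?_ ?_ ?_ ?_ ?_
    all_goals first | simp [nf_apply, e_apply]; done | (ext <;> simp [nf_apply, e_apply])
  have a3 : nf l y x w (e 3) = w 3 • e 0 + (-l) • e 2 := by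
    refine V_ext ?_ ?_ ?_ ?_ ?_
    all_goals first | simp [nf_apply, e_apply]; done | (ext <;> simp [nf_apply, e_apply])
  have a4 : nf l y x w (e 4) = w 4 • e 0 + l • e 5 := by
    refine V_ext ?_ ?_ ?_ ?_ ?_
    all_goals first | simp [nf_apply, e_apply]; done | (ext <;> simp [nf_apply, e_apply])
  have a5 : nf l y x w (e 5) = w 5 • e 0 + (-l) • e 4 := by
    refine V_ext ?_ ?_ ?_ ?_ ?_
    all_goals first | simp [nf_apply, e_apply]; done | (ext <;> simp [nf_apply, e_apply])
  rw [phi0, map_add, extAct_ιMulti_eq_zero, extAct_ιMulti_eq_zero, add_zero]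
  · intro i
    fin_cases i
    · exact ⟨1, 2, by decide, by decide, 0, 0, a0'⟩
    · exact ⟨0, 2, by decide, by decide, _, _, a1'⟩
    · exact ⟨0, 3, by decide, by decide, _, _, a4⟩
    · exact ⟨0, 2, by decide, by decide, _, _, a5⟩
  · intro i
    fin_cases i
    · exact ⟨1, 2, by decide, by decide, 0, 0, a0⟩
    · exact ⟨0, 2, by decide, by decide, _, _, a1⟩
    · exact ⟨0, 3, by decide, by decide, _, _, a2⟩
    · exact ⟨0, 2, by decide, by decide, _, _, a3⟩

theorem spinRep_mem_S1 {A : Module.End ℝ V} (hA : A ∈ N1) {s : S} (hs : s ∈ S1) :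
    spinRep A s ∈ S1 := by
  obtain ⟨l, y, x, w, hy, hx, h0, h10, rfl⟩ := hA
  rw [mem_S1] at hs ⊢
  rw [spinRep_nf l hy hx h0 h10]
  simp [sigH, hs.1, hs.2]

theorem spinRep_mem_S2 {A : Module.End ℝ V} (hA : A ∈ N1) {s : S} (hs : s ∈ S2) :
    spinRep A s ∈ S2 := by
  obtain ⟨l, y, x, w, hy, hx, h0, h10, rfl⟩ := hA
  rw [mem_S2] at hs ⊢
  rw [spinRep_nf l hy hx h0 h10]
  simp [sigH, hs.1, hs.2]

theorem lie_mem_N1 {A B : Module.End ℝ V} (hA : A ∈ N1) (hB : B ∈ N1) : ⁅A, B⁆ ∈ N1 := by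
  obtain ⟨l, y, x, w, hy, hx, h0, h10, rfl⟩ := hA
  obtain ⟨l', y', x', w', hy', hx', h0', h10', rfl⟩ := hB
  exact ⟨_, _, _, _, by simp; ring, by simp; ring, rfl, rfl, lie_nf _ _ hy hy' hx hx' _ _⟩

theorem lie_mem_N2 {A B : Module.End ℝ V} (hA : A ∈ N2) (hB : B ∈ N2) : ⁅A, B⁆ ∈ N2 := by
  obtain ⟨l, a, rfl⟩ := hA
  obtain ⟨l', a', rfl⟩ := hB
  refine ⟨0, l • (qI * a') - l' • (qI * a), ?_⟩
  rw [lie_nf _ _ rfl rfl rfl rfl]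
  simp

theorem add_tmul_mem_symSq {S' : Submodule ℝ S} {s t : S} (hs : s ∈ S') (ht : t ∈ S') :
    s ⊗ₜ[ℝ] t + t ⊗ₜ[ℝ] s ∈ symSq S' := by
  have h : s ⊗ₜ[ℝ] t + t ⊗ₜ[ℝ] s = (s + t) ⊗ₜ[ℝ] (s + t) - s ⊗ₜ[ℝ] s - t ⊗ₜ[ℝ] t := by
    simp only [TensorProduct.add_tmul, TensorProduct.tmul_add]
    abel
  rw [h]
  exact sub_mem (sub_mem (Submodule.subset_span ⟨_, S'.add_mem hs ht, rfl⟩)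
    (Submodule.subset_span ⟨_, hs, rfl⟩)) (Submodule.subset_span ⟨_, ht, rfl⟩)

/-- A pair with κ(s,t) = 0 yields the Dirac kernel element (s ⊗ t + t ⊗ s)/2. These suffice to
generate the isotropy in both examples. -/
theorem gamma_mem_isotropy {φ : ⋀[ℝ]^4 V} {S' : Submodule ℝ S} {s t : S} (hs : s ∈ S')
    (ht : t ∈ S') (h : kappa s t = 0) : gamma φ s t ∈ isotropy φ S' := by
  refine ⟨(1 / 2 : ℝ) • (s ⊗ₜ[ℝ] t + t ⊗ₜ[ℝ] s), ⟨?_, ?_⟩, ?_⟩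
  · exact Submodule.smul_mem _ _ (add_tmul_mem_symSq hs ht)
  · rw [SetLike.mem_coe, LinearMap.mem_ker]
    simp [kappa_comm t s, h]
  · simp only [map_smul, map_add, TensorProduct.lift.tmul, gamma_comm φ t s]
    module

/-- The condition κ = 0 is dropped: the upper bound already holds on all of ⊙²S'. -/
theorem isotropy_le {φ : ⋀[ℝ]^4 V} {S' : Submodule ℝ S} {N : Submodule ℝ (Module.End ℝ V)}
    (h : ∀ s ∈ S', gamma φ s s ∈ N) : isotropy φ S' ≤ N := by
  rintro _ ⟨x, ⟨hx, -⟩, rfl⟩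
  have : symSq S' ≤ N.comap (TensorProduct.lift (gamma φ)) := by
    refine Submodule.span_le.2 ?_
    rintro _ ⟨s, hs, rfl⟩
    simpa using h s hs
  exact this hx

theorem gamma_mem_N1 {s t : S} (hs : s ∈ S1) (ht : t ∈ S1) : gamma phi0 s t ∈ N1 := by
  rw [gamma_of_mem_S1 hs ht]
  refine ⟨_, _, _, _, ?_, ?_, wv_zero_coord s t, wv_ten_coord s t, rfl⟩
  · simp; ring_nf
  · simp; ring_nf

/-- J kills the S_- parts, so only `Kv` of J s_+ with t_- and of J t_+ with s_- survive. These pair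
components 0, 2 with components 1, 3, and such pairings lie in E^⊤. -/
theorem wv_of_mem_S2 {s t : S} (hs : s ∈ S2) (ht : t ∈ S2) :
    wv s t = mkV 0 0 (quatA (wv s t)) 0 0 := by
  obtain ⟨s1, s3⟩ := mem_S2.1 hs
  obtain ⟨t1, t3⟩ := mem_S2.1 ht
  have hs' : JJ s.2 = 0 := by refine H4_ext ?_ ?_ ?_ ?_ <;> simp [s1, s3]
  have ht' : JJ t.2 = 0 := by refine H4_ext ?_ ?_ ?_ ?_ <;> simp [t1, t3]
  refine V_ext ?_ ?_ ?_ ?_ ?_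
  · simp
  · simp
  · simp [wv, hs', ht', Kv_apply, kap1, s1, s3, t1, t3]
  · simp
  · simp [wv, hs', ht', Kv_apply, quatB_sub, quatB_smul, quatB_add, kapB, s1, s3, t1, t3]

theorem gamma_mem_N2 {s t : S} (hs : s ∈ S2) (ht : t ∈ S2) : gamma phi0 s t ∈ N2 := by
  rw [gamma_of_mem_S2 hs ht, wv_of_mem_S2 hs ht]
  exact ⟨_, _, rfl⟩

/-- Values of `γ^φ` on `S_+ ⊙ S_-`. -/
theorem gamma_fst_snd_S1 (h : H4) {x : H4} (h1 : x 1 = 0) (h3 : x 3 = 0) :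
    gamma phi0 (h, 0) (0, x) =
      nf 0 0 0 ((1 / 6 : ℝ) • Kv h (JJ x) - (1 / 2 : ℝ) • Kv (JJ h) x) := by
  rw [gamma_of_mem_S1 (s := (h, 0)) (t := (0, x)) (by simp [mem_S1]) (by simp [mem_S1, h1, h3])]
  simp [wv]

/-- Values of `γ^φ` on `⊙² S_-`. -/
theorem gamma_snd_snd_S1 {x z : H4} (h1 : x 1 = 0) (h3 : x 3 = 0) (z1 : z 1 = 0) (z3 : z 3 = 0) :
    gamma phi0 (0, x) (0, z) =
      nf ((√2 / 6) * (inner ℝ (x 0) (z 0) - inner ℝ (x 2) (z 2)))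
      (-(√2 / 6) • (star (x 2) * qI * z 2 + star (z 2) * qI * x 2))
      (-(√2 / 6) • (star (x 0) * qI * z 0 + star (z 0) * qI * x 0)) 0 := by
  rw [gamma_of_mem_S1 (s := (0, x)) (t := (0, z)) (by simp [mem_S1, h1, h3])
    (by simp [mem_S1, z1, z3])]
  simp [wv]

theorem dot_zero_left (x : H4) : dot 0 x = 0 := by
  rw [dot_comm, dot_zero_right]

theorem kappa_fst_snd (h x : H4) : kappa (h, 0) (0, x) = Kv h x := by
  simp [kappa_eq, dot_zero_right, dot_zero_left]

theorem kappa_snd_snd (x z : H4) : kappa (0, x) (0, z) = -(√2 * dot x z) • e 10 := by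
  simp [kappa_eq, dot_zero_right]

theorem nf_mem_isotropy_S1 {h x : H4} (h1 : x 1 = 0) (h3 : x 3 = 0) (hK : Kv h x = 0) {w : V}
    (hw : (1 / 6 : ℝ) • Kv h (JJ x) - (1 / 2 : ℝ) • Kv (JJ h) x = w) :
    nf 0 0 0 w ∈ isotropy phi0 S1 := by
  rw [← hw, ← gamma_fst_snd_S1 h h1 h3]
  exact gamma_mem_isotropy (by simp [mem_S1]) (by simp [mem_S1, h1, h3])
    ((kappa_fst_snd h x).trans hK)

theorem nf_mem_isotropy_S1' {x z : H4} (h1 : x 1 = 0) (h3 : x 3 = 0) (z1 : z 1 = 0) (z3 : z 3 = 0)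
    (hd : dot x z = 0) : nf ((√2 / 6) * (inner ℝ (x 0) (z 0) - inner ℝ (x 2) (z 2)))
      (-(√2 / 6) • (star (x 2) * qI * z 2 + star (z 2) * qI * x 2))
      (-(√2 / 6) • (star (x 0) * qI * z 0 + star (z 0) * qI * x 0)) 0 ∈ isotropy phi0 S1 := by
  rw [← gamma_snd_snd_S1 h1 h3 z1 z3]
  exact gamma_mem_isotropy (by simp [mem_S1, h1, h3]) (by simp [mem_S1, z1, z3])
    (by rw [kappa_snd_snd, hd]; simp)

/-- Both spinors are placed in component 0 of S_-: orthogonality makes the Dirac current and the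
𝔲(1) part vanish together, and the ideal of y is not reached. -/
theorem nf_mem_isotropy_x {p q : ℍ[ℝ]} (hd : inner ℝ p q = 0) (c : ℝ) :
    nf 0 0 (c • (star p * qI * q + star q * qI * p)) 0 ∈ isotropy phi0 S1 := by
  have h := nf_mem_isotropy_S1' (x := ![p, 0, 0, 0]) (z := ![q, 0, 0, 0]) rfl rfl rfl rfl
    (by simp [dot_apply, hd])
  have h' := (isotropy phi0 S1).smul_mem (-3 * √2 * c) h
  rw [smul_nf] at h'
  convert h' using 1
  congr 1
  · simp [hd]
  · simp
  · simp only [Matrix.cons_val_zero, smul_smul]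
    congr 1
    linear_combination (-c / 2) * sqrt2_mul
  · simp

theorem nf_mem_isotropy_y {p q : ℍ[ℝ]} (hd : inner ℝ p q = 0) (c : ℝ) :
    nf 0 (c • (star p * qI * q + star q * qI * p)) 0 0 ∈ isotropy phi0 S1 := by
  have h := nf_mem_isotropy_S1' (x := ![0, 0, p, 0]) (z := ![0, 0, q, 0]) rfl rfl rfl rfl
    (by simp [dot_apply, hd])
  have h' := (isotropy phi0 S1).smul_mem (-3 * √2 * c) h
  rw [smul_nf] at h'
  convert h' using 1
  congr 1
  · simp [hd]
  · simp only [Matrix.cons_val, smul_smul]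
    congr 1
    linear_combination (-c / 2) * sqrt2_mul
  · simp
  · simp

/-- Polarised expressions p* i q + q* i p with p ⊥ q span the imaginary quaternions: the orthogonal
pairs (1+j, 1-j), (1, k), (1, j) give 4i, -2j, 2k. -/
theorem imaginary_eq {x : ℍ[ℝ]} (hx : x.re = 0) :
    x = (x.imI / 4) • (star (1 + qJ) * qI * (1 - qJ) + star (1 - qJ) * qI * (1 + qJ))
      + (-x.imJ / 2) • (star 1 * qI * qK + star qK * qI * 1)
      + (x.imK / 2) • (star 1 * qI * qJ + star qJ * qI * 1) := by
  ext <;> simp [hx] <;> ring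

theorem isotropy_S1 : isotropy phi0 S1 = N1 := by
  refine le_antisymm (isotropy_le fun s hs => gamma_mem_N1 hs hs) ?_
  rintro _ ⟨l, y, x, w, hy, hx, h0, h10, rfl⟩
  have i1 : inner ℝ (1 + qJ) (1 - qJ) = (0 : ℝ) := by simp [inner_quat]
  have i2 : inner ℝ (1 : ℍ[ℝ]) qK = (0 : ℝ) := by simp [inner_quat]
  have i3 : inner ℝ (1 : ℍ[ℝ]) qJ = (0 : ℝ) := by simp [inner_quat]
  have Hx : ∀ x : ℍ[ℝ], x.re = 0 → nf 0 0 x 0 ∈ isotropy phi0 S1 := by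
    intro x hx
    have h := add_mem (add_mem (nf_mem_isotropy_x i1 (x.imI / 4))
      (nf_mem_isotropy_x i2 (-x.imJ / 2))) (nf_mem_isotropy_x i3 (x.imK / 2))
    rw [nf_add, nf_add, ← imaginary_eq hx] at h
    simpa using h
  have Hy : ∀ y : ℍ[ℝ], y.re = 0 → nf 0 y 0 0 ∈ isotropy phi0 S1 := by
    intro y hy
    have h := add_mem (add_mem (nf_mem_isotropy_y i1 (y.imI / 4))
      (nf_mem_isotropy_y i2 (-y.imJ / 2))) (nf_mem_isotropy_y i3 (y.imK / 2))
    rw [nf_add, nf_add, ← imaginary_eq hy] at h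
    simpa using h
  -- The spinors (1,0,1,0) and (1,0,-1,0) are orthogonal although their inner products in components
  -- 0 and 2 differ by 2, which produces a 𝔲(1) part. Their rotations of E^⊥ are removed by `Hx` and
  -- `Hy`.
  have Hl : nf l 0 0 0 ∈ isotropy phi0 S1 := by
    have h := nf_mem_isotropy_S1' (x := ![1, 0, 1, 0]) (z := ![1, 0, -1, 0]) rfl rfl
      rfl rfl (by simp [dot_apply])
    have h' := (isotropy phi0 S1).smul_mem ((3 / 2) * √2 * l) h
    rw [smul_nf] at h'
    have h'' := sub_mem (sub_mem h'
      (Hx (((3 / 2) * √2 * l) • (-(√2 / 6) • (star 1 * qI * 1 + star 1 * qI * 1))) (by simp)))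
      (Hy (((3 / 2) * √2 * l) • (-(√2 / 6) • (star 1 * qI * (-1) + star (-1) * qI * 1))) (by simp))
    · convert h'' using 1
      rw [eq_sub_iff_add_eq, eq_sub_iff_add_eq, nf_add, nf_add]
      congr 1
      · simp
        linear_combination (-l / 2) * sqrt2_mul
      · simp
      · simp
      · simp
  -- κ vanishes since 1 ⊥ i. Applying J to either spinor makes the pairing nonzero, and the two
  -- contributions are w₁/4 and 3w₁/4.
  have H1 : nf 0 0 0 (mkV 0 (w 1) 0 0 0) ∈ isotropy phi0 S1 := by
    refine nf_mem_isotropy_S1 (h := ![1, 0, 0, 0]) (x := ![(-(3 / 2) * w 1) • qI, 0, 0, 0])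
      rfl rfl ?_ ?_
    · refine V_ext ?_ ?_ ?_ ?_ ?_ <;> simp [Kv_apply, kap1, kapA, kapB, inner_quat]
    · refine V_ext ?_ ?_ ?_ ?_ ?_
      · simp [Kv_apply]
      · simp [Kv_apply]
      · simp [Kv_apply, kap1, inner_quat]; ring
      · simp [Kv_apply, kapA, quatA_sub, quatA_smul]
      · simp [Kv_apply, kapB, quatB_sub, quatB_smul]
  -- Components 0 and 2 of x are equal and cancel in κ; J gives them opposite signs, so they add up
  -- in `wv`. Here J h = 0, which leaves only the coefficient 1/6.
  have HA : nf 0 0 0 (mkV 0 0 (quatA w) 0 0) ∈ isotropy phi0 S1 := by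
    refine nf_mem_isotropy_S1 (h := ![0, 1, 0, 1])
      (x := ![(-3 : ℝ) • (qI * quatA w), 0, (-3 : ℝ) • (qI * quatA w), 0]) rfl rfl ?_ ?_
    · refine V_ext ?_ ?_ ?_ ?_ ?_ <;> simp [Kv_apply, kap1, kapA, kapB]
    · refine V_ext ?_ ?_ ?_ ?_ ?_
      · simp [Kv_apply]
      · simp [Kv_apply]
      · simp [Kv_apply, kap1]
      · ext <;> simp [Kv_apply, kapA] <;> ring
      · simp [Kv_apply, kapB, quatB_sub, quatB_smul]
  -- With h = (1, 0, q, 0) and x = j h the E^⊥ part of κ is (jq)* + q* j = 0, whereas that of `wv`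
  -- is -(2/3) q* k; q is chosen to make this the prescribed value.
  have HB : nf 0 0 0 (mkV 0 0 0 (quatB w) 0) ∈ isotropy phi0 S1 := by
    refine nf_mem_isotropy_S1
      (h := ![1, 0, (-3 / 2 : ℝ) • star (quatB w * star qK), 0])
      (x := ![qJ, 0, qJ * ((-3 / 2 : ℝ) • star (quatB w * star qK)), 0]) rfl rfl ?_ ?_
    · refine V_ext ?_ ?_ ?_ ?_ ?_
      · simp [Kv_apply]
      · simp [Kv_apply]
      · simp [Kv_apply, kap1, inner_quat]; ring
      · simp [Kv_apply, kapA]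
      · ext <;> simp [Kv_apply, kapB]
    · refine V_ext ?_ ?_ ?_ ?_ ?_
      · simp [Kv_apply]
      · simp [Kv_apply]
      · simp [Kv_apply, kap1, inner_quat]; ring
      · simp [Kv_apply, kapA, quatA_sub, quatA_smul]
      · ext <;> simp [Kv_apply, kapB] <;> ring
  have h := add_mem (add_mem (add_mem (add_mem (add_mem Hl (Hx x hx)) (Hy y hy)) H1) HA) HB
  simp only [nf_add] at h
  convert h using 1
  congr 1
  · simp
  · simp
  · simp
  · refine V_ext ?_ ?_ ?_ ?_ ?_ <;> simp [quatA_add, quatB_add, h0, h10]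

theorem isotropy_S2 : isotropy phi0 S2 = N2 := by
  refine le_antisymm (isotropy_le fun s hs => gamma_mem_N2 hs hs) ?_
  rintro _ ⟨l, a, rfl⟩
  have Hl : nf l 0 0 0 ∈ isotropy phi0 S2 := by
    have m1 : ((0, ![0, 1, 0, 1]) : S) ∈ S2 := by simp [mem_S2]
    have m2 : ((0, ![0, 1, 0, -1]) : S) ∈ S2 := by simp [mem_S2]
    have h := gamma_mem_isotropy (φ := phi0) m1 m2 (by rw [kappa_snd_snd]; simp [dot_apply])
    have h' := (isotropy phi0 S2).smul_mem ((-1 / 2) * √2 * l) h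
    rw [gamma_of_mem_S2 m1 m2, smul_nf] at h'
    convert h' using 1
    congr 1
    · simp
      linear_combination (-l / 2) * sqrt2_mul
    · simp
    · simp
    · simp [wv]
  have HA : nf 0 0 0 (mkV 0 0 a 0 0) ∈ isotropy phi0 S2 := by
    have m1 : ((![qI * a, 0, qI * a, 0], 0) : S) ∈ S2 := by simp [mem_S2]
    have m2 : ((0, ![0, 1, 0, 1]) : S) ∈ S2 := by simp [mem_S2]
    have h := gamma_mem_isotropy (φ := phi0) m1 m2 (by
      rw [kappa_fst_snd]
      refine V_ext ?_ ?_ ?_ ?_ ?_ <;> simp [Kv_apply, kap1, kapA, kapB])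
    rw [gamma_of_mem_S2 m1 m2] at h
    convert h using 1
    congr 1
    · simp
    · refine V_ext ?_ ?_ ?_ ?_ ?_
      · simp
      · simp
      · simp [wv, Kv_apply, kap1]
      · ext <;> simp [wv, Kv_apply, kapA] <;> ring
      · simp [wv, Kv_apply, kapB, quatB_sub, quatB_smul]
  have h := add_mem Hl HA
  simpa [nf_add] using h

/-! ### Dimensions, Lie pairs and maximality -/

theorem finrank_H4 : Module.finrank ℝ H4 = 16 := by
  rw [Module.finrank_pi_fintype]
  simp [Quaternion.finrank_eq_four]

theorem finrank_S1 : Module.finrank ℝ S1 = 24 := by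
  let f : S1 ≃ₗ[ℝ] H4 × (ℍ[ℝ] × ℍ[ℝ]) :=
    { toFun := fun s => (s.1.1, (s.1.2 0, s.1.2 2))
      invFun := fun t => ⟨(t.1, ![t.2.1, 0, t.2.2, 0]), by simp [mem_S1]⟩
      map_add' := fun s t => rfl
      map_smul' := fun c s => rfl
      left_inv := fun s => by
        obtain ⟨h1, h3⟩ := mem_S1.1 s.2
        refine Subtype.ext (Prod.ext rfl (H4_ext rfl ?_ rfl ?_))
        · simp [h1]
        · simp [h3]
      right_inv := fun t => rfl }
  rw [f.finrank_eq, Module.finrank_prod, Module.finrank_prod, finrank_H4]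
  simp [Quaternion.finrank_eq_four]

theorem finrank_S2 : Module.finrank ℝ S2 = 24 := by
  let f : S2 ≃ₗ[ℝ] H4 × (ℍ[ℝ] × ℍ[ℝ]) :=
    { toFun := fun s => (s.1.1, (s.1.2 1, s.1.2 3))
      invFun := fun t => ⟨(t.1, ![0, t.2.1, 0, t.2.2]), by simp [mem_S2]⟩
      map_add' := fun s t => rfl
      map_smul' := fun c s => rfl
      left_inv := fun s => by
        obtain ⟨h1, h3⟩ := mem_S2.1 s.2
        refine Subtype.ext (Prod.ext rfl (H4_ext ?_ rfl ?_ rfl))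
        · simp [h1]
        · simp [h3]
      right_inv := fun t => rfl }
  rw [f.finrank_eq, Module.finrank_prod, Module.finrank_prod, finrank_H4]
  simp [Quaternion.finrank_eq_four]

theorem isLiePair_S1 : IsLiePair phi0 S1 := by
  refine ⟨by rw [finrank_S1]; norm_num, fun A hA => ?_⟩
  rw [isotropy_S1] at hA
  exact ⟨extAct_phi0_of_mem_N1 hA, fun s hs => spinRep_mem_S1 hA hs⟩

theorem isLiePair_S2 : IsLiePair phi0 S2 := by
  refine ⟨by rw [finrank_S2]; norm_num, fun A hA => ?_⟩
  rw [isotropy_S2] at hA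
  exact ⟨extAct_phi0_of_mem_N1 (N2_le_N1 hA), fun s hs => spinRep_mem_S2 (N2_le_N1 hA) hs⟩

/-- The coefficient of `e_+ ∧ e_2 ∧ e_4 ∧ e_5`. -/
def coeff0245 : ⋀[ℝ]^4 V →ₗ[ℝ] ℝ := exteriorPower.alternatingMapLinearEquiv
  (Matrix.detRowAlternating.compLinearMap (LinearMap.funLeft ℝ ℝ ![(0 : Fin 11), 2, 4, 5]))

theorem coeff0245_ιMulti (v : Fin 4 → V) : coeff0245 (exteriorPower.ιMulti ℝ 4 v) =
    (Matrix.of fun i j => v i (![(0 : Fin 11), 2, 4, 5] j)).det := by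
  simp [coeff0245]
  rfl

/-- A derivation changes one factor at a time. Thus e_+123, lacking both e_4 and e_5, contributes
nothing, and e_+145 contributes only through the e_2-component of A e_1. -/
theorem coeff0245_extAct_phi0 {A : Module.End ℝ V} (h : A (e 0) = 0) :
    coeff0245 (extAct 4 A phi0) = A (e 1) 2 := by
  rw [phi0, map_add, map_add, extAct_ιMulti, extAct_ιMulti, map_sum, map_sum]
  simp only [coeff0245_ιMulti, Fin.sum_univ_four]
  simp [Matrix.det_succ_row_zero, Fin.sum_univ_succ, e_apply, h]

/-- If a Lie pair contains `(0, x)` and `(0, z)` with `x ⊥ z` then `γ(e_2) γ(e_1) J` vanishes on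
them. -/
theorem dot_eq_zero_of_isLiePair {S' : Submodule ℝ S} (hS' : IsLiePair phi0 S') {x z : H4}
    (hx : ((0, x) : S) ∈ S') (hz : ((0, z) : S) ∈ S') (hd : dot x z = 0) :
    dot (BB (e 1) x) (gam (e 2) z) + dot (BB (e 1) z) (gam (e 2) x) = 0 := by
  have h := gamma_mem_isotropy (φ := phi0) hx hz (by rw [kappa_snd_snd, hd]; simp)
  have h1 := (hS'.2 _ h).1
  have h2 := coeff0245_extAct_phi0 (A := gamma phi0 (0, x) (0, z)) (by
    rw [gamma_phi0_apply]
    have : BB (e 0) = 0 := by simp [BB, gam_e_zero]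
    simp [this, wv, nf_zero])
  rw [h1, map_zero, gamma_phi0_apply] at h2
  have hw : wv (0, x) (0, z) = 0 := by simp [wv]
  rw [hw, nf_zero] at h2
  have h3 : (√2 / 12) * (dot (BB (e 1) x) (gam (e 2) z) + dot (BB (e 1) z) (gam (e 2) x)) = 0 := by
    rw [← kapA_re, ← kapA_re]
    simp [Kv_apply] at h2
    linear_combination h2
  exact (mul_eq_zero.1 h3).resolve_left (by positivity)

theorem qI_mul_qI : qI * qI = -1 := by ext <;> simp

theorem maximal_S1 : Maximal (IsLiePair phi0) S1 := by
  refine ⟨isLiePair_S1, fun S' hS' hle s hs => ?_⟩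
  have hx : ((0, ![0, s.2 1, 0, s.2 3]) : S) ∈ S' := by
    have hm : ((s.1, ![s.2 0, 0, s.2 2, 0]) : S) ∈ S1 := by simp [mem_S1]
    have := S'.sub_mem hs (hle hm)
    convert this using 1
    refine Prod.ext ?_ (H4_ext ?_ ?_ ?_ ?_) <;> simp
  -- `BB (e 1)` vanishes on components 1, 3 and is 4 γ(e_1) J on components 0, 2, so one of the two
  -- terms of the criterion survives. It pairs s_- nondegenerately with the arbitrary p and q.
  have key : ∀ p q, 4 * (inner ℝ (qI * p) (s.2 1) - inner ℝ (qI * q) (s.2 3)) = (0 : ℝ) := by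
    intro p q
    have hz : ((0, ![p, 0, q, 0]) : S) ∈ S' := hle (by simp [mem_S1])
    have h := dot_eq_zero_of_isLiePair hS' hx hz (by simp [dot_apply])
    rw [← h]
    simp [dot_apply, BB_apply, inner_quat, e_apply]
    ring
  rw [mem_S1]
  have hI : ∀ z, qI * -(qI * z) = z := fun z => by
    rw [mul_neg, ← mul_assoc, qI_mul_qI]; simp
  constructor
  -- This test value makes the pairing equal to 4 |s_1|², where s_1 is component 1 of s_-.
  · have h := key (-(qI * s.2 1)) 0
    rw [hI] at h
    simpa using h
  · have h := key 0 (-(qI * s.2 3))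
    rw [hI] at h
    simpa using h

theorem maximal_S2 : Maximal (IsLiePair phi0) S2 := by
  refine ⟨isLiePair_S2, fun S' hS' hle s hs => ?_⟩
  have hx : ((0, ![s.2 0, 0, s.2 2, 0]) : S) ∈ S' := by
    have hm : ((s.1, ![0, s.2 1, 0, s.2 3]) : S) ∈ S2 := by simp [mem_S2]
    have := S'.sub_mem hs (hle hm)
    convert this using 1
    refine Prod.ext ?_ (H4_ext ?_ ?_ ?_ ?_) <;> simp
  have key : ∀ p q, 4 * (inner ℝ (qI * s.2 0) p - inner ℝ (qI * s.2 2) q) = (0 : ℝ) := by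
    intro p q
    have hz : ((0, ![0, p, 0, q]) : S) ∈ S' := hle (by simp [mem_S2])
    have h := dot_eq_zero_of_isLiePair hS' hx hz (by simp [dot_apply])
    rw [← h]
    simp [dot_apply, BB_apply, inner_quat, e_apply]
    ring
  rw [mem_S2]
  have hI : ∀ z, qI * z = 0 → z = 0 := fun z hz => by
    have : -(qI * (qI * z)) = z := by rw [← mul_assoc, qI_mul_qI]; simp
    rw [← this, hz]; simp
  constructor
  · have h := key (qI * s.2 0) 0
    exact hI _ (by simpa using h)
  · have h := key 0 (qI * s.2 2)
    exact hI _ (by simpa using h)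

/-! ### The structure of the isotropy algebras -/

theorem mem_spanIcc {a b : Fin 11} {v : V} : v ∈ spanIcc a b ↔ ∀ i, i ∉ Set.Icc a b → v i = 0 := by
  constructor
  · intro hv
    induction hv using Submodule.span_induction with
    | mem x hx =>
      obtain ⟨j, hj, rfl⟩ := hx
      intro i hi
      rw [e_apply, if_neg]
      rintro rfl
      exact hi hj
    | zero => simp
    | add x y _ _ hx hy =>
      intro i hi
      simp [hx i hi, hy i hi]
    | smul c x _ hx =>
      intro i hi
      simp [hx i hi]
  · intro h
    rw [← sum_apply_smul_e v]
    refine Submodule.sum_mem _ fun i _ => ?_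
    by_cases hi : i ∈ Set.Icc a b
    · exact Submodule.smul_mem _ _ (Submodule.subset_span ⟨i, hi, rfl⟩)
    · rw [h i hi, zero_smul]
      exact Submodule.zero_mem _

theorem mem_spanIcc_one_nine {v : V} : v ∈ spanIcc 1 9 ↔ v 0 = 0 ∧ v 10 = 0 := by
  rw [mem_spanIcc]
  constructor
  · exact fun h => ⟨h 0 (by simp), h 10 (by simp)⟩
  · rintro ⟨h0, h10⟩ i hi
    fin_cases i <;> first | exact h0 | exact h10 | (exact absurd ⟨by decide, by decide⟩ hi)

theorem mem_spanIcc_two_five {v : V} : v ∈ spanIcc 2 5 ↔ v = mkV 0 0 (quatA v) 0 0 := by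
  rw [mem_spanIcc]
  constructor
  · intro h
    refine V_ext (h 0 (by simp)) (h 10 (by simp)) (h 1 (by simp)) rfl ?_
    ext
    · exact h 6 (by simp)
    · exact h 7 (by simp)
    · exact h 8 (by simp)
    · exact h 9 (by simp)
  · intro h i hi
    rw [h]
    fin_cases i <;> first | rfl | (exact absurd ⟨by decide, by decide⟩ hi)

theorem mem_spanIcc_six_nine {v : V} : v ∈ spanIcc 6 9 ↔ v = mkV 0 0 0 (quatB v) 0 := by
  rw [mem_spanIcc]
  constructor
  · intro h
    refine V_ext (h 0 (by simp)) (h 10 (by simp)) (h 1 (by simp)) ?_ rfl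
    ext
    · exact h 2 (by simp)
    · exact h 3 (by simp)
    · exact h 4 (by simp)
    · exact h 5 (by simp)
  · intro h i hi
    rw [h]
    fin_cases i <;> first | rfl | (exact absurd ⟨by decide, by decide⟩ hi)

theorem nf_u1 (l : ℝ) : nf l 0 0 0 = -(l • (wedge (e 2) (e 3) + wedge (e 4) (e 5))) := by
  have h0 : wedge ePlus 0 = 0 := by
    refine LinearMap.ext fun v => ?_
    simp [wedge_apply]
  rw [nf_eq_wedges l rfl rfl rfl rfl, h0]
  simp

theorem mem_u1 {A : Module.End ℝ V} : A ∈ u1 ↔ ∃ l, A = nf l 0 0 0 := by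
  rw [u1, Submodule.mem_span_singleton]
  constructor
  · rintro ⟨c, rfl⟩
    exact ⟨-c, by rw [nf_u1]; module⟩
  · rintro ⟨l, rfl⟩
    exact ⟨-l, by rw [nf_u1]; module⟩

/-- The components of a ∧ b in the two 𝔰𝔲(2) ideals are, up to factors ±1/2, the imaginary parts of
a b* and a* b. -/
theorem wedge_quatB (a b : ℍ[ℝ]) : wedge (mkV 0 0 0 a 0) (mkV 0 0 0 b 0) =
    nf 0 ((1 / 4 : ℝ) • (a * star b - b * star a)) (-(1 / 4 : ℝ) • (star a * b - star b * a)) 0 := by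
  refine LinearMap.ext fun v => ?_
  refine V_ext ?_ ?_ ?_ ?_ ?_
  · simp [wedge_apply, nf_apply]
  · simp [wedge_apply, nf_apply]
  · simp [wedge_apply, nf_apply]
  · ext <;> simp [wedge_apply, nf_apply]
  · ext <;> simp [wedge_apply, nf_apply, eta_apply] <;> ring

theorem e_mem_spanIcc {i a b : Fin 11} (h : i ∈ Set.Icc a b) : e i ∈ spanIcc a b :=
  Submodule.subset_span ⟨i, h, rfl⟩

theorem mem_soOf {A : Module.End ℝ V} : A ∈ soOf (spanIcc 6 9) ↔
    ∃ y x : ℍ[ℝ], y.re = 0 ∧ x.re = 0 ∧ A = nf 0 y x 0 := by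
  constructor
  · intro hA
    induction hA using Submodule.span_induction with
    | mem A hA =>
      obtain ⟨v, hv, w, hw, rfl⟩ := hA
      rw [mem_spanIcc_six_nine.1 hv, mem_spanIcc_six_nine.1 hw, wedge_quatB]
      exact ⟨_, _, by simp; ring, by simp; ring, rfl⟩
    | zero => exact ⟨0, 0, rfl, rfl, nf_zero.symm⟩
    | add A B _ _ hA hB =>
      obtain ⟨y, x, hy, hx, rfl⟩ := hA
      obtain ⟨y', x', hy', hx', rfl⟩ := hB
      exact ⟨y + y', x + x', by simp [hy, hy'], by simp [hx, hx'], by rw [nf_add]; simp⟩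
    | smul c A _ hA =>
      obtain ⟨y, x, hy, hx, rfl⟩ := hA
      exact ⟨c • y, c • x, by simp [hy], by simp [hx], by rw [smul_nf]; simp⟩
  · rintro ⟨y, x, hy, hx, rfl⟩
    have h0 : wedge ePlus 0 = 0 := by
      refine LinearMap.ext fun v => ?_
      simp [wedge_apply]
    have m : ∀ (c : ℝ) (i j : Fin 11), i ∈ Set.Icc (6 : Fin 11) 9 → j ∈ Set.Icc (6 : Fin 11) 9 →
        c • wedge (e i) (e j) ∈ soOf (spanIcc 6 9) := fun c i j hi hj =>
      Submodule.smul_mem _ _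
        (Submodule.subset_span ⟨_, e_mem_spanIcc hi, _, e_mem_spanIcc hj, rfl⟩)
    have k6 : (6 : Fin 11) ∈ Set.Icc (6 : Fin 11) 9 := by simp
    have k7 : (7 : Fin 11) ∈ Set.Icc (6 : Fin 11) 9 := by simp
    have k8 : (8 : Fin 11) ∈ Set.Icc (6 : Fin 11) 9 := by simp
    have k9 : (9 : Fin 11) ∈ Set.Icc (6 : Fin 11) 9 := by simp
    rw [nf_eq_wedges 0 hy hx rfl rfl, h0, zero_smul, neg_zero, zero_sub, add_zero]
    exact neg_mem (add_mem (add_mem (sub_mem (add_mem (add_mem (m _ _ _ k6 k7) (m _ _ _ k8 k9))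
      (m _ _ _ k6 k8)) (m _ _ _ k7 k9)) (m _ _ _ k6 k9)) (m _ _ _ k7 k8))

theorem mem_plusWedge {W : Submodule ℝ V} (hW : W ≤ spanIcc 1 9) {A : Module.End ℝ V} :
    A ∈ plusWedge W ↔ ∃ w ∈ W, A = nf 0 0 0 w := by
  constructor
  · intro hA
    induction hA using Submodule.span_induction with
    | mem A hA =>
      obtain ⟨w, hw, rfl⟩ := hA
      obtain ⟨h0, h10⟩ := mem_spanIcc_one_nine.1 (hW hw)
      exact ⟨w, hw, wedge_ePlus h0 h10⟩
    | zero => exact ⟨0, W.zero_mem, nf_zero.symm⟩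
    | add A B _ _ hA hB =>
      obtain ⟨w, hw, rfl⟩ := hA
      obtain ⟨w', hw', rfl⟩ := hB
      exact ⟨w + w', W.add_mem hw hw', by rw [nf_add]; simp⟩
    | smul c A _ hA =>
      obtain ⟨w, hw, rfl⟩ := hA
      exact ⟨c • w, W.smul_mem c hw, by rw [smul_nf]; simp⟩
  · rintro ⟨w, hw, rfl⟩
    obtain ⟨h0, h10⟩ := mem_spanIcc_one_nine.1 (hW hw)
    exact Submodule.subset_span ⟨w, hw, (wedge_ePlus h0 h10).symm⟩

theorem spanIcc_two_five_le : spanIcc 2 5 ≤ spanIcc 1 9 := by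
  intro v hv
  rw [mem_spanIcc_two_five.1 hv, mem_spanIcc_one_nine]
  exact ⟨rfl, rfl⟩

theorem mem_u1_sup_soOf {A : Module.End ℝ V} : A ∈ u1 ⊔ soOf (spanIcc 6 9) ↔
    ∃ (l : ℝ) (y x : ℍ[ℝ]), y.re = 0 ∧ x.re = 0 ∧ A = nf l y x 0 := by
  rw [Submodule.mem_sup]
  constructor
  · rintro ⟨A, hA, B, hB, rfl⟩
    obtain ⟨l, rfl⟩ := mem_u1.1 hA
    obtain ⟨y, x, hy, hx, rfl⟩ := mem_soOf.1 hB
    exact ⟨l, y, x, hy, hx, by rw [nf_add]; simp⟩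
  · rintro ⟨l, y, x, hy, hx, rfl⟩
    exact ⟨_, mem_u1.2 ⟨l, rfl⟩, _, mem_soOf.2 ⟨y, x, hy, hx, rfl⟩, by rw [nf_add]; simp⟩

/-- Evaluation at e_- recovers w from e_+ ∧ w, whereas the rotations annihilate e_-. This separates
the two summands of the semidirect sum. -/
theorem nf_eq_zero_of_apply {w : V} (h0 : w 0 = 0) (h10 : w 10 = 0)
    (h : nf 0 0 0 w (e 10) = 0) : nf 0 0 0 w = 0 := by
  rw [nf_zero_apply _ _ h0 h10] at h
  have h' : w = 0 := by
    refine V_ext h0 h10 ?_ ?_ ?_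
    · simpa [e_apply] using congrFun h 1
    · simpa [e_apply, tdot] using congrArg quatA h
    · simpa [e_apply, tdot] using congrArg quatB h
  rw [h', nf_zero]

theorem isSemidirectSum_S1 :
    IsSemidirectSum (isotropy phi0 S1) (u1 ⊔ soOf (spanIcc 6 9)) (plusWedge (spanIcc 1 9)) := by
  rw [isotropy_S1]
  refine ⟨?_, ?_, ?_, ?_⟩
  · ext A
    rw [Submodule.mem_sup]
    constructor
    · rintro ⟨l, y, x, w, hy, hx, h0, h10, rfl⟩
      exact ⟨_, mem_u1_sup_soOf.2 ⟨l, y, x, hy, hx, rfl⟩, _,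
        (mem_plusWedge le_rfl).2 ⟨w, mem_spanIcc_one_nine.2 ⟨h0, h10⟩, rfl⟩, by rw [nf_add]; simp⟩
    · rintro ⟨A, hA, B, hB, rfl⟩
      obtain ⟨l, y, x, hy, hx, rfl⟩ := mem_u1_sup_soOf.1 hA
      obtain ⟨w, hw, rfl⟩ := (mem_plusWedge le_rfl).1 hB
      obtain ⟨h0, h10⟩ := mem_spanIcc_one_nine.1 hw
      exact ⟨l, y, x, w, hy, hx, h0, h10, by rw [nf_add]; simp⟩
  · rw [Submodule.disjoint_def]
    intro A hA hB
    obtain ⟨l, y, x, hy, hx, hA⟩ := mem_u1_sup_soOf.1 hA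
    obtain ⟨w, hw, rfl⟩ := (mem_plusWedge le_rfl).1 hB
    obtain ⟨h0, h10⟩ := mem_spanIcc_one_nine.1 hw
    refine nf_eq_zero_of_apply h0 h10 ?_
    rw [hA]
    refine V_ext ?_ ?_ ?_ ?_ ?_
    all_goals first | simp [nf_apply, e_apply]; done | (ext <;> simp [nf_apply, e_apply])
  · intro A hA B hB
    obtain ⟨l, y, x, hy, hx, rfl⟩ := mem_u1_sup_soOf.1 hA
    obtain ⟨l', y', x', hy', hx', rfl⟩ := mem_u1_sup_soOf.1 hB
    rw [lie_nf _ _ hy hy' hx hx', mem_u1_sup_soOf]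
    refine ⟨0, _, _, by simp; ring, by simp; ring, congrArg _ ?_⟩
    refine V_ext ?_ ?_ ?_ ?_ ?_ <;> simp
  · rintro A ⟨l, y, x, w, hy, hx, h0, h10, rfl⟩ B hB
    obtain ⟨w', hw', rfl⟩ := (mem_plusWedge le_rfl).1 hB
    rw [lie_nf _ _ hy rfl hx rfl, mem_plusWedge le_rfl]
    refine ⟨mkV 0 0 (l • (qI * quatA w')) (y * quatB w' + quatB w' * x) 0,
      mem_spanIcc_one_nine.2 ⟨rfl, rfl⟩, ?_⟩
    congr 1 <;> simp

theorem isLieDirectSum_u1_soOf :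
    IsLieDirectSum (u1 ⊔ soOf (spanIcc 6 9)) u1 (soOf (spanIcc 6 9)) := by
  refine ⟨rfl, ?_, ?_, ?_, ?_⟩
  · rw [Submodule.disjoint_def]
    intro A hA hB
    obtain ⟨l, rfl⟩ := mem_u1.1 hA
    obtain ⟨y, x, hy, hx, h⟩ := mem_soOf.1 hB
    have h' := congrFun (LinearMap.congr_fun h (e 2)) 3
    have hl : l = 0 := by simpa [nf_apply, e_apply] using h'
    rw [hl, nf_zero]
  · intro A hA B hB
    obtain ⟨l, rfl⟩ := mem_u1.1 hA
    obtain ⟨l', rfl⟩ := mem_u1.1 hB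
    rw [lie_nf _ _ rfl rfl rfl rfl, mem_u1]
    refine ⟨0, ?_⟩
    congr 1
    · simp
    · simp
    · refine V_ext ?_ ?_ ?_ ?_ ?_ <;> simp
  · intro A hA B hB
    obtain ⟨y, x, hy, hx, rfl⟩ := mem_soOf.1 hA
    obtain ⟨y', x', hy', hx', rfl⟩ := mem_soOf.1 hB
    rw [lie_nf _ _ hy hy' hx hx', mem_soOf]
    refine ⟨_, _, by simp; ring, by simp; ring, congrArg _ ?_⟩
    refine V_ext ?_ ?_ ?_ ?_ ?_ <;> simp
  · intro A hA B hB
    obtain ⟨l, rfl⟩ := mem_u1.1 hA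
    obtain ⟨y, x, hy, hx, rfl⟩ := mem_soOf.1 hB
    rw [lie_nf _ _ rfl hy rfl hx, ← nf_zero]
    congr 1
    · simp
    · simp
    · refine V_ext ?_ ?_ ?_ ?_ ?_ <;> simp

theorem isSemidirectSum_S2 : IsSemidirectSum (isotropy phi0 S2) u1 (plusWedge (spanIcc 2 5)) := by
  rw [isotropy_S2]
  have mem : ∀ a, mkV 0 0 a 0 0 ∈ spanIcc 2 5 := fun a => mem_spanIcc_two_five.2 rfl
  refine ⟨?_, ?_, isLieDirectSum_u1_soOf.2.2.1, ?_⟩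
  · ext A
    rw [Submodule.mem_sup]
    constructor
    · rintro ⟨l, a, rfl⟩
      exact ⟨_, mem_u1.2 ⟨l, rfl⟩, _,
        (mem_plusWedge spanIcc_two_five_le).2 ⟨_, mem a, rfl⟩, by rw [nf_add]; simp⟩
    · rintro ⟨A, hA, B, hB, rfl⟩
      obtain ⟨l, rfl⟩ := mem_u1.1 hA
      obtain ⟨w, hw, rfl⟩ := (mem_plusWedge spanIcc_two_five_le).1 hB
      exact ⟨l, quatA w, by rw [nf_add, ← mem_spanIcc_two_five.1 hw]; simp⟩
  · refine isSemidirectSum_S1.2.1.mono le_sup_left ?_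
    intro A hA
    obtain ⟨w, hw, rfl⟩ := (mem_plusWedge spanIcc_two_five_le).1 hA
    exact (mem_plusWedge le_rfl).2 ⟨w, spanIcc_two_five_le hw, rfl⟩
  · rintro A ⟨l, a, rfl⟩ B hB
    obtain ⟨w', hw', rfl⟩ := (mem_plusWedge spanIcc_two_five_le).1 hB
    have hB : quatB w' = 0 := by
      rw [mem_spanIcc_two_five.1 hw']; simp
    rw [lie_nf _ _ rfl rfl rfl rfl, mem_plusWedge spanIcc_two_five_le]
    refine ⟨mkV 0 0 (l • (qI * quatA w')) 0 0, mem _, ?_⟩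
    congr 1
    · simp
    · simp
    · refine V_ext ?_ ?_ ?_ ?_ ?_ <;> simp [hB]

/-! ### The Lie superalgebra of a symmetric symbol -/

/-- The algebraic conditions on `h`, `S'` and `R` under which the brackets
`[A,B] = AB - BA`, `[A,s] = σ(A)s`, `[A,v] = Av`, `[s,t] = κ(s,t) + γ^φ(s,t)`, `[v,s] = β^φ(v,s)`,
`[v,w] = R(v,w)` define a Lie superalgebra. -/
structure IsSymmetricSymbol (φ : ⋀[ℝ]^4 V) (h : Submodule ℝ (Module.End ℝ V))
    (S' : Submodule ℝ S) (R : V →ₗ[ℝ] V →ₗ[ℝ] Module.End ℝ V) : Prop where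
  dim_gt : 16 < Module.finrank ℝ S'
  h_le_so : ∀ A ∈ h, A ∈ so
  h_lie : ∀ A ∈ h, ∀ B ∈ h, ⁅A, B⁆ ∈ h
  h_phi : ∀ A ∈ h, extAct 4 A φ = 0
  h_spin : ∀ A ∈ h, ∀ s ∈ S', spinRep A s ∈ S'
  beta_mem : ∀ v, ∀ s ∈ S', beta φ v s ∈ S'
  gamma_mem : ∀ s ∈ S', ∀ t ∈ S', gamma φ s t ∈ h
  R_mem : ∀ v w, R v w ∈ h
  R_self : ∀ v, R v v = 0
  R_inv : ∀ A ∈ h, ∀ v w, ⁅A, R v w⁆ = R (A v) w + R v (A w)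
  bianchi : ∀ u v w, R u v w + R v w u + R w u v = 0
  curv : ∀ v w, ∀ s ∈ S', beta φ v (beta φ w s) - beta φ w (beta φ v s) = spinRep (R v w) s
  R_kappa : ∀ v, ∀ s ∈ S', ∀ t ∈ S',
    R v (kappa s t) = gamma φ (beta φ v s) t + gamma φ s (beta φ v t)
  cubic : ∀ s ∈ S', spinRep (gamma φ s s) s + beta φ (kappa s s) s = 0

namespace IsSymmetricSymbol

variable {φ : ⋀[ℝ]^4 V} {h : Submodule ℝ (Module.End ℝ V)} {S' : Submodule ℝ S}
  {R : V →ₗ[ℝ] V →ₗ[ℝ] Module.End ℝ V} (D : IsSymmetricSymbol φ h S' R)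

include D

theorem R_swap (v w : V) : R v w = -R w v := by
  have := D.R_self (v + w)
  simp only [map_add, LinearMap.add_apply, D.R_self, zero_add, add_zero] at this
  exact eq_neg_of_add_eq_zero_right this

theorem cubic_polarised {s t u : S} (hs : s ∈ S') (ht : t ∈ S') (hu : u ∈ S') :
    spinRep (gamma φ s t) u + beta φ (kappa s t) u
      + (spinRep (gamma φ t u) s + beta φ (kappa t u) s)
      + (spinRep (gamma φ u s) t + beta φ (kappa u s) t) = 0 := by
  have c1 := D.cubic _ (S'.add_mem (S'.add_mem hs ht) hu)
  have c2 := D.cubic _ (S'.add_mem hs ht)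
  have c3 := D.cubic _ (S'.add_mem ht hu)
  have c4 := D.cubic _ (S'.add_mem hs hu)
  have c5 := D.cubic _ hs
  have c6 := D.cubic _ ht
  have c7 := D.cubic _ hu
  simp only [map_add, LinearMap.add_apply, gamma_comm φ u s, kappa_comm u s, gamma_comm φ t s,
    kappa_comm t s, gamma_comm φ u t, kappa_comm u t] at c1 c2 c3 c4 c5 c6 c7 ⊢
  linear_combination (norm := module)
    (1 / 2 : ℝ) • (c1 - c2 - c3 - c4 + c5 + c6 + c7)

end IsSymmetricSymbol

theorem lie_apply (A B : Module.End ℝ V) (v : V) : ⁅A, B⁆ v = A (B v) - B (A v) := rfl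

/-- The bracket of even elements. -/
def bracket00 {h : Submodule ℝ (Module.End ℝ V)} {R : V →ₗ[ℝ] V →ₗ[ℝ] Module.End ℝ V}
    (h_lie : ∀ A ∈ h, ∀ B ∈ h, ⁅A, B⁆ ∈ h) (R_mem : ∀ v w, R v w ∈ h) :
    (h × V) →ₗ[ℝ] (h × V) →ₗ[ℝ] h × V :=
  LinearMap.mk₂ ℝ
    (fun a b => (⟨⁅(a.1 : Module.End ℝ V), (b.1 : Module.End ℝ V)⁆ + R a.2 b.2,
        h.add_mem (h_lie _ a.1.2 _ b.1.2) (R_mem _ _)⟩,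
      (a.1 : Module.End ℝ V) b.2 - (b.1 : Module.End ℝ V) a.2))
    (by
      intro a a' b
      ext1
      · refine Subtype.ext (LinearMap.ext fun x => ?_)
        simp only [Prod.fst_add, Prod.snd_add, Submodule.coe_add, map_add, lie_apply,
          LinearMap.add_apply]
        abel
      · simp only [Prod.fst_add, Prod.snd_add, Submodule.coe_add, map_add, LinearMap.add_apply]
        abel)
    (by
      intro c a b
      ext1
      · refine Subtype.ext ?_
        simp [Ring.lie_def, smul_sub, smul_add]
      · simp [smul_sub])
    (by
      intro a b b'
      ext1
      · refine Subtype.ext (LinearMap.ext fun x => ?_)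
        simp only [Prod.fst_add, Prod.snd_add, Submodule.coe_add, map_add, lie_apply,
          LinearMap.add_apply]
        abel
      · simp only [Prod.fst_add, Prod.snd_add, Submodule.coe_add, map_add, LinearMap.add_apply]
        abel)
    (by
      intro c a b
      ext1
      · refine Subtype.ext ?_
        simp [Ring.lie_def, smul_sub, smul_add]
      · simp [smul_sub])

/-- The bracket of an even and an odd element. -/
def bracket01 {φ : ⋀[ℝ]^4 V} {h : Submodule ℝ (Module.End ℝ V)} {S' : Submodule ℝ S}
    (h_spin : ∀ A ∈ h, ∀ s ∈ S', spinRep A s ∈ S') (beta_mem : ∀ v, ∀ s ∈ S', beta φ v s ∈ S') :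
    (h × V) →ₗ[ℝ] S' →ₗ[ℝ] S' :=
  LinearMap.mk₂ ℝ
    (fun a s => ⟨spinRep (a.1 : Module.End ℝ V) s + beta φ a.2 s,
      S'.add_mem (h_spin _ a.1.2 _ s.2) (beta_mem _ _ s.2)⟩)
    (by
      intro a a' b
      refine Subtype.ext ?_
      simp only [Prod.fst_add, Prod.snd_add, Submodule.coe_add, map_add, LinearMap.add_apply]
      abel)
    (by intro c a b; refine Subtype.ext ?_; simp)
    (by
      intro a b b'
      refine Subtype.ext ?_
      simp only [Submodule.coe_add, map_add]
      abel)
    (by intro c a b; refine Subtype.ext ?_; simp)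

/-- The bracket of odd elements. -/
def bracket11 {φ : ⋀[ℝ]^4 V} {h : Submodule ℝ (Module.End ℝ V)} {S' : Submodule ℝ S}
    (gamma_mem : ∀ s ∈ S', ∀ t ∈ S', gamma φ s t ∈ h) : S' →ₗ[ℝ] S' →ₗ[ℝ] h × V :=
  LinearMap.mk₂ ℝ (fun s t => (⟨gamma φ s t, gamma_mem _ s.2 _ t.2⟩, kappa s t))
    (by intro s s' t; ext1 <;> simp)
    (by intro s s' t; ext1 <;> simp)
    (by intro s s' t; ext1 <;> simp)
    (by intro s s' t; ext1 <;> simp)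

/-- The Lie superalgebra of a symmetric symbol. -/
def IsSymmetricSymbol.deformation {φ : ⋀[ℝ]^4 V} {h : Submodule ℝ (Module.End ℝ V)}
    {S' : Submodule ℝ S} {R : V →ₗ[ℝ] V →ₗ[ℝ] Module.End ℝ V}
    (D : IsSymmetricSymbol φ h S' R) : FilteredSubdeformation h S' where
  b00 := bracket00 D.h_lie D.R_mem
  b01 := bracket01 D.h_spin D.beta_mem
  b11 := bracket11 D.gamma_mem
  alt00 a := by
    ext1
    · refine Subtype.ext ?_
      simp [bracket00, D.R_self, Ring.lie_def]
    · simp [bracket00]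
  symm11 s t := by
    ext1
    · refine Subtype.ext ?_
      simp [bracket11, gamma_comm φ (s : S)]
    · simp [bracket11, kappa_comm (s : S)]
  jac000 := by
    rintro ⟨⟨A, hA⟩, u⟩ ⟨⟨B, hB⟩, v⟩ ⟨⟨C, hC⟩, w⟩
    ext1
    · refine Subtype.ext (LinearMap.ext fun x => ?_)
      -- The 𝔥-component is the Jacobi identity of commutators together with the invariance of R
      -- under A, B and C. The V-component is the Bianchi identity.
      have hA' := LinearMap.congr_fun (D.R_inv A hA v w) x
      have hB' := LinearMap.congr_fun (D.R_inv B hB u w) x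
      have hC' := LinearMap.congr_fun (D.R_inv C hC u v) x
      rw [D.R_swap (C u) v] at hC'
      simp only [lie_apply, LinearMap.add_apply, LinearMap.neg_apply] at hA' hB' hC'
      simp only [bracket00, LinearMap.mk₂_apply, Prod.fst_add, Submodule.coe_add, map_add, map_sub,
        lie_apply, LinearMap.sub_apply, LinearMap.add_apply]
      linear_combination (norm := module) hA' - hB' + hC'
    · have hb := D.bianchi u v w
      rw [D.R_swap w u, LinearMap.neg_apply] at hb
      simp only [bracket00, LinearMap.mk₂_apply, Prod.snd_add, LinearMap.add_apply, map_sub,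
        Ring.lie_def, LinearMap.sub_apply, Module.End.mul_apply]
      linear_combination (norm := module) -hb
  jac001 := by
    rintro ⟨⟨A, hA⟩, u⟩ ⟨⟨B, hB⟩, v⟩ ⟨s, hs⟩
    refine Subtype.ext ?_
    have e1 : ∀ {A}, A ∈ h → ∀ v s, spinRep A (beta φ v s) =
        beta φ (A v) s + beta φ v (spinRep A s) := fun hA v s =>
      LinearMap.congr_fun (spinRep_mul_beta (D.h_le_so _ hA) (D.h_phi _ hA) v) s
    have e2 := LinearMap.congr_fun (spinRep_lie (D.h_le_so _ hA) B) s
    simp only [LinearMap.sub_apply, Module.End.mul_apply] at e2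
    have e3 := D.curv u v s hs
    simp only [bracket00, bracket01, LinearMap.mk₂_apply, Submodule.coe_add, map_add, map_sub,
      LinearMap.add_apply, LinearMap.sub_apply, e1 hA, e1 hB, e2, ← e3]
    abel
  jac011 := by
    rintro ⟨⟨A, hA⟩, u⟩ ⟨s, hs⟩ ⟨t, ht⟩
    ext1
    · refine Subtype.ext ?_
      simp only [bracket00, bracket01, bracket11, LinearMap.mk₂_apply, Prod.fst_add,
        Submodule.coe_add, map_add, LinearMap.add_apply, D.R_kappa u s hs t ht,
        lie_gamma (D.h_le_so _ hA) (D.h_phi _ hA)]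
      abel
    -- For vectors u the V-component holds by the very definition of γ^φ through κ and β; for A in 𝔥
    -- it is the equivariance of κ.
    · simp only [bracket00, bracket01, bracket11, LinearMap.mk₂_apply, Prod.snd_add,
        map_add, LinearMap.add_apply, kappa_spinRep (D.h_le_so _ hA), gamma_apply,
        kappa_comm s (beta φ u t)]
      abel
  jac111 := by
    rintro ⟨s, hs⟩ ⟨t, ht⟩ ⟨u, hu⟩
    refine Subtype.ext ?_
    simpa [bracket01, bracket11] using D.cubic_polarised hs ht hu
  h_le_so := D.h_le_so
  h_lie := D.h_lie
  h_spin := D.h_spin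
  dim_gt := D.dim_gt
  bracket_h_h A B := by simp [bracket00]
  bracket_h_S A s := by simp [bracket01]
  bracket_h_V A v := by simp [bracket00]
  bracket_S_S s t := by simp [bracket11]

namespace IsSymmetricSymbol

variable {φ : ⋀[ℝ]^4 V} {h : Submodule ℝ (Module.End ℝ V)} {S' : Submodule ℝ S}
  {R : V →ₗ[ℝ] V →ₗ[ℝ] Module.End ℝ V} (D : IsSymmetricSymbol φ h S' R)

theorem b00_fst (a b : h × V) : ((D.deformation.b00 a b).1 : Module.End ℝ V) =
    ⁅(a.1 : Module.End ℝ V), (b.1 : Module.End ℝ V)⁆ + R a.2 b.2 := rfl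

theorem b00_snd (a b : h × V) : (D.deformation.b00 a b).2 =
    (a.1 : Module.End ℝ V) b.2 - (b.1 : Module.End ℝ V) a.2 := rfl

theorem b01_coe (a : h × V) (s : S') : (D.deformation.b01 a s : S) =
    spinRep (a.1 : Module.End ℝ V) s + beta φ a.2 s := rfl

theorem b11_fst (s t : S') : ((D.deformation.b11 s t).1 : Module.End ℝ V) = gamma φ s t := rfl

theorem b11_snd (s t : S') : (D.deformation.b11 s t).2 = kappa s t := rfl

theorem rho_deformation (v w : V) : D.deformation.rho v w = R v w := by
  simp [FilteredSubdeformation.rho, b00_fst, Ring.lie_def]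

theorem realizedBy_deformation : D.deformation.RealizedBy φ 0 := by
  have ha : ∀ v w, D.deformation.alpha v w = 0 := fun v w => by
    simp [FilteredSubdeformation.alpha, b00_snd]
  refine ⟨fun v => ?_, D.h_phi, fun v => ?_, fun v w => ?_, fun v s => ?_, fun s t => ?_,
    fun A v => ?_⟩
  · simp
  · refine Finset.sum_eq_zero fun j _ => Finset.sum_eq_zero fun i _ => ?_
    split_ifs
    · rw [(formOf 4 φ).map_coord_zero 0 (by simp [ha]), mul_zero]
    · rfl
  · simp [ha]
  · simp [FilteredSubdeformation.betaComp, b01_coe]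
  · simp [FilteredSubdeformation.gammaComp, b11_fst]
  · simp [FilteredSubdeformation.deltaComp, b00_fst, Ring.lie_def]

end IsSymmetricSymbol

/-- The deformation is odd-generated if `h = 𝔥_(φ,S')` and the Dirac current is onto. -/
theorem IsSymmetricSymbol.oddGenerated {φ : ⋀[ℝ]^4 V} {S' : Submodule ℝ S}
    {R : V →ₗ[ℝ] V →ₗ[ℝ] Module.End ℝ V} (D : IsSymmetricSymbol φ (isotropy φ S') S' R)
    (hκ : ∀ v, v ∈ Submodule.span ℝ {u | ∃ s ∈ S', ∃ t ∈ S', u = kappa s t}) :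
    D.deformation.OddGenerated := by
  set T := Submodule.span ℝ
    {a : isotropy φ S' × V | ∃ s t : S', a = D.deformation.b11 s t} with hT
  have h1 : ∀ v, ∃ A, (A, v) ∈ T := by
    intro v
    induction hκ v using Submodule.span_induction with
    | mem x hx =>
      obtain ⟨s, hs, t, ht, rfl⟩ := hx
      exact ⟨_, Submodule.subset_span ⟨⟨s, hs⟩, ⟨t, ht⟩, rfl⟩⟩
    | zero => exact ⟨0, T.zero_mem⟩
    | add x y _ _ hx hy =>
      obtain ⟨A, hA⟩ := hx
      obtain ⟨B, hB⟩ := hy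
      exact ⟨A + B, T.add_mem hA hB⟩
    | smul c x _ hx =>
      obtain ⟨A, hA⟩ := hx
      exact ⟨c • A, T.smul_mem c hA⟩
  have h2 : ∀ x ∈ symSq S', ∃ a ∈ T, (a.1 : Module.End ℝ V) = TensorProduct.lift (gamma φ) x ∧
      a.2 = TensorProduct.lift kappa x := by
    intro x hx
    induction hx using Submodule.span_induction with
    | mem x hx =>
      obtain ⟨s, hs, rfl⟩ := hx
      exact ⟨_, Submodule.subset_span ⟨⟨s, hs⟩, ⟨s, hs⟩, rfl⟩, by simp [b11_fst], by simp [b11_snd]⟩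
    | zero => exact ⟨0, T.zero_mem, by simp, by simp⟩
    | add x y _ _ hx hy =>
      obtain ⟨a, ha, ha1, ha2⟩ := hx
      obtain ⟨b, hb, hb1, hb2⟩ := hy
      exact ⟨a + b, T.add_mem ha hb, by simp [ha1, hb1], by simp [ha2, hb2]⟩
    | smul c x _ hx =>
      obtain ⟨a, ha, ha1, ha2⟩ := hx
      exact ⟨c • a, T.smul_mem c ha, by simp [ha1], by simp [ha2]⟩
  -- Elements of 𝔥 come from tensors in the Dirac kernel, whose odd brackets have no V-component.
  have h3 : ∀ A : isotropy φ S', (A, (0 : V)) ∈ T := by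
    rintro ⟨A, hA⟩
    obtain ⟨x, ⟨hx, hx'⟩, rfl⟩ := hA
    obtain ⟨a, ha, ha1, ha2⟩ := h2 x hx
    convert ha using 1
    refine Prod.ext (Subtype.ext ha1.symm) ?_
    rw [ha2]
    exact (LinearMap.mem_ker.1 hx').symm
  rw [FilteredSubdeformation.OddGenerated, eq_top_iff]
  rintro ⟨A, v⟩ -
  obtain ⟨B, hB⟩ := h1 v
  convert T.add_mem hB (h3 (A - B)) using 1
  exact Prod.ext (add_sub_cancel B A).symm (add_zero v).symm

/-! ### The curvature tensors -/

/-- The transverse endomorphism with eigenvalues `c₁`, `c₂`, `c₃` on `e_1`, `E^⊤`, `E^⊥`. -/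
def Cmap (c₁ c₂ c₃ : ℝ) : V →ₗ[ℝ] V where
  toFun v := mkV 0 (c₁ * v 1) (c₂ • quatA v) (c₃ • quatB v) 0
  map_add' v w := by
    refine V_ext ?_ ?_ ?_ ?_ ?_ <;> simp [quatA_add, quatB_add, mul_add]
  map_smul' c v := by
    refine V_ext ?_ ?_ ?_ ?_ ?_ <;> simp [quatA_smul, quatB_smul, smul_comm c]
    ring

theorem Cmap_apply (c₁ c₂ c₃ : ℝ) (v : V) :
    Cmap c₁ c₂ c₃ v = mkV 0 (c₁ * v 1) (c₂ • quatA v) (c₃ • quatB v) 0 := rfl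

/-- The map `w ↦ e_+ ∧ w` on transverse vectors. -/
def nfv : V →ₗ[ℝ] Module.End ℝ V where
  toFun w := nf 0 0 0 w
  map_add' v w := by rw [nf_add]; simp
  map_smul' c v := by rw [RingHom.id_apply, smul_nf]; simp

theorem nfv_apply (w : V) : nfv w = nf 0 0 0 w := rfl

/-- The curvature tensor `R(v,w) = e_+ ∧ (η(e_+,v) C w - η(e_+,w) C v)`. -/
def Rpp (c₁ c₂ c₃ : ℝ) : V →ₗ[ℝ] V →ₗ[ℝ] Module.End ℝ V :=
  LinearMap.mk₂ ℝ (fun v w => nfv (v 10 • Cmap c₁ c₂ c₃ w - w 10 • Cmap c₁ c₂ c₃ v))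
    (by
      intro v v' w
      rw [← map_add]
      refine congrArg nfv ?_
      rw [map_add, Pi.add_apply]
      module)
    (by
      intro c v w
      rw [← LinearMap.map_smul nfv]
      refine congrArg nfv ?_
      rw [LinearMap.map_smul, Pi.smul_apply, smul_eq_mul]
      module)
    (by
      intro v w w'
      rw [← map_add]
      refine congrArg nfv ?_
      rw [map_add, Pi.add_apply]
      module)
    (by
      intro c v w
      rw [← LinearMap.map_smul nfv]
      refine congrArg nfv ?_
      rw [LinearMap.map_smul, Pi.smul_apply, smul_eq_mul]
      module)

section

variable {c₁ c₂ c₃ : ℝ}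

theorem Rpp_apply (v w : V) : Rpp c₁ c₂ c₃ v w =
    nf 0 0 0 (v 10 • Cmap c₁ c₂ c₃ w - w 10 • Cmap c₁ c₂ c₃ v) := rfl

theorem Rpp_mem_N1 (v w : V) : Rpp c₁ c₂ c₃ v w ∈ N1 :=
  ⟨0, 0, 0, _, rfl, rfl, by simp [Cmap_apply], by simp [Cmap_apply], rfl⟩

theorem Rpp_mem_N2 (v w : V) : Rpp 0 c₂ 0 v w ∈ N2 := by
  refine ⟨0, v 10 • c₂ • quatA w - w 10 • c₂ • quatA v, ?_⟩
  rw [Rpp_apply]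
  congr 1
  refine V_ext ?_ ?_ ?_ ?_ ?_ <;> simp [Cmap_apply, quatA_sub, quatB_sub, quatA_smul, quatB_smul]

theorem Rpp_self (v : V) : Rpp c₁ c₂ c₃ v v = 0 := by
  rw [Rpp_apply, sub_self, nf_zero]

/-- The rotations in `N1` commute with C, which is scalar on each of the three blocks; the null part
of A contributes v_- w_- Cu twice with opposite signs. -/
theorem lie_Rpp {A : Module.End ℝ V} (hA : A ∈ N1) (v w : V) :
    ⁅A, Rpp c₁ c₂ c₃ v w⁆ = Rpp c₁ c₂ c₃ (A v) w + Rpp c₁ c₂ c₃ v (A w) := by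
  obtain ⟨l, y, x, u, hy, hx, h0, h10, rfl⟩ := hA
  simp only [Rpp_apply]
  rw [lie_nf _ _ hy (by simp) hx (by simp), nf_add]
  congr 1
  · simp
  · simp
  · simp
  · refine V_ext ?_ ?_ ?_ ?_ ?_
    · simp [Cmap_apply]
    · simp [Cmap_apply]
    · simp [Cmap_apply, nf_apply]; ring
    · ext <;> simp [Cmap_apply, nf_apply, quatA_sub, quatA_smul, quatA_add] <;> ring
    · ext <;> simp [Cmap_apply, nf_apply, quatB_sub, quatB_smul, quatB_add] <;> ring

/-- The e_+-component cancels because C is symmetric, the transverse one because its terms are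
antisymmetric under exchange. -/
theorem Rpp_bianchi (u v w : V) :
    Rpp c₁ c₂ c₃ u v w + Rpp c₁ c₂ c₃ v w u + Rpp c₁ c₂ c₃ w u v = 0 := by
  simp only [Rpp_apply]
  refine V_ext ?_ ?_ ?_ ?_ ?_
  · simp [Cmap_apply, nf_apply]; ring
  · simp [nf_apply]
  · simp [Cmap_apply, nf_apply]; ring
  · simp [Cmap_apply, nf_apply, quatA_sub, quatA_smul, quatA_add]; module
  · simp [Cmap_apply, nf_apply, quatB_sub, quatB_smul, quatB_add]; module

theorem spinRep_Rpp (v w : V) (s : S) : spinRep (Rpp c₁ c₂ c₃ v w) s =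
    (-(√2 / 2) • (v 10 • gam (Cmap c₁ c₂ c₃ w) s.2 - w 10 • gam (Cmap c₁ c₂ c₃ v) s.2), 0) := by
  rw [Rpp_apply, spinRep_nf 0 rfl rfl (by simp [Cmap_apply]) (by simp [Cmap_apply])]
  have h : ∀ h : H4, sigH 0 0 0 h = 0 := fun h => by
    refine H4_ext ?_ ?_ ?_ ?_ <;> simp [sigH]
  rw [h, h]
  simp

/-- `Rpp` satisfies `[β_v, β_w] = σ(R(v,w))`. -/
theorem beta_phi0_curv {s : S} (h : ∀ w, (1 / 2 : ℝ) • JJ (BB w s.2) + (1 / 6 : ℝ) • BB w (JJ s.2) =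
    -(6 : ℝ) • gam (Cmap c₁ c₂ c₃ w) s.2) (v w : V) :
    beta phi0 v (beta phi0 w s) - beta phi0 w (beta phi0 v s) =
      spinRep (Rpp c₁ c₂ c₃ v w) s := by
  rw [spinRep_Rpp]
  simp only [beta_phi0, map_add, map_neg, map_smul]
  have hv := h v
  have hw := h w
  ext1
  · simp only [Prod.fst_sub]
    -- The factor -6 in the hypothesis reflects (√2/12) · (-6) = -√2/2, the coefficient in the spin
    -- action of e_+ ∧ w.
    linear_combination (norm := module)
      (√2 / 12 * v 10) • hw - (√2 / 12 * w 10) • hv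
  · simp only [Prod.snd_sub]
    module

/-- `Rpp` satisfies `R(v, κ(s,t)) = γ(β_v s, t) + γ(s, β_v t)`. -/
theorem Rpp_kappa {s t : S}
    (h1 : -(1 / 36 : ℝ) • Kv s.1 (JJ (JJ t.2)) + (1 / 6 : ℝ) • Kv (JJ s.1) (JJ t.2)
      - (1 / 4 : ℝ) • Kv (JJ (JJ s.1)) t.2 = Cmap c₁ c₂ c₃ (Kv s.1 t.2))
    (h2 : -(1 / 36 : ℝ) • Kv t.1 (JJ (JJ s.2)) + (1 / 6 : ℝ) • Kv (JJ t.1) (JJ s.2)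
      - (1 / 4 : ℝ) • Kv (JJ (JJ t.1)) s.2 = Cmap c₁ c₂ c₃ (Kv t.1 s.2))
    (h3 : ∀ v, (1 / 6 : ℝ) • (Kv (BB v s.2) (JJ t.2) + Kv (BB v t.2) (JJ s.2))
      - (1 / 2 : ℝ) • (Kv (JJ (BB v s.2)) t.2 + Kv (JJ (BB v t.2)) s.2) =
      (12 * dot s.2 t.2) • Cmap c₁ c₂ c₃ v)
    (h4 : ∀ v, Kv (BB v (JJ s.2)) t.2 + Kv (BB v t.2) (JJ s.2)
      + (Kv (BB v s.2) (JJ t.2) + Kv (BB v (JJ t.2)) s.2) = 0) (v : V) :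
    Rpp c₁ c₂ c₃ v (kappa s t) = gamma phi0 (beta phi0 v s) t + gamma phi0 s (beta phi0 v t) := by
  have hC : Cmap c₁ c₂ c₃ (kappa s t) =
      Cmap c₁ c₂ c₃ (Kv s.1 t.2) + Cmap c₁ c₂ c₃ (Kv t.1 s.2) := by
    have z0 : Cmap c₁ c₂ c₃ (e 0) = 0 := by
      refine V_ext ?_ ?_ ?_ ?_ ?_ <;> simp [Cmap_apply, e_apply] <;> right <;> ext <;>
        simp [e_apply]
    have z10 : Cmap c₁ c₂ c₃ (e 10) = 0 := by
      refine V_ext ?_ ?_ ?_ ?_ ?_ <;> simp [Cmap_apply, e_apply] <;> right <;> ext <;>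
        simp [e_apply]
    rw [kappa_eq]
    simp only [map_add, map_sub, map_smul, z0, z10]
    module
  -- This compares the null rotations: `h1` and `h2` match the terms with v_-, and `h3` matches
  -- those with κ(s,t)_-. The rotations, which R does not contain, cancel by `h4`.
  have hw : wv (beta phi0 v s) t + wv s (beta phi0 v t) =
      v 10 • Cmap c₁ c₂ c₃ (kappa s t) - kappa s t 10 • Cmap c₁ c₂ c₃ v := by
    rw [hC, ← h1, ← h2, kappa_ten_coord]
    simp only [wv, beta_phi0, map_add, map_neg, map_smul, LinearMap.add_apply,
      LinearMap.smul_apply]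
    linear_combination (norm := module) (√2 / 12) • h3 v
  refine LinearMap.ext fun u => ?_
  rw [LinearMap.add_apply, gamma_phi0_apply, gamma_phi0_apply, Rpp_apply, ← hw, ← nfv_apply,
    ← nfv_apply, ← nfv_apply, map_add, LinearMap.add_apply]
  simp only [beta_phi0, map_neg, map_smul, LinearMap.neg_apply, LinearMap.smul_apply]
  linear_combination (norm := module) -(√2 / 12 * v 10 / 6) • h4 u

end

/-! ### The curvatures R_1 and R_2 and the identities fixing their eigenvalues -/

theorem part_apply (a b : Fin 11) (v : V) (i : Fin 11) :
    part a b v i = if i ∈ Finset.Icc a b then v i else 0 := by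
  simp [part, Finset.sum_apply, e_apply]

theorem eta_ePlus_part (v : V) : eta ePlus (part 10 10 v) = v 10 := by
  simp [eta_apply, e_apply, part_apply]

theorem wedge_swap (v w : V) : wedge v w = -wedge w v := by
  simp [wedge]

theorem wedge_part {a b : Fin 11} (h : 0 < a) (h' : b < 10) (v : V) :
    wedge (part a b v) ePlus = -nfv (part a b v) := by
  rw [wedge_swap, wedge_ePlus, nfv_apply]
  · rw [part_apply, if_neg (by simp [h.ne'])]
  · rw [part_apply, if_neg (by simp [h'])]

theorem R1_eq (v w : V) : R1 v w = Rpp (4 / 9) (1 / 36) (1 / 9) v w := by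
  have hC : ∀ v, Cmap (4 / 9) (1 / 36) (1 / 9) v = (4 / 9 : ℝ) • part 1 1 v
      + (1 / 36 : ℝ) • part 2 5 v + (1 / 9 : ℝ) • part 6 9 v := fun v => by
    refine V_ext ?_ ?_ ?_ ?_ ?_
    · simp [Cmap_apply, part_apply]
    · simp [Cmap_apply, part_apply]
    · simp [Cmap_apply, part_apply]
    · ext <;> simp [Cmap_apply, part_apply]
    · ext <;> simp [Cmap_apply, part_apply]
  rw [R1, Rpp_apply, ← nfv_apply, hC, hC, eta_ePlus_part, eta_ePlus_part]
  simp only [wedge_part (show (0 : Fin 11) < 1 by decide) (show (1 : Fin 11) < 10 by decide),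
    wedge_part (show (0 : Fin 11) < 2 by decide) (show (5 : Fin 11) < 10 by decide),
    wedge_part (show (0 : Fin 11) < 6 by decide) (show (9 : Fin 11) < 10 by decide), map_add,
    map_sub, map_smul]
  module

theorem R2_eq (v w : V) : R2 v w = Rpp 0 (1 / 4) 0 v w := by
  have hC : ∀ v, Cmap 0 (1 / 4) 0 v = (1 / 4 : ℝ) • part 2 5 v := fun v => by
    refine V_ext ?_ ?_ ?_ ?_ ?_
    · simp [Cmap_apply, part_apply]
    · simp [Cmap_apply, part_apply]
    · simp [Cmap_apply, part_apply]
    · ext <;> simp [Cmap_apply, part_apply]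
    · ext <;> simp [Cmap_apply, part_apply]
  rw [R2, Rpp_apply, ← nfv_apply, hC, hC, eta_ePlus_part, eta_ePlus_part]
  simp only [wedge_part (show (0 : Fin 11) < 2 by decide) (show (5 : Fin 11) < 10 by decide),
    map_sub, map_smul]
  module

/-- On im J, where J² = -1, `BB w` is 4γJ, γJ or -2γJ for w along e_1, E^⊤ or E^⊥, since γ(w)
commutes with J, maps into its kernel, or anticommutes with it. The left side becomes -8/3, -1/6,
-2/3 times γ, that is, -6 times the eigenvalues. -/
theorem BB_gam_S1 {s : S} (hs : s ∈ S1) (w : V) :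
    (1 / 2 : ℝ) • JJ (BB w s.2) + (1 / 6 : ℝ) • BB w (JJ s.2) =
      -(6 : ℝ) • gam (Cmap (4 / 9) (1 / 36) (1 / 9) w) s.2 := by
  obtain ⟨s1, s3⟩ := mem_S1.1 hs
  refine H4_ext ?_ ?_ ?_ ?_ <;>
    simp only [BB_apply, Cmap_apply, s1, s3, JJ_apply_zero, JJ_apply_one, JJ_apply_two,
      JJ_apply_three, gam_apply_zero, gam_apply_one, gam_apply_two, gam_apply_three, Pi.add_apply,
      Pi.smul_apply, mkV_one, quatA_mkV, quatB_mkV, mul_zero, zero_mul, add_zero, zero_add,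
      sub_zero, zero_sub, smul_zero] <;>
    ext <;> simp only [Quaternion.re_add, Quaternion.imI_add, Quaternion.imJ_add,
      Quaternion.imK_add, Quaternion.re_sub, Quaternion.imI_sub, Quaternion.imJ_sub,
      Quaternion.imK_sub, Quaternion.re_neg, Quaternion.imI_neg, Quaternion.imJ_neg,
      Quaternion.imK_neg, Quaternion.re_mul, Quaternion.imI_mul, Quaternion.imJ_mul,
      Quaternion.imK_mul, Quaternion.re_smul, Quaternion.imI_smul, Quaternion.imJ_smul,
      Quaternion.imK_smul, Quaternion.re_star, Quaternion.imI_star, Quaternion.imJ_star,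
      Quaternion.imK_star, qI_re, qI_imI, qI_imJ, qI_imK, smul_eq_mul, quatA_re, quatA_imI,
      quatA_imJ, quatA_imK, quatB_re, quatB_imI, quatB_imJ, quatB_imK] <;> ring

/-- On ker J the left side is (3/2) J² γ(w). Only w in E^⊤ moves the spinor into im J, where J² =
-1. -/
theorem BB_gam_S2 {s : S} (hs : s ∈ S2) (w : V) :
    (1 / 2 : ℝ) • JJ (BB w s.2) + (1 / 6 : ℝ) • BB w (JJ s.2) =
      -(6 : ℝ) • gam (Cmap 0 (1 / 4) 0 w) s.2 := by
  obtain ⟨s1, s3⟩ := mem_S2.1 hs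
  refine H4_ext ?_ ?_ ?_ ?_ <;>
    simp only [BB_apply, Cmap_apply, s1, s3, JJ_apply_zero, JJ_apply_one, JJ_apply_two,
      JJ_apply_three, gam_apply_zero, gam_apply_one, gam_apply_two, gam_apply_three, Pi.add_apply,
      Pi.smul_apply, mkV_one, quatA_mkV, quatB_mkV, mul_zero, zero_mul, add_zero, zero_add,
      sub_zero, zero_sub, smul_zero, neg_zero] <;>
    ext <;> simp only [Quaternion.re_add, Quaternion.imI_add, Quaternion.imJ_add,
      Quaternion.imK_add, Quaternion.re_neg, Quaternion.imI_neg, Quaternion.imJ_neg,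
      Quaternion.imK_neg, Quaternion.re_mul, Quaternion.imI_mul, Quaternion.imJ_mul,
      Quaternion.imK_mul, Quaternion.re_smul, Quaternion.imI_smul, Quaternion.imJ_smul,
      Quaternion.imK_smul, Quaternion.re_star, Quaternion.imI_star, Quaternion.imJ_star,
      Quaternion.imK_star, Quaternion.re_zero, Quaternion.imI_zero, Quaternion.imJ_zero,
      Quaternion.imK_zero, qI_re, qI_imI, qI_imJ, qI_imK, smul_eq_mul, quatA_re, quatA_imI,
      quatA_imJ, quatA_imK, quatB_re, quatB_imI, quatB_imJ, quatB_imK] <;> ring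

/-- The left side is minus the square of J/2 on h combined with -J/6 on x, the action of β(e_-).
Along e_1 and E^⊥ both parts contribute, giving (1/2 ± 1/6)²; along E^⊤ the relevant part of h is
killed by J, leaving (1/6)². -/
theorem Kv_C_S1 (h : H4) {x : H4} (x1 : x 1 = 0) (x3 : x 3 = 0) :
    -(1 / 36 : ℝ) • Kv h (JJ (JJ x)) + (1 / 6 : ℝ) • Kv (JJ h) (JJ x)
      - (1 / 4 : ℝ) • Kv (JJ (JJ h)) x = Cmap (4 / 9) (1 / 36) (1 / 9) (Kv h x) := by
  refine V_ext ?_ ?_ ?_ ?_ ?_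
  · simp [Kv_apply, Cmap_apply]
  · simp [Kv_apply, Cmap_apply]
  · simp [Kv_apply, Cmap_apply, kap1, x1, x3, inner_quat]; ring
  · simp only [Kv_apply, Cmap_apply, kapA, x1, x3, JJ_apply_zero, JJ_apply_one, JJ_apply_two,
    JJ_apply_three, quatA_add, quatA_sub, quatA_smul, quatA_mkV,
    quatB_mkV, mul_zero, add_zero, zero_add, sub_zero, smul_zero,
    star_zero]
    ext <;> simp only [Quaternion.re_sub, Quaternion.imI_sub, Quaternion.imJ_sub,
      Quaternion.imK_sub, Quaternion.re_neg, Quaternion.imI_neg, Quaternion.imJ_neg,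
      Quaternion.imK_neg, Quaternion.re_mul, Quaternion.imI_mul, Quaternion.imJ_mul,
      Quaternion.imK_mul, Quaternion.re_smul, Quaternion.imI_smul, Quaternion.imJ_smul,
      Quaternion.imK_smul, Quaternion.re_star, Quaternion.imI_star, Quaternion.imJ_star,
      Quaternion.imK_star, qI_re, qI_imI, qI_imJ, qI_imK, smul_eq_mul] <;> ring
  · simp only [Kv_apply, Cmap_apply, kapB, x1, x3, JJ_apply_zero, JJ_apply_one, JJ_apply_two,
    JJ_apply_three, quatA_mkV, quatB_add, quatB_sub, quatB_smul,
    quatB_mkV, mul_zero, zero_mul, add_zero,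
    star_zero]
    ext <;> simp only [Quaternion.re_add, Quaternion.imI_add, Quaternion.imJ_add,
      Quaternion.imK_add, Quaternion.re_sub, Quaternion.imI_sub, Quaternion.imJ_sub,
      Quaternion.imK_sub, Quaternion.re_neg, Quaternion.imI_neg, Quaternion.imJ_neg,
      Quaternion.imK_neg, Quaternion.re_mul, Quaternion.imI_mul, Quaternion.imJ_mul,
      Quaternion.imK_mul, Quaternion.re_smul, Quaternion.imI_smul, Quaternion.imJ_smul,
      Quaternion.imK_smul, Quaternion.re_star, Quaternion.imI_star, Quaternion.imJ_star,
      Quaternion.imK_star, qI_re, qI_imI, qI_imJ, qI_imK, smul_eq_mul] <;> ring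

theorem Kv_C_S2 (h : H4) {x : H4} (x0 : x 0 = 0) (x2 : x 2 = 0) :
    -(1 / 36 : ℝ) • Kv h (JJ (JJ x)) + (1 / 6 : ℝ) • Kv (JJ h) (JJ x)
      - (1 / 4 : ℝ) • Kv (JJ (JJ h)) x = Cmap 0 (1 / 4) 0 (Kv h x) := by
  refine V_ext ?_ ?_ ?_ ?_ ?_
  · simp [Kv_apply, Cmap_apply]
  · simp [Kv_apply, Cmap_apply]
  · simp [Kv_apply, Cmap_apply, kap1, x0, x2, inner_quat]
  · simp only [Kv_apply, Cmap_apply, kapA, x0, x2, JJ_apply_zero, JJ_apply_one, JJ_apply_two,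
    JJ_apply_three, quatA_add, quatA_sub, quatA_smul, quatA_mkV,
    quatB_mkV, mul_zero, zero_mul, add_zero, sub_zero, zero_sub, smul_zero, neg_zero,
    star_zero]
    ext <;> simp only [Quaternion.re_sub, Quaternion.imI_sub, Quaternion.imJ_sub,
      Quaternion.imK_sub, Quaternion.re_neg, Quaternion.imI_neg, Quaternion.imJ_neg,
      Quaternion.imK_neg, Quaternion.re_mul, Quaternion.imI_mul, Quaternion.imJ_mul,
      Quaternion.imK_mul, Quaternion.re_smul, Quaternion.imI_smul, Quaternion.imJ_smul,
      Quaternion.imK_smul, Quaternion.re_star, Quaternion.imI_star, Quaternion.imJ_star,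
      Quaternion.imK_star, qI_re, qI_imI, qI_imJ, qI_imK, smul_eq_mul] <;> ring
  · simp only [Kv_apply, Cmap_apply, kapB, x0, x2, JJ_apply_zero, JJ_apply_one, JJ_apply_two,
    JJ_apply_three, quatA_mkV, quatB_add, quatB_sub, quatB_smul,
    quatB_mkV, mul_zero, zero_mul, add_zero, zero_add, sub_zero, smul_zero, neg_zero,
    star_zero]
    ext <;> simp only [Quaternion.re_add, Quaternion.imI_add, Quaternion.imJ_add,
      Quaternion.imK_add, Quaternion.re_mul, Quaternion.imI_mul, Quaternion.imJ_mul,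
      Quaternion.imK_mul, Quaternion.re_smul, Quaternion.imI_smul, Quaternion.imJ_smul,
      Quaternion.imK_smul, Quaternion.re_star, Quaternion.imI_star, Quaternion.imJ_star,
      Quaternion.imK_star, Quaternion.re_zero, Quaternion.imI_zero, Quaternion.imJ_zero,
      Quaternion.imK_zero, smul_eq_mul] <;> ring


/-- This is the part of R(v, κ(s,t)) coming from κ(s,t)_- = -√2 (s_-, t_-); the constant 12
compensates the factor √2/12 of `BB` in β. -/
theorem Kv_BB_S1 {x z : H4} (x1 : x 1 = 0) (x3 : x 3 = 0) (z1 : z 1 = 0) (z3 : z 3 = 0) (v : V) :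
    (1 / 6 : ℝ) • (Kv (BB v x) (JJ z) + Kv (BB v z) (JJ x))
      - (1 / 2 : ℝ) • (Kv (JJ (BB v x)) z + Kv (JJ (BB v z)) x) =
      (12 * dot x z) • Cmap (4 / 9) (1 / 36) (1 / 9) v := by
  have hx := BB_of_mem_S1 v x1 x3
  have hz := BB_of_mem_S1 v z1 z3
  refine V_ext ?_ ?_ ?_ ?_ ?_
  · simp [Kv_apply, Cmap_apply]
  · simp [Kv_apply, Cmap_apply]
  · simp [Kv_apply, Cmap_apply, kap1, inner_quat, dot_apply, hx, hz, x1, x3, z1, z3]; ring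
  · simp only [quatA_sub, quatA_smul, quatA_add, quatA_mkV,
    Kv_apply, Cmap_apply, kapA, hx, hz, x1, x3, z1, z3, JJ_apply_zero, JJ_apply_one,
    JJ_apply_two, JJ_apply_three, dot_apply, inner_quat, Matrix.cons_val_zero, Matrix.cons_val_one,
    Matrix.cons_val, mul_zero, add_zero, zero_add, sub_zero, smul_zero,
    star_zero]
    ext <;> simp only [Quaternion.re_add, Quaternion.imI_add, Quaternion.imJ_add,
      Quaternion.imK_add, Quaternion.re_sub, Quaternion.imI_sub, Quaternion.imJ_sub,
      Quaternion.imK_sub, Quaternion.re_neg, Quaternion.imI_neg, Quaternion.imJ_neg,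
      Quaternion.imK_neg, Quaternion.re_mul, Quaternion.imI_mul, Quaternion.imJ_mul,
      Quaternion.imK_mul, Quaternion.re_smul, Quaternion.imI_smul, Quaternion.imJ_smul,
      Quaternion.imK_smul, Quaternion.re_star, Quaternion.imI_star, Quaternion.imJ_star,
      Quaternion.imK_star, Quaternion.re_zero, Quaternion.imI_zero, Quaternion.imJ_zero,
      Quaternion.imK_zero, qI_re, qI_imI, qI_imJ, qI_imK, smul_eq_mul, quatA_re, quatA_imI,
      quatA_imJ, quatA_imK] <;> ring
  · simp only [quatB_sub, quatB_smul, quatB_add,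
    quatB_mkV, Kv_apply, Cmap_apply, kapB, hx, hz, x1, x3, z1, z3, JJ_apply_zero, JJ_apply_one,
    JJ_apply_two, JJ_apply_three, dot_apply, inner_quat, Matrix.cons_val_zero, Matrix.cons_val_one,
    Matrix.cons_val, mul_zero, zero_mul, add_zero,
    star_zero]
    ext <;> simp only [Quaternion.re_add, Quaternion.imI_add, Quaternion.imJ_add,
      Quaternion.imK_add, Quaternion.re_sub, Quaternion.imI_sub, Quaternion.imJ_sub,
      Quaternion.imK_sub, Quaternion.re_neg, Quaternion.imI_neg, Quaternion.imJ_neg,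
      Quaternion.imK_neg, Quaternion.re_mul, Quaternion.imI_mul, Quaternion.imJ_mul,
      Quaternion.imK_mul, Quaternion.re_smul, Quaternion.imI_smul, Quaternion.imJ_smul,
      Quaternion.imK_smul, Quaternion.re_star, Quaternion.imI_star, Quaternion.imJ_star,
      Quaternion.imK_star, Quaternion.re_zero, Quaternion.imI_zero, Quaternion.imJ_zero,
      Quaternion.imK_zero, qI_re, qI_imI, qI_imJ, qI_imK, smul_eq_mul, quatB_re, quatB_imI,
      quatB_imJ, quatB_imK] <;> ring

theorem Kv_BB_S2 {x z : H4} (x1 : x 0 = 0) (x3 : x 2 = 0) (z1 : z 0 = 0) (z3 : z 2 = 0) (v : V) :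
    (1 / 6 : ℝ) • (Kv (BB v x) (JJ z) + Kv (BB v z) (JJ x))
      - (1 / 2 : ℝ) • (Kv (JJ (BB v x)) z + Kv (JJ (BB v z)) x) =
      (12 * dot x z) • Cmap 0 (1 / 4) 0 v := by
  refine V_ext ?_ ?_ ?_ ?_ ?_
  · simp [Kv_apply, Cmap_apply]
  · simp [Kv_apply, Cmap_apply]
  · simp [Kv_apply, Cmap_apply, BB_apply, kap1, x1, x3, z1, z3]
  · ext <;> simp [Kv_apply, Cmap_apply, BB_apply, kapA, x1, x3, z1, z3, inner_quat, dot_apply] <;>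
      ring
  · ext <;> simp [Kv_apply, Cmap_apply, BB_apply, kapB, x1, x3, z1, z3]

theorem qI_mul_qI_mul (x : ℍ[ℝ]) : qI * (qI * x) = -x := by
  ext <;> simp

/-- The rotational part of γ^φ on ⊙²S_- is invariant under J. This is needed because β(e_-) acts on
S_- through J, while R takes values in null rotations. -/
theorem Kv_BB_JJ_S1 {x z : H4} (x1 : x 1 = 0) (x3 : x 3 = 0) (z1 : z 1 = 0) (z3 : z 3 = 0)
    (v : V) : Kv (BB v (JJ x)) z + Kv (BB v z) (JJ x) + (Kv (BB v x) (JJ z) + Kv (BB v (JJ z)) x) =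
      0 := by
  have hx := BB_of_mem_S1 v x1 x3
  have hz := BB_of_mem_S1 v z1 z3
  have hx' := BB_of_mem_S1 v (JJ_apply_one x) (JJ_apply_three x)
  have hz' := BB_of_mem_S1 v (JJ_apply_one z) (JJ_apply_three z)
  refine V_ext ?_ ?_ ?_ ?_ ?_
  · simp [Kv_apply]
  · simp [Kv_apply]
  · simp [Kv_apply, kap1, inner_quat, hx, hz, hx', hz', x1, x3, z1, z3]; ring
  · ext <;> simp [Kv_apply, kapA, hx, hz, hx', hz', x1, x3, z1, z3] <;> ring
  · simp [Kv_apply, kapB, hx, hz, hx', hz', x1, x3, z1, z3, quatB_add, star_qI, mul_add, add_mul,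
      mul_assoc, qI_mul_qI_mul, -QuaternionAlgebra.star_smul]
    module

theorem Kv_BB_JJ_S2 {x z : H4} (x1 : x 0 = 0) (x3 : x 2 = 0) (z1 : z 0 = 0) (z3 : z 2 = 0)
    (v : V) : Kv (BB v (JJ x)) z + Kv (BB v z) (JJ x) + (Kv (BB v x) (JJ z) + Kv (BB v (JJ z)) x) =
      0 := by
  have hx : JJ x = 0 := by refine H4_ext ?_ ?_ ?_ ?_ <;> simp [x1, x3]
  have hz : JJ z = 0 := by refine H4_ext ?_ ?_ ?_ ?_ <;> simp [z1, z3]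
  simp [hx, hz]

/-! ### The cubic identity -/

theorem wv_self_S1 {s : S} (hs : s ∈ S1) : wv s s =
    mkV 0 ((4 / 3) * (inner ℝ (s.1 0) (qI * s.2 0) + inner ℝ (s.1 2) (qI * s.2 2)))
      ((1 / 3 : ℝ) • (qI * s.2 0 * star (s.1 1) + qI * s.2 2 * star (s.1 3)))
      (-(2 / 3 : ℝ) • (star (s.2 2) * qI * s.1 0 + star (s.1 2) * qI * s.2 0)) 0 := by
  obtain ⟨s1, s3⟩ := mem_S1.1 hs
  refine V_ext ?_ ?_ ?_ ?_ ?_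
  · simp
  · simp
  · simp [wv, Kv_apply, kap1, inner_quat, s1, s3]; ring
  · ext <;> simp [wv, Kv_apply, kapA, s1, s3] <;> ring
  · ext <;> simp [wv, Kv_apply, kapB, s1, s3] <;> ring

theorem cubic_S1 {s : S} (hs : s ∈ S1) :
    spinRep (gamma phi0 s s) s + beta phi0 (kappa s s) s = 0 := by
  obtain ⟨s1, s3⟩ := mem_S1.1 hs
  rw [gamma_of_mem_S1 hs hs, spinRep_nf, beta_phi0, kappa_ten_coord, BB_of_mem_S1 _ s1 s3,
    kappa_one_coord, quatA_kappa, quatB_kappa, wv_self_S1 hs, kap1, kapA, kapB]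
  · obtain ⟨h, x⟩ := s
    simp only [dot_apply, inner_quat] at s1 s3 ⊢
    -- Every term carries exactly one factor √2, so the identity is polynomial in the real
    -- components and does not use √2² = 2.
    ext1
    · refine H4_ext ?_ ?_ ?_ ?_ <;>
        simp only [Prod.fst_add, Pi.add_apply, Pi.sub_apply, Pi.smul_apply, sigH,
          gam_apply_zero, gam_apply_one, gam_apply_two, gam_apply_three, JJ_apply_zero,
          JJ_apply_one, JJ_apply_two, JJ_apply_three, mkV_one, quatA_mkV, quatB_mkV,
          Matrix.cons_val_zero, Matrix.cons_val_one, Matrix.cons_val, s1, s3, mul_zero,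
          zero_mul, add_zero, zero_add, sub_zero, zero_sub, smul_zero, neg_zero, star_zero,
          Prod.fst_zero, Pi.zero_apply, Quaternion.re_zero, Quaternion.imI_zero,
          Quaternion.imJ_zero, Quaternion.imK_zero] <;> ext <;>
        simp only [Quaternion.re_add, Quaternion.imI_add, Quaternion.imJ_add,
          Quaternion.imK_add, Quaternion.re_sub, Quaternion.imI_sub, Quaternion.imJ_sub,
          Quaternion.imK_sub, Quaternion.re_neg, Quaternion.imI_neg, Quaternion.imJ_neg,
          Quaternion.imK_neg, Quaternion.re_mul, Quaternion.imI_mul, Quaternion.imJ_mul,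
          Quaternion.imK_mul, Quaternion.re_smul, Quaternion.imI_smul, Quaternion.imJ_smul,
          Quaternion.imK_smul, Quaternion.re_star, Quaternion.imI_star, Quaternion.imJ_star,
          Quaternion.imK_star, Quaternion.re_zero, Quaternion.imI_zero, Quaternion.imJ_zero,
          Quaternion.imK_zero, qI_re, qI_imI, qI_imJ, qI_imK, smul_eq_mul] <;>
        ring
    · refine H4_ext ?_ ?_ ?_ ?_ <;>
        simp only [Prod.snd_add, Pi.add_apply, Pi.neg_apply, Pi.smul_apply, sigH, JJ_apply_zero,
          JJ_apply_one, JJ_apply_two, JJ_apply_three, Matrix.cons_val_zero, Matrix.cons_val_one,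
          Matrix.cons_val, s1, s3, mul_zero, zero_mul, add_zero, zero_add, sub_zero, smul_zero,
          neg_zero, star_zero, Prod.snd_zero, Pi.zero_apply, Quaternion.re_zero,
          Quaternion.imI_zero, Quaternion.imJ_zero, Quaternion.imK_zero] <;> ext <;>
        simp only [Quaternion.re_add, Quaternion.imI_add, Quaternion.imJ_add,
          Quaternion.imK_add, Quaternion.re_sub, Quaternion.imI_sub, Quaternion.imJ_sub,
          Quaternion.imK_sub, Quaternion.re_neg, Quaternion.imI_neg, Quaternion.imJ_neg,
          Quaternion.imK_neg, Quaternion.re_mul, Quaternion.imI_mul, Quaternion.imJ_mul,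
          Quaternion.imK_mul, Quaternion.re_smul, Quaternion.imI_smul, Quaternion.imJ_smul,
          Quaternion.imK_smul, Quaternion.re_star, Quaternion.imI_star, Quaternion.imJ_star,
          Quaternion.imK_star, Quaternion.re_zero, Quaternion.imI_zero, Quaternion.imJ_zero,
          Quaternion.imK_zero, qI_re, qI_imI, qI_imJ, qI_imK, smul_eq_mul] <;>
        ring
  · simp; ring_nf
  · simp; ring_nf
  · simp
  · simp

theorem wv_self_S2 {s : S} (hs : s ∈ S2) : wv s s =
    mkV 0 0 (-(qI * s.1 0 * star (s.2 1) + qI * s.1 2 * star (s.2 3))) 0 0 := by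
  obtain ⟨s1, s3⟩ := mem_S2.1 hs
  rw [wv_of_mem_S2 hs hs]
  congr 1
  ext <;> simp [wv, Kv_apply, kapA, s1, s3] <;> ring

theorem BB_of_mem_S2 (v : V) {x : H4} (h0 : x 0 = 0) (h2 : x 2 = 0) : BB v x =
    ![(3 : ℝ) • (qI * quatA v * x 1), 0, (3 : ℝ) • (qI * quatA v * x 3), 0] := by
  refine H4_ext ?_ ?_ ?_ ?_ <;> simp [BB_apply, h0, h2, mul_assoc]

theorem cubic_S2 {s : S} (hs : s ∈ S2) :
    spinRep (gamma phi0 s s) s + beta phi0 (kappa s s) s = 0 := by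
  obtain ⟨s1, s3⟩ := mem_S2.1 hs
  rw [gamma_of_mem_S2 hs hs, spinRep_nf, beta_phi0, kappa_ten_coord, BB_of_mem_S2 _ s1 s3,
    quatA_kappa, wv_self_S2 hs, kapA]
  · obtain ⟨h, x⟩ := s
    simp only [dot_apply, inner_quat] at s1 s3 ⊢
    ext1
    · refine H4_ext ?_ ?_ ?_ ?_ <;>
        simp only [Prod.fst_add, Pi.add_apply, Pi.sub_apply, Pi.smul_apply, sigH, gam_apply_zero,
          gam_apply_one, gam_apply_two, gam_apply_three, JJ_apply_zero, JJ_apply_one, JJ_apply_two,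
          JJ_apply_three, mkV_one, quatA_mkV, quatB_mkV, s1, s3, Prod.fst_zero, Pi.zero_apply,
          Matrix.cons_val_zero, Matrix.cons_val_one, Matrix.cons_val, mul_zero, zero_mul, add_zero,
          zero_add, sub_zero, zero_sub, smul_zero, neg_zero, star_zero] <;> ext <;>
        simp only [Quaternion.re_add, Quaternion.imI_add, Quaternion.imJ_add,
          Quaternion.imK_add, Quaternion.re_sub, Quaternion.imI_sub, Quaternion.imJ_sub,
          Quaternion.imK_sub, Quaternion.re_neg, Quaternion.imI_neg, Quaternion.imJ_neg,
          Quaternion.imK_neg, Quaternion.re_mul, Quaternion.imI_mul, Quaternion.imJ_mul,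
          Quaternion.imK_mul, Quaternion.re_smul, Quaternion.imI_smul, Quaternion.imJ_smul,
          Quaternion.imK_smul, Quaternion.re_star, Quaternion.imI_star, Quaternion.imJ_star,
          Quaternion.imK_star, Quaternion.re_zero, Quaternion.imI_zero, Quaternion.imJ_zero,
          Quaternion.imK_zero, qI_re, qI_imI, qI_imJ, qI_imK, smul_eq_mul] <;> ring
    · refine H4_ext ?_ ?_ ?_ ?_ <;>
        simp only [Prod.snd_add, Pi.add_apply, Pi.neg_apply, Pi.smul_apply] <;> ext <;>
        simp [sigH, s1, s3]
  · simp
  · simp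
  · simp
  · simp

/-! ### The symmetric symbols -/

/-- The geometric symbol `(φ, S'_1)`, with the curvature `R_1`. -/
theorem isSymmetricSymbol_S1 :
    IsSymmetricSymbol phi0 (isotropy phi0 S1) S1 (Rpp (4 / 9) (1 / 36) (1 / 9)) where
  dim_gt := isLiePair_S1.1
  h_le_so A hA := mem_N1_so (isotropy_S1 ▸ hA)
  h_lie A hA B hB := by
    rw [isotropy_S1] at hA hB ⊢
    exact lie_mem_N1 hA hB
  h_phi A hA := extAct_phi0_of_mem_N1 (isotropy_S1 ▸ hA)
  h_spin A hA s hs := spinRep_mem_S1 (isotropy_S1 ▸ hA) hs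
  beta_mem v s hs := by
    obtain ⟨s1, s3⟩ := mem_S1.1 hs
    rw [mem_S1, beta_phi0]
    simp
  gamma_mem s hs t ht := by
    rw [isotropy_S1]
    exact gamma_mem_N1 hs ht
  R_mem v w := by
    rw [isotropy_S1]
    exact Rpp_mem_N1 v w
  R_self := Rpp_self
  R_inv A hA := lie_Rpp (isotropy_S1 ▸ hA)
  bianchi := Rpp_bianchi
  curv v w s hs := beta_phi0_curv (BB_gam_S1 hs) v w
  R_kappa v s hs t ht := by
    obtain ⟨s1, s3⟩ := mem_S1.1 hs
    obtain ⟨t1, t3⟩ := mem_S1.1 ht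
    exact Rpp_kappa (Kv_C_S1 _ t1 t3) (Kv_C_S1 _ s1 s3) (Kv_BB_S1 s1 s3 t1 t3)
      (Kv_BB_JJ_S1 s1 s3 t1 t3) v
  cubic _ := cubic_S1

/-- The geometric symbol `(φ, S'_2)`, with the curvature `R_2`. -/
theorem isSymmetricSymbol_S2 :
    IsSymmetricSymbol phi0 (isotropy phi0 S2) S2 (Rpp 0 (1 / 4) 0) where
  dim_gt := isLiePair_S2.1
  h_le_so A hA := mem_N1_so (N2_le_N1 (isotropy_S2 ▸ hA))
  h_lie A hA B hB := by
    rw [isotropy_S2] at hA hB ⊢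
    exact lie_mem_N2 hA hB
  h_phi A hA := extAct_phi0_of_mem_N1 (N2_le_N1 (isotropy_S2 ▸ hA))
  h_spin A hA s hs := spinRep_mem_S2 (N2_le_N1 (isotropy_S2 ▸ hA)) hs
  beta_mem v s hs := by
    obtain ⟨s1, s3⟩ := mem_S2.1 hs
    rw [mem_S2, beta_phi0]
    simp [s1, s3]
  gamma_mem s hs t ht := by
    rw [isotropy_S2]
    exact gamma_mem_N2 hs ht
  R_mem v w := by
    rw [isotropy_S2]
    exact Rpp_mem_N2 v w
  R_self := Rpp_self
  R_inv A hA := lie_Rpp (N2_le_N1 (isotropy_S2 ▸ hA))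
  bianchi := Rpp_bianchi
  curv v w s hs := beta_phi0_curv (BB_gam_S2 hs) v w
  R_kappa v s hs t ht := by
    obtain ⟨s1, s3⟩ := mem_S2.1 hs
    obtain ⟨t1, t3⟩ := mem_S2.1 ht
    exact Rpp_kappa (Kv_C_S2 _ t1 t3) (Kv_C_S2 _ s1 s3) (Kv_BB_S2 s1 s3 t1 t3)
      (Kv_BB_JJ_S2 s1 s3 t1 t3) v
  cubic _ := cubic_S2

/-- Squares in S_+ produce e_+, a square in S_- produces e_-, and a single x in S_- paired with all
of S_+ already produces every transverse vector. -/
theorem mem_span_kappa {S' : Submodule ℝ S} {x : H4} (hS : ∀ h : H4, (h, (0 : H4)) ∈ S')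
    (hx : ((0 : H4), x) ∈ S') (hd : dot x x = 1)
    (hK : ∀ v : V, ∃ h : H4, Kv h x = mkV 0 (v 1) (quatA v) (quatB v) 0) (v : V) :
    v ∈ Submodule.span ℝ {u | ∃ s ∈ S', ∃ t ∈ S', u = kappa s t} := by
  set T := Submodule.span ℝ {u | ∃ s ∈ S', ∃ t ∈ S', u = kappa s t}
  have m : ∀ s ∈ S', ∀ t ∈ S', kappa s t ∈ T := fun s hs t ht =>
    Submodule.subset_span ⟨s, hs, t, ht, rfl⟩
  obtain ⟨h, hh⟩ := hK v
  have hs : √2 ≠ 0 := by positivity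
  have e0 : e 0 ∈ T := by
    have h1 := T.smul_mem (-(√2)⁻¹) (m _ (hS x) _ (hS x))
    rw [kappa_eq] at h1
    convert h1 using 1
    simp [hd, smul_smul, dot_zero_right, hs]
  have e10 : e 10 ∈ T := by
    have h1 := T.smul_mem (-(√2)⁻¹) (m _ hx _ hx)
    rw [kappa_snd_snd] at h1
    convert h1 using 1
    simp [hd, smul_smul, hs]
  have h2 : Kv h x ∈ T := by
    rw [← kappa_fst_snd]
    exact m _ (hS h) _ hx
  have h3 : v = v 0 • e 0 + v 10 • e 10 + Kv h x := by
    rw [hh]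
    refine V_ext ?_ ?_ ?_ ?_ ?_
    · simp [e_apply]
    · simp [e_apply]
    · simp [e_apply]
    · ext <;> simp [e_apply]
    · ext <;> simp [e_apply]
  rw [h3]
  exact T.add_mem (T.add_mem (T.smul_mem _ e0) (T.smul_mem _ e10)) h2

theorem kappa_S1_onto (v : V) :
    v ∈ Submodule.span ℝ {u | ∃ s ∈ S1, ∃ t ∈ S1, u = kappa s t} := by
  refine mem_span_kappa (x := ![1, 0, 0, 0]) (by simp [mem_S1]) (by simp [mem_S1])
    (by simp [dot_apply]) (fun v => ?_) v
  refine ⟨![((v 1 : ℝ) : ℍ[ℝ]), star (quatA v), star (quatB v), 0], ?_⟩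
  refine V_ext ?_ ?_ ?_ ?_ ?_ <;> simp [Kv_apply, kap1, kapA, kapB, inner_quat]

theorem kappa_S2_onto (v : V) :
    v ∈ Submodule.span ℝ {u | ∃ s ∈ S2, ∃ t ∈ S2, u = kappa s t} := by
  refine mem_span_kappa (x := ![0, 1, 0, 0]) (by simp [mem_S2]) (by simp [mem_S2])
    (by simp [dot_apply]) (fun v => ?_) v
  refine ⟨![quatA v, ((-v 1 : ℝ) : ℍ[ℝ]), 0, star (quatB v)], ?_⟩
  refine V_ext ?_ ?_ ?_ ?_ ?_ <;> simp [Kv_apply, kap1, kapA, kapB, inner_quat]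

/-! ### Contraction of alternating forms -/

theorem alternatingMap_expand {k : ℕ} (g : V [⋀^Fin k]→ₗ[ℝ] ℝ) (w : Fin k → V) :
    ∑ a : Fin k → Fin 11, g (fun i => e (a i)) * ∏ i, w i (a i) = g w := by
  have h : w = fun i => ∑ b : Fin 11, w i b • e b := by
    funext i
    rw [sum_apply_smul_e]
  conv_rhs => rw [h]
  rw [← AlternatingMap.coe_multilinearMap, MultilinearMap.map_sum]
  refine Finset.sum_congr rfl fun a _ => ?_
  rw [MultilinearMap.map_smul_univ, smul_eq_mul, mul_comm]

/-- Contraction of a `k`-form with the decomposable `k`-vector `w₁ ∧ … ∧ w_k`. -/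
theorem sum_alternatingMap_mul_det {k : ℕ} (g : V [⋀^Fin k]→ₗ[ℝ] ℝ) (w : Fin k → V) :
    ∑ a : Fin k → Fin 11, g (fun i => e (a i)) *
      (Matrix.of fun i j => w j (a i)).det = k.factorial * g w := by
  have h : ∀ a : Fin k → Fin 11, g (fun i => e (a i)) * (Matrix.of fun i j => w j (a i)).det =
      ∑ σ : Equiv.Perm (Fin k), (Equiv.Perm.sign σ : ℝ) *
        (g (fun i => e (a i)) * ∏ i, w (σ i) (a i)) := fun a => by
    rw [← Matrix.det_transpose, Matrix.det_apply', Finset.mul_sum]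
    refine Finset.sum_congr rfl fun σ _ => ?_
    simp only [Matrix.transpose_apply, Matrix.of_apply]
    ring
  rw [Finset.sum_congr rfl fun a _ => h a, Finset.sum_comm]
  simp only [← Finset.mul_sum]
  have h2 : ∀ σ : Equiv.Perm (Fin k), (Equiv.Perm.sign σ : ℝ) *
      ∑ a : Fin k → Fin 11, g (fun i => e (a i)) * ∏ i, w (σ i) (a i) = g w := fun σ => by
    rw [alternatingMap_expand g fun i => w (σ i)]
    have := g.map_perm w σ
    rw [show (fun i => w (σ i)) = w ∘ σ from rfl, this, Units.smul_def, zsmul_eq_mul, ← mul_assoc]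
    norm_cast
    simp
  rw [Finset.sum_congr rfl fun σ _ => h2 σ, Finset.sum_const, Finset.card_univ, Fintype.card_perm,
    Fintype.card_fin, nsmul_eq_mul]

theorem sum_formOf_mul_formOf_ιMulti (φ : ⋀[ℝ]^4 V) (v : Fin 4 → V) :
    ∑ a : Fin 4 → Fin 11, formOf 4 φ (fun k => e (a k)) *
      formOf 4 (exteriorPower.ιMulti ℝ 4 v) (fun k => eDual (a k)) = 24 * formOf 4 φ v := by
  rw [show (24 : ℝ) = ((Nat.factorial 4 : ℕ) : ℝ) by norm_num [Nat.factorial],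
    ← sum_alternatingMap_mul_det]
  simp only [formOf_ιMulti, eta_e_right]

/-- The interior product of a `4`-form with a vector. -/
theorem sum_formOf_cons_mul_formOf_ιMulti (φ : ⋀[ℝ]^4 V) (v : Fin 4 → V) (x w : V) :
    ∑ a : Fin 3 → Fin 11, formOf 4 φ (Fin.cons x (fun k => e (a k)) : Fin 4 → V) *
      formOf 4 (exteriorPower.ιMulti ℝ 4 v) (Fin.cons w (fun k => eDual (a k)) : Fin 4 → V) =
    6 * ∑ j : Fin 4, (-1) ^ (j : ℕ) * eta (v j) w *
      formOf 4 φ (Fin.cons x (j.removeNth v) : Fin 4 → V) := by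
  have h : ∀ j : Fin 4, ∑ a : Fin 3 → Fin 11,
      formOf 4 φ (Fin.cons x (fun k => e (a k)) : Fin 4 → V) *
      (Matrix.of fun i l => j.removeNth v l (a i)).det =
      6 * formOf 4 φ (Fin.cons x (j.removeNth v) : Fin 4 → V) := fun j => by
    have := sum_alternatingMap_mul_det ((formOf 4 φ).curryLeft x) (j.removeNth v)
    simpa [Nat.factorial, AlternatingMap.curryLeft_apply_apply, Matrix.vecCons] using this
  have h2 : ∀ a : Fin 3 → Fin 11,
      formOf 4 (exteriorPower.ιMulti ℝ 4 v) (Fin.cons w (fun k => eDual (a k)) : Fin 4 → V) =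
      ∑ j : Fin 4, (-1) ^ (j : ℕ) * eta (v j) w *
        (Matrix.of fun i l => j.removeNth v l (a i)).det := fun a => by
    rw [formOf_ιMulti, Matrix.det_succ_row_zero]
    refine Finset.sum_congr rfl fun j _ => ?_
    congr 2
    funext i l
    simp [Fin.removeNth, eta_e_right]
  simp only [h2, Finset.mul_sum]
  rw [Finset.sum_comm]
  refine Finset.sum_congr rfl fun j _ => ?_
  rw [mul_left_comm, ← h j, Finset.mul_sum]
  exact Finset.sum_congr rfl fun a _ => by ring

/-! ### The four-form `φ` -/

theorem eta_phi0_vectors {i : Fin 11} (hi : i ≠ 10) : eta (e i) ePlus = 0 := by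
  rw [eta_apply]
  fin_cases i <;> simp [e_apply] at hi ⊢

/-- All factors of φ are orthogonal to e_+, so e_+ inserted into F gives zero. The coframe of the
pp-wave differs from the identity by such shifts, hence F has constant coefficients in coordinates.
-/
theorem formOf_phi0_shift {w w' : Fin 4 → V} (h : ∀ k, ∃ c : ℝ, w' k = w k + c • ePlus) :
    formOf 4 phi0 w' = formOf 4 phi0 w := by
  choose c hc using h
  have key : ∀ v : Fin 4 → V, (∀ j, eta (v j) ePlus = 0) →
      formOf 4 (exteriorPower.ιMulti ℝ 4 v) w' = formOf 4 (exteriorPower.ιMulti ℝ 4 v) w := by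
    intro v hv
    rw [formOf_ιMulti, formOf_ιMulti]
    congr 2
    funext i j
    rw [hc, map_add, map_smul, hv, smul_zero, add_zero]
  rw [phi0, formOf_add, AlternatingMap.add_apply, AlternatingMap.add_apply, key, key]
  · intro j
    fin_cases j <;> exact eta_phi0_vectors (by decide)
  · intro j
    fin_cases j <;> exact eta_phi0_vectors (by decide)

theorem formOf_phi0_eq_zero {w : Fin 4 → V} {k : Fin 4} (h : w k = ePlus) :
    formOf 4 phi0 w = 0 := by
  have h1 : formOf 4 phi0 w = formOf 4 phi0 (Function.update w k 0) := by
    refine formOf_phi0_shift fun j => ?_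
    by_cases hj : j = k
    · subst hj
      exact ⟨1, by simp [h]⟩
    · exact ⟨0, by simp [hj]⟩
  rw [h1]
  exact (formOf 4 phi0).map_coord_zero k (by simp)

theorem eta_e_transverse (v : V) {a : Fin 11} (h0 : a ≠ 0) (h10 : a ≠ 10) :
    eta v (e a) = -v a := by
  rw [← eta_e_right a v, eDual, if_neg h0, if_neg h10, map_neg, neg_neg]

theorem formOf_ιMulti_eq_zero_of_row {k : ℕ} (v w : Fin k → V) (i : Fin k)
    (h : ∀ j, eta (v j) (w i) = 0) : formOf k (exteriorPower.ιMulti ℝ k v) w = 0 := by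
  rw [formOf_ιMulti]
  exact Matrix.det_eq_zero_of_row_eq_zero i h

theorem formOf_ιMulti_ePlus_cons (x : V) {a b c : Fin 11} (ha : a ∈ Set.Icc (1 : Fin 11) 9)
    (hb : b ∈ Set.Icc (1 : Fin 11) 9) (hc : c ∈ Set.Icc (1 : Fin 11) 9) (hab : a < b) (hbc : b < c) :
    formOf 4 (exteriorPower.ιMulti ℝ 4 ![ePlus, e a, e b, e c])
      (Fin.cons x ![e a, e b, e c] : Fin 4 → V) = -x 10 := by
  have h : ∀ i ∈ Set.Icc (1 : Fin 11) 9, i ≠ 0 ∧ i ≠ 10 := by decide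
  have hx : eta ePlus x = x 10 := by simp [eta_apply, e_apply]
  have ht : ∀ (v : V) {i}, i ∈ Set.Icc (1 : Fin 11) 9 → eta v (e i) = -v i := fun v _ hi =>
    eta_e_transverse v (h _ hi).1 (h _ hi).2
  rw [formOf_ιMulti, Matrix.det_of_isUpperTriangular]
  · simp [Fin.prod_univ_succ, hx, ht _ ha, ht _ hb, ht _ hc, e_apply]
  · intro i j hij
    have n1 := (h a ha).1
    have n2 := (h b hb).1
    have n3 := (h c hc).1
    fin_cases i <;> fin_cases j <;> first
      | exact absurd hij (by decide)
      | simp [ht _ ha, ht _ hb, ht _ hc, e_apply, n1, n2, n3, hab.ne', hbc.ne', (hab.trans hbc).ne']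

theorem formOf_phi0_cons (x : V) :
    formOf 4 phi0 (Fin.cons x ![e 1, e 2, e 3] : Fin 4 → V) = -x 10 ∧
    formOf 4 phi0 (Fin.cons x ![e 1, e 4, e 5] : Fin 4 → V) = -x 10 := by
  rw [phi0, formOf_add, AlternatingMap.add_apply, AlternatingMap.add_apply]
  constructor
  · rw [formOf_ιMulti_ePlus_cons x (by decide) (by decide) (by decide) (by decide) (by decide),
      formOf_ιMulti_eq_zero_of_row _ _ 2, add_zero]
    intro j
    change eta _ (e 2) = 0
    rw [eta_e_transverse _ (by decide) (by decide)]
    fin_cases j <;> simp [e_apply]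
  · rw [formOf_ιMulti_ePlus_cons x (by decide) (by decide) (by decide) (by decide) (by decide),
      formOf_ιMulti_eq_zero_of_row _ _ 2, zero_add]
    intro j
    change eta _ (e 4) = 0
    rw [eta_e_transverse _ (by decide) (by decide)]
    fin_cases j <;> simp [e_apply]

/-- Contracting with φ evaluates the form on its own factors, among which is e_+. -/
theorem norm_phi0 : ∑ a : Fin 4 → Fin 11, formOf 4 phi0 (fun k => e (a k)) *
    formOf 4 phi0 (fun k => eDual (a k)) = 0 := by
  conv_lhs =>
    enter [2, a]
    rw [show formOf 4 phi0 (fun k => eDual (a k)) =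
      formOf 4 (exteriorPower.ιMulti ℝ 4 ![ePlus, e 1, e 2, e 3]) (fun k => eDual (a k)) +
      formOf 4 (exteriorPower.ιMulti ℝ 4 ![ePlus, e 1, e 4, e 5]) (fun k => eDual (a k)) by
        rw [phi0, formOf_add, AlternatingMap.add_apply], mul_add]
  rw [Finset.sum_add_distrib, sum_formOf_mul_formOf_ιMulti, sum_formOf_mul_formOf_ιMulti,
    formOf_phi0_eq_zero (k := 0) rfl, formOf_phi0_eq_zero (k := 0) rfl]
  simp

/-- In the expansion only the term that omits e_+ survives. Each summand of φ contributes -6 x_-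
w_-. -/
theorem inner_phi0 (x w : V) : ∑ a : Fin 3 → Fin 11,
    formOf 4 phi0 (Fin.cons x (fun k => e (a k)) : Fin 4 → V) *
      formOf 4 phi0 (Fin.cons w (fun k => eDual (a k)) : Fin 4 → V) = -12 * x 10 * w 10 := by
  have h : ∀ a b c : V, formOf 4 phi0 (Fin.cons x ![ePlus, b, c] : Fin 4 → V) = 0 := fun a b c =>
    formOf_phi0_eq_zero (k := 1) rfl
  have key : ∀ b c d : V, formOf 4 phi0 (Fin.cons x ![b, c, d] : Fin 4 → V) = -x 10 →
      6 * ∑ j : Fin 4, (-1) ^ (j : ℕ) * eta (![ePlus, b, c, d] j) w *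
        formOf 4 phi0 (Fin.cons x (j.removeNth ![ePlus, b, c, d]) : Fin 4 → V) =
      -6 * x 10 * w 10 := by
    intro b c d hb
    have h0 : (0 : Fin 4).removeNth ![ePlus, b, c, d] = ![b, c, d] := by
      funext i; fin_cases i <;> rfl
    have h1 : ∀ j : Fin 3, formOf 4 phi0
        (Fin.cons x (j.succ.removeNth ![ePlus, b, c, d]) : Fin 4 → V) = 0 := fun j =>
      formOf_phi0_eq_zero (k := 1) (by fin_cases j <;> rfl)
    rw [Fin.sum_univ_succ]
    simp only [h1, h0, hb]
    simp [eta_apply, e_apply]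
    ring
  conv_lhs =>
    enter [2, a]
    rw [show formOf 4 phi0 (Fin.cons w (fun k => eDual (a k)) : Fin 4 → V) =
      formOf 4 (exteriorPower.ιMulti ℝ 4 ![ePlus, e 1, e 2, e 3])
        (Fin.cons w (fun k => eDual (a k)) : Fin 4 → V) +
      formOf 4 (exteriorPower.ιMulti ℝ 4 ![ePlus, e 1, e 4, e 5])
        (Fin.cons w (fun k => eDual (a k)) : Fin 4 → V) by
        conv_lhs => rw [phi0, formOf_add, AlternatingMap.add_apply], mul_add]
  rw [Finset.sum_add_distrib, sum_formOf_cons_mul_formOf_ιMulti, sum_formOf_cons_mul_formOf_ιMulti,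
    key _ _ _ (formOf_phi0_cons x).1, key _ _ _ (formOf_phi0_cons x).2]
  ring

theorem hodge_ιMulti (v : Fin 4 → V) (w : Fin 7 → V) :
    hodge (exteriorPower.ιMulti ℝ 4 v) w = (Pi.basisFun ℝ (Fin 11)).det (Fin.append v w) := by
  have h : (⟨((exteriorPower.ιMulti ℝ 4 v : ⋀[ℝ]^4 V) : ExteriorAlgebra ℝ V) *
      (exteriorPower.ιMulti ℝ 7 w : ⋀[ℝ]^7 V), SetLike.mul_mem_graded
        (A := fun n : ℕ => ⋀[ℝ]^n V) (exteriorPower.ιMulti ℝ 4 v).2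
        (exteriorPower.ιMulti ℝ 7 w).2⟩ : ⋀[ℝ]^11 V) =
      exteriorPower.ιMulti ℝ 11 (Fin.append v w : Fin (4 + 7) → V) :=
    Subtype.ext (ExteriorAlgebra.ιMulti_mul_ιMulti v w)
  exact (congrArg (exteriorPower.alternatingMapLinearEquiv (n := 11)
    (Pi.basisFun ℝ (Fin 11)).det) h).trans
      (exteriorPower.alternatingMapLinearEquiv_apply_ιMulti _ _)

theorem hodge_add (φ ψ : ⋀[ℝ]^4 V) (w : Fin 7 → V) :
    hodge (φ + ψ) w = hodge φ w + hodge ψ w := by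
  simp only [hodge]
  rw [← map_add]
  exact congrArg _ (Subtype.ext (add_mul _ _ _))

/-- A unimodular map fixing the factors of φ preserves vol(φ ∧ ·). Applied to the shears, this makes
⋆F constant in coordinates. -/
theorem hodge_phi0_shift {f : V →ₗ[ℝ] V} (hf : LinearMap.det f = 1)
    (he : ∀ i : Fin 11, i ≠ 10 → f (e i) = e i) (w : Fin 7 → V) :
    hodge phi0 (fun i => f (w i)) = hodge phi0 w := by
  have key : ∀ v : Fin 4 → V, (∀ j, f (v j) = v j) →
      hodge (exteriorPower.ιMulti ℝ 4 v) (fun i => f (w i)) =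
        hodge (exteriorPower.ιMulti ℝ 4 v) w := by
    intro v hv
    rw [hodge_ιMulti, hodge_ιMulti]
    have : (Fin.append v (fun i => f (w i)) : Fin (4 + 7) → V) = f ∘ Fin.append v w := by
      funext i
      refine Fin.addCases (fun j => ?_) (fun j => ?_) i <;> simp [hv]
    rw [this]
    exact (Module.Basis.det_comp _ f _).trans (by rw [hf, one_mul])
  rw [phi0, hodge_add, hodge_add, key, key]
  · intro j
    fin_cases j <;> exact he _ (by decide)
  · intro j
    fin_cases j <;> exact he _ (by decide)

theorem phi0_mul_phi0 : (phi0 : ExteriorAlgebra ℝ V) * (phi0 : ExteriorAlgebra ℝ V) = 0 := by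
  have h : ∀ v w : Fin 4 → V, v 0 = w 0 →
      ExteriorAlgebra.ιMulti ℝ 4 v * ExteriorAlgebra.ιMulti ℝ 4 w = 0 := fun v w h => by
    rw [ExteriorAlgebra.ιMulti_mul_ιMulti]
    refine (ExteriorAlgebra.ιMulti ℝ (4 + 4)).map_eq_zero_of_eq _ (i := Fin.castAdd 4 0)
      (j := Fin.natAdd 4 0) ?_ (by decide)
    rw [Fin.append_left, Fin.append_right, h]
  rw [phi0, Submodule.coe_add, exteriorPower.ιMulti_apply_coe, exteriorPower.ιMulti_apply_coe,
    add_mul, mul_add, mul_add, h ![ePlus, e 1, e 2, e 3] ![ePlus, e 1, e 2, e 3] rfl,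
    h ![ePlus, e 1, e 4, e 5] ![ePlus, e 1, e 4, e 5] rfl,
    h ![ePlus, e 1, e 2, e 3] ![ePlus, e 1, e 4, e 5] rfl,
    h ![ePlus, e 1, e 4, e 5] ![ePlus, e 1, e 2, e 3] rfl]
  simp

theorem wedgeSq_phi0 (u : Fin 8 → V) : wedgeSq phi0 u = 0 := by
  rw [wedgeSq]
  have : (⟨(phi0 : ExteriorAlgebra ℝ V) * (phi0 : ExteriorAlgebra ℝ V),
    SetLike.mul_mem_graded (A := fun n : ℕ => ⋀[ℝ]^n V) phi0.2 phi0.2⟩ : ⋀[ℝ]^8 V) = 0 :=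
      Subtype.ext phi0_mul_phi0
  exact (congrArg (fun φ => formOf 8 φ u) this).trans (by rw [formOf_zero]; rfl)

/-! ### Calculus with bilinear maps -/

section

variable {E F G : Type*} [NormedAddCommGroup E] [NormedSpace ℝ E] [FiniteDimensional ℝ E]
  [NormedAddCommGroup F] [NormedSpace ℝ F] [FiniteDimensional ℝ F]
  [NormedAddCommGroup G] [NormedSpace ℝ G]

theorem hasFDerivAt_bilinear (b : E →ₗ[ℝ] F →ₗ[ℝ] G) {f : V → E} {g : V → F} {x : V}
    {f' : V →L[ℝ] E} {g' : V →L[ℝ] F} (hf : HasFDerivAt f f' x) (hg : HasFDerivAt g g' x) :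
    ∃ L : V →L[ℝ] G, HasFDerivAt (fun y => b (f y) (g y)) L x ∧
      ∀ u, L u = b (f' u) (g x) + b (f x) (g' u) := by
  refine ⟨_, (b.toContinuousBilinearMap).hasFDerivAt_of_bilinear hf hg, fun u => ?_⟩
  simp [add_comm]

theorem fderiv_bilinear (b : E →ₗ[ℝ] F →ₗ[ℝ] G) {f : V → E} {g : V → F} {x : V}
    (hf : DifferentiableAt ℝ f x) (hg : DifferentiableAt ℝ g x) (u : V) :
    fderiv ℝ (fun y => b (f y) (g y)) x u = b (fderiv ℝ f x u) (g x) + b (f x) (fderiv ℝ g x u) := by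
  obtain ⟨L, hL, hu⟩ := hasFDerivAt_bilinear b hf.hasFDerivAt hg.hasFDerivAt
  rw [hL.fderiv, hu]

theorem contDiff_bilinear (b : E →ₗ[ℝ] F →ₗ[ℝ] G) {f : V → E} {g : V → F}
    (hf : ContDiff ℝ ∞ f) (hg : ContDiff ℝ ∞ g) : ContDiff ℝ ∞ (fun y => b (f y) (g y)) :=
  b.toContinuousBilinearMap.isBoundedBilinearMap.contDiff.comp₂ hf hg

end

/-! ### The symmetric pp-waves -/

/-- The null shear `u ↦ u + a u_- e_+`. -/
def shear (a : ℝ) : V ≃L[ℝ] V :=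
  (LinearEquiv.transvection (f := (LinearMap.proj 10 : V →ₗ[ℝ] ℝ)) (v := a • ePlus)
    (by simp [e_apply])).toContinuousLinearEquiv

theorem shear_apply (a : ℝ) (u : V) : shear a u = u + (a * u 10) • ePlus := by
  rw [mul_comm, mul_smul]
  rfl

theorem shear_symm_apply (a : ℝ) (u : V) : (shear a).symm u = u - (a * u 10) • ePlus := by
  rw [ContinuousLinearEquiv.symm_apply_eq, shear_apply]
  simp [e_apply]

/-- The nilpotent endomorphism `u ↦ u_- e_+`. -/
def nullEnd : V →L[ℝ] V := (ContinuousLinearMap.proj 10 : V →L[ℝ] ℝ).smulRight ePlus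

theorem nullEnd_apply (u : V) : nullEnd u = u 10 • ePlus := rfl

theorem coe_shear (a : ℝ) : (shear a : V →L[ℝ] V) = ContinuousLinearMap.id ℝ V + a • nullEnd := by
  refine ContinuousLinearMap.ext fun u => ?_
  simp [shear_apply, nullEnd_apply, mul_smul]

theorem det_shear (a : ℝ) : LinearMap.det ((shear a : V →L[ℝ] V) : V →ₗ[ℝ] V) = 1 := by
  rw [show ((shear a : V →L[ℝ] V) : V →ₗ[ℝ] V) =
    LinearMap.transvection (LinearMap.proj 10 : V →ₗ[ℝ] ℝ) (a • ePlus) from rfl,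
    LinearMap.transvection.det]
  simp [e_apply]

section

variable (c₁ c₂ c₃ : ℝ)

/-- The quadratic form `H(x) = c₁ x₁² + c₂ |x_⊤|² + c₃ |x_⊥|²`, polarised. -/
def Hpol : V →ₗ[ℝ] V →ₗ[ℝ] ℝ :=
  LinearMap.mk₂ ℝ (fun x y => tdot (Cmap c₁ c₂ c₃ x) y)
    (by intro x x' y; simp [tdot_add_left]) (by intro c x y; simp [tdot_smul_left])
    (by intro x y y'; simp [tdot]; ring) (by intro c x y; simp [tdot]; ring)

theorem Hpol_apply (x y : V) : Hpol c₁ c₂ c₃ x y = tdot (Cmap c₁ c₂ c₃ x) y := rfl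

theorem Hpol_comm (x y : V) : Hpol c₁ c₂ c₃ x y = Hpol c₁ c₂ c₃ y x := by
  simp [Hpol_apply, tdot, Cmap_apply]
  ring

theorem hasFDerivAt_Hpol (x : V) : ∃ L : V →L[ℝ] ℝ,
    HasFDerivAt (fun y => Hpol c₁ c₂ c₃ y y / 2) L x ∧ ∀ u, L u = Hpol c₁ c₂ c₃ x u := by
  obtain ⟨L, hL, h⟩ := hasFDerivAt_bilinear (Hpol c₁ c₂ c₃) (hasFDerivAt_id x) (hasFDerivAt_id x)
  refine ⟨(1 / 2 : ℝ) • L, ?_, fun u => ?_⟩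
  · simpa [div_eq_mul_inv] using hL.mul_const (1 / 2 : ℝ)
  · rw [smul_apply, h]
    simp only [ContinuousLinearMap.id_apply, id_eq, Hpol_comm _ _ _ u x, smul_eq_mul]
    ring

/-- Endomorphisms of `V` as continuous linear maps. -/
def toC : Module.End ℝ V ≃ₗ[ℝ] V →L[ℝ] V := LinearMap.toContinuousLinearMap

/-- The Levi-Civita connection form of the symmetric pp-wave. -/
def connPP : V →ₗ[ℝ] V →ₗ[ℝ] V →L[ℝ] V :=
  LinearMap.mk₂ ℝ (fun x u => u 10 • toC (nfv (Cmap c₁ c₂ c₃ x)))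
    (by intro x x' u; simp) (by intro c x u; simp [smul_comm c])
    (by intro x u u'; simp [add_smul]) (by intro c x u; simp [mul_smul])

theorem connPP_apply (x u : V) : ((connPP c₁ c₂ c₃ x u : V →L[ℝ] V) : Module.End ℝ V) =
    u 10 • nfv (Cmap c₁ c₂ c₃ x) := rfl

theorem connPP_apply_apply (x u v : V) : connPP c₁ c₂ c₃ x u v =
    u 10 • (Hpol c₁ c₂ c₃ x v • ePlus + v 10 • Cmap c₁ c₂ c₃ x) := by
  rw [Hpol_apply, ← nf_zero_apply _ _ (by simp [Cmap_apply]) (by simp [Cmap_apply])]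
  rfl

theorem Cmap_ePlus : Cmap c₁ c₂ c₃ ePlus = 0 := by
  refine V_ext ?_ ?_ ?_ ?_ ?_ <;> simp [Cmap_apply, e_apply] <;> right <;> ext <;>
    simp [e_apply]

theorem connPP_mem_N1 (x u : V) :
    ((connPP c₁ c₂ c₃ x u : V →L[ℝ] V) : Module.End ℝ V) ∈ N1 := by
  rw [connPP_apply]
  exact N1.smul_mem _ ⟨0, 0, 0, _, rfl, rfl, by simp [Cmap_apply], by simp [Cmap_apply], rfl⟩

theorem connPP_mem_N2 (x u : V) :
    ((connPP 0 c₂ 0 x u : V →L[ℝ] V) : Module.End ℝ V) ∈ N2 := by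
  rw [connPP_apply]
  refine N2.smul_mem _ ⟨0, c₂ • quatA x, ?_⟩
  rw [nfv_apply]
  congr 1
  refine V_ext ?_ ?_ ?_ ?_ ?_ <;> simp [Cmap_apply]

/-- The pp-wave metric `2 dx⁺dx⁻ + H (dx⁻)² - ∑ (dxⁱ)²` with its Levi-Civita connection. -/
def ppSpacetime : FramedSpacetime where
  θ x := shear (Hpol c₁ c₂ c₃ x x / 2)
  conn x := (connPP c₁ c₂ c₃).toContinuousBilinearMap x
  θ_smooth := by
    simp only [coe_shear]
    have h : ContDiff ℝ ∞ fun x => Hpol c₁ c₂ c₃ x x :=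
      contDiff_bilinear (Hpol c₁ c₂ c₃) contDiff_id contDiff_id
    exact contDiff_const.add ((h.div_const 2).smul contDiff_const)
  conn_smooth := ContinuousLinearMap.contDiff _
  conn_skew x u := mem_N1_so (connPP_mem_N1 c₁ c₂ c₃ x u)
  torsion_free x u w := by
    -- dθ has values along e_+ and cancels the e_+-part of the connection; the remaining terms u_-
    -- w_- Cx are symmetric in u and w.
    have h : ∀ u w : V, fderiv ℝ (fun y => (shear (Hpol c₁ c₂ c₃ y y / 2) : V →L[ℝ] V)) x u w =
        Hpol c₁ c₂ c₃ x u • w 10 • ePlus := fun u w => by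
      obtain ⟨L, hL, hu⟩ := hasFDerivAt_Hpol c₁ c₂ c₃ x
      simp only [coe_shear]
      rw [((hL.smul_const nullEnd).const_add _).fderiv]
      simp [hu, nullEnd_apply]
    rw [h, h, LinearMap.toContinuousBilinearMap_apply, LinearMap.toContinuousBilinearMap_apply,
      connPP_apply_apply, connPP_apply_apply]
    have h0 : ∀ x, Hpol c₁ c₂ c₃ x ePlus = 0 := fun x => by
      rw [Hpol_comm, Hpol_apply, Cmap_ePlus]; simp [tdot]
    have h10 : ePlus 10 = 0 := by simp [e_apply]
    simp only [shear_apply, map_add, map_smul, h0, Pi.add_apply, Pi.smul_apply, h10, smul_zero,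
      add_zero]
    module

/-- The connection form is linear in x, and its quadratic term is u_- w_- times a fixed square, so
it drops out of the antisymmetrisation. Passing to the frame alters vectors only along e_+, on which
C and the e_- coordinate vanish. -/
theorem ppSpacetime_curvature (x v w : V) :
    (ppSpacetime c₁ c₂ c₃).curvature x v w = Rpp c₁ c₂ c₃ v w := by
  have hs : ∀ a, ∀ u : V, ((shear a).symm u) 10 = u 10 := fun a u => by
    simp [shear_symm_apply, e_apply]
  have hC : ∀ a, ∀ u : V, Cmap c₁ c₂ c₃ ((shear a).symm u) = Cmap c₁ c₂ c₃ u := fun a u => by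
    simp [shear_symm_apply, Cmap_ePlus]
  refine LinearMap.ext fun y => ?_
  have hf : fderiv ℝ (ppSpacetime c₁ c₂ c₃).conn x =
      (connPP c₁ c₂ c₃).toContinuousBilinearMap := ContinuousLinearMap.fderiv _
  have ha : ∀ x u v : V, (connPP c₁ c₂ c₃) x u v = u 10 • nfv (Cmap c₁ c₂ c₃ x) v :=
    fun x u v => rfl
  simp only [FramedSpacetime.curvature, FramedSpacetime.curvatureForm, hf]
  simp only [ppSpacetime, LinearMap.toContinuousBilinearMap_apply, LinearMap.neg_apply,
    ContinuousLinearMap.coe_coe, sub_apply, add_apply,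
    ContinuousLinearMap.comp_apply, ha, hs, hC, map_smul]
  rw [Rpp_apply, ← nfv_apply, map_sub, map_smul, map_smul]
  simp only [LinearMap.sub_apply, LinearMap.smul_apply]
  module

theorem ppSpacetime_isPPWave : (ppSpacetime c₁ c₂ c₃).IsPPWave := by
  refine ⟨fun x => Hpol c₁ c₂ c₃ x x, fun x t => ?_, fun x u w => ?_⟩
  · simp [Hpol_apply, Cmap_ePlus, tdot, e_apply]
  · simp only [FramedSpacetime.metric, ppSpacetime, shear_apply, eta, LinearMap.mk₂_apply]
    have h : ∀ i ∈ Finset.Icc (1 : Fin 11) 9, ∀ (t : ℝ) (u : V), (u + t • ePlus) i = u i := by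
      intro i hi t u
      have : i ≠ 0 := by rintro rfl; simp at hi
      simp [e_apply, this]
    rw [Finset.sum_congr rfl fun i hi => by rw [h i hi, h i hi]]
    simp [e_apply]
    ring

/-- The curvature is constant in the frame and the connection takes values in `N1`, which leaves it
invariant. -/
theorem ppSpacetime_isLocallySymmetric : (ppSpacetime c₁ c₂ c₃).IsLocallySymmetric := by
  intro x u v w y
  simp only [ppSpacetime_curvature, fderiv_const_apply, zero_apply, zero_add]
  have h := LinearMap.congr_fun (lie_Rpp (c₁ := c₁) (c₂ := c₂) (c₃ := c₃)
    (connPP_mem_N1 c₁ c₂ c₃ x u) v w) y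
  simp only [lie_apply, LinearMap.add_apply, ContinuousLinearMap.coe_coe] at h
  simp only [ppSpacetime, LinearMap.toContinuousBilinearMap_apply]
  linear_combination (norm := module) h

/-- Ricci is -v_- w_- times the trace of C, the blocks having dimensions 1, 4, 4. Einstein's
equation asks for the coefficient (1/2)(1/6)(-12) = -1. -/
theorem ppSpacetime_ricci (hc : c₁ + 4 * c₂ + 4 * c₃ = 1) (x v w : V) :
    (ppSpacetime c₁ c₂ c₃).ricci x v w = -(v 10 * w 10) := by
  have h : ∀ a : Fin 11, Rpp c₁ c₂ c₃ (e a) v w a = -(v 10 * w 10) * Cmap c₁ c₂ c₃ (e a) a := by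
    intro a
    rw [Rpp_apply, nf_zero_apply _ _ (by simp [Cmap_apply]) (by simp [Cmap_apply])]
    fin_cases a <;> simp [e_apply, Cmap_apply, tdot] <;> ring
  simp only [FramedSpacetime.ricci, ppSpacetime_curvature, eta_e_right, h, ← Finset.mul_sum]
  have : ∑ a, Cmap c₁ c₂ c₃ (e a) a = c₁ + 4 * c₂ + 4 * c₃ := by
    have h1 : ∀ a, Cmap c₁ c₂ c₃ (e a) a = ![0, c₁, c₂, c₂, c₂, c₂, c₃, c₃, c₃, c₃, 0] a := by
      intro a
      fin_cases a <;> simp [e_apply, Cmap_apply]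
    simp [h1, Fin.sum_univ_succ]
    ring
  rw [this, hc, mul_one]

/-- The symmetric pp-wave as a background of `D = 11` supergravity. -/
def ppBackground (hc : c₁ + 4 * c₂ + 4 * c₃ = 1) : SugraBackground where
  toFramedSpacetime := ppSpacetime c₁ c₂ c₃
  φ _ := phi0
  φ_smooth _ := contDiff_const
  closed x u := by
    have h : ∀ (y : V) (w : Fin 4 → V),
        formOf 4 phi0 (fun i => (ppSpacetime c₁ c₂ c₃).θ y (w i)) = formOf 4 phi0 w := fun y w =>
      formOf_phi0_shift fun k => ⟨_, shear_apply _ _⟩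
    simp [extD, h]
  maxwell x u := by
    have h : ∀ (y : V) (w : Fin 7 → V),
        hodge phi0 (fun i => (ppSpacetime c₁ c₂ c₃).θ y (w i)) = hodge phi0 w := fun y w =>
      hodge_phi0_shift (f := ((shear (Hpol c₁ c₂ c₃ y y / 2) : V →L[ℝ] V) : V →ₗ[ℝ] V))
        (det_shear _) (fun i hi => by simp [shear_apply, e_apply, hi.symm]) w
    simp [extD, h, wedgeSq_phi0]
  einstein x v w := by
    rw [ppSpacetime_ricci _ _ _ hc, inner_phi0, norm_phi0]
    ring

end

/-! ### Flat sections -/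

/-- A flat section vanishing at the origin vanishes. -/
theorem eq_zero_of_flat {W E : Type*} [NormedAddCommGroup W] [NormedSpace ℝ W]
    [FiniteDimensional ℝ W] [NormedAddCommGroup E] [NormedSpace ℝ E] [FiniteDimensional ℝ E]
    (b : W →ₗ[ℝ] E →ₗ[ℝ] E) {τ : V → V → W} (hτ : ∀ u, Continuous fun x => τ x u) {ψ : V → E}
    (hψ : Differentiable ℝ ψ) (hd : ∀ x u, fderiv ℝ ψ x u = b (τ x u) (ψ x)) (h0 : ψ 0 = 0) :
    ψ = 0 := by
  funext x
  have hc : Continuous fun t : ℝ => τ (t • x) x := (hτ x).comp (continuous_id.smul continuous_const)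
  obtain ⟨M, hM⟩ := (isCompact_Icc (a := (0 : ℝ)) (b := 1)).exists_bound_of_continuousOn
    hc.continuousOn
  have hderiv : ∀ t : ℝ, HasDerivAt (fun t : ℝ => ψ (t • x)) (b (τ (t • x) x) (ψ (t • x))) t := by
    intro t
    rw [← hd]
    have h2 : HasDerivAt (fun t : ℝ => t • x) x t := by
      simpa using (hasDerivAt_id t).smul_const x
    exact (hψ (t • x)).hasFDerivAt.comp_hasDerivAt t h2
  -- Along the ray to x the section solves a linear ordinary differential equation whose
  -- coefficients are bounded by compactness, so Grönwall's inequality applies.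
  have := eq_zero_of_abs_deriv_le_mul_abs_self_of_eq_zero_right
    (f := fun t : ℝ => ψ (t • x)) (f' := fun t => b (τ (t • x) x) (ψ (t • x)))
    (K := ‖b.toContinuousBilinearMap‖ * M) (a := 0) (b := 1)
    (fun t _ => (hderiv t).continuousAt.continuousWithinAt)
    (fun t _ => (hderiv t).hasDerivWithinAt) (by simpa using h0) (fun t ht => ?_) 1 (by simp)
  · simpa using this
  · refine (b.toContinuousBilinearMap.le_opNorm₂ (τ (t • x) x) (ψ (t • x))).trans ?_
    gcongr
    exact hM t ⟨ht.1, ht.2.le⟩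

/-- The ambient space `End(V) ⊕ V` of the even part. -/
abbrev E0 := (V →L[ℝ] V) × V

/-- The bracket of even elements. -/
def bEE (R : V →ₗ[ℝ] V →ₗ[ℝ] Module.End ℝ V) : E0 →ₗ[ℝ] E0 →ₗ[ℝ] E0 :=
  LinearMap.mk₂ ℝ
    (fun a b => (a.1.comp b.1 - b.1.comp a.1 + toC (R a.2 b.2), a.1 b.2 - b.1 a.2))
    (by
      intro a a' b
      ext1
      · simp only [Prod.fst_add, Prod.snd_add, ContinuousLinearMap.add_comp,
          ContinuousLinearMap.comp_add, map_add, LinearMap.add_apply]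
        abel
      · simp only [Prod.fst_add, Prod.snd_add, map_add, add_apply]
        abel)
    (by
      intro c a b
      ext1
      · simp only [Prod.smul_fst, Prod.smul_snd, ContinuousLinearMap.smul_comp,
          ContinuousLinearMap.comp_smul, map_smul, LinearMap.smul_apply]
        module
      · simp only [Prod.smul_fst, Prod.smul_snd, map_smul, smul_apply]
        module)
    (by
      intro a b b'
      ext1
      · simp only [Prod.fst_add, Prod.snd_add, ContinuousLinearMap.add_comp,
          ContinuousLinearMap.comp_add, map_add]
        abel
      · simp only [Prod.fst_add, Prod.snd_add, map_add, add_apply]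
        abel)
    (by
      intro c a b
      ext1
      · simp only [Prod.smul_fst, Prod.smul_snd, ContinuousLinearMap.smul_comp,
          ContinuousLinearMap.comp_smul, map_smul]
        module
      · simp only [Prod.smul_fst, Prod.smul_snd, map_smul, smul_apply]
        module)

/-- The bracket of even and odd elements. -/
def bES (φ : ⋀[ℝ]^4 V) : E0 →ₗ[ℝ] S →ₗ[ℝ] S :=
  LinearMap.mk₂ ℝ (fun a s => spinRep (a.1 : V →ₗ[ℝ] V) s + beta φ a.2 s)
    (by
      intro a a' s
      simp only [Prod.fst_add, Prod.snd_add, ContinuousLinearMap.toLinearMap_add, map_add,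
        LinearMap.add_apply]
      abel)
    (by
      intro c a s
      simp only [Prod.smul_fst, Prod.smul_snd, ContinuousLinearMap.toLinearMap_smul, map_smul,
        LinearMap.smul_apply]
      module)
    (by intro a s t; simp only [map_add]; abel)
    (by intro c a s; simp only [map_smul]; module)

/-- The bracket of odd elements. -/
def bSS (φ : ⋀[ℝ]^4 V) : S →ₗ[ℝ] S →ₗ[ℝ] E0 :=
  LinearMap.mk₂ ℝ (fun s t => (toC (gamma φ s t), kappa s t))
    (by intro s s' t; ext1 <;> simp) (by intro s s' t; ext1 <;> simp)
    (by intro s s' t; ext1 <;> simp) (by intro s s' t; ext1 <;> simp)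

namespace IsSymmetricSymbol

variable {φ : ⋀[ℝ]^4 V} {h : Submodule ℝ (Module.End ℝ V)} {S' : Submodule ℝ S}
  {R : V →ₗ[ℝ] V →ₗ[ℝ] Module.End ℝ V} (D : IsSymmetricSymbol φ h S' R)

include D

/-- On elements with first entry in 𝔥 the ambient brackets are those of `deformation`, so its Jacobi
identities carry over. Working in the fixed space `E0` allows differentiation. -/
theorem bEE_jacobi {a b c : E0} (ha : (a.1 : V →ₗ[ℝ] V) ∈ h) (hb : (b.1 : V →ₗ[ℝ] V) ∈ h)
    (hc : (c.1 : V →ₗ[ℝ] V) ∈ h) :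
    bEE R a (bEE R b c) = bEE R (bEE R a b) c + bEE R b (bEE R a c) := by
  have := D.deformation.jac000 (⟨_, ha⟩, a.2) (⟨_, hb⟩, b.2) (⟨_, hc⟩, c.2)
  have h1 := congrArg (fun t : h × V => ((toC (t.1 : Module.End ℝ V), t.2) : E0)) this
  exact h1

theorem bES_jacobi {a b : E0} {s : S} (ha : (a.1 : V →ₗ[ℝ] V) ∈ h) (hb : (b.1 : V →ₗ[ℝ] V) ∈ h)
    (hs : s ∈ S') : bES φ a (bES φ b s) = bES φ (bEE R a b) s + bES φ b (bES φ a s) := by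
  have h1 : ∀ (a : h × V) (s : S'),
      (D.deformation.b01 a s : S) = bES φ (toC (a.1 : Module.End ℝ V), a.2) s := fun a s => rfl
  have h2 : ((toC ((D.deformation.b00 (⟨_, ha⟩, a.2) (⟨_, hb⟩, b.2)).1 : Module.End ℝ V),
      (D.deformation.b00 (⟨_, ha⟩, a.2) (⟨_, hb⟩, b.2)).2) : E0) = bEE R a b := rfl
  have h3 := congrArg Subtype.val (D.deformation.jac001 (⟨_, ha⟩, a.2) (⟨_, hb⟩, b.2) ⟨s, hs⟩)
  simp only [Submodule.coe_add, h1, h2] at h3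
  exact h3

theorem bSS_jacobi {a : E0} {s t : S} (ha : (a.1 : V →ₗ[ℝ] V) ∈ h) (hs : s ∈ S') (ht : t ∈ S') :
    bEE R a (bSS φ s t) = bSS φ (bES φ a s) t + bSS φ s (bES φ a t) := by
  have := D.deformation.jac011 (⟨_, ha⟩, a.2) ⟨s, hs⟩ ⟨t, ht⟩
  have h1 := congrArg (fun t : h × V => ((toC (t.1 : Module.End ℝ V), t.2) : E0)) this
  exact h1

theorem bEE_mem {a b : E0} (ha : (a.1 : V →ₗ[ℝ] V) ∈ h) (hb : (b.1 : V →ₗ[ℝ] V) ∈ h) :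
    ((bEE R a b).1 : V →ₗ[ℝ] V) ∈ h :=
  h.add_mem (D.h_lie _ ha _ hb) (D.R_mem _ _)

end IsSymmetricSymbol

/-! ### The transvection superalgebra -/

/-- The connection one-form `u ↦ (-conn(u), θ(u))` of the Killing superconnection. -/
def omega (B : FramedSpacetime) (x u : V) : E0 := (-B.conn x u, B.θ x u)

theorem continuous_omega (B : FramedSpacetime) (u : V) : Continuous fun x => omega B x u :=
  ((B.conn_smooth.continuous.clm_apply continuous_const).neg).prodMk
    (B.θ_smooth.continuous.clm_apply continuous_const)

theorem bES_omega (φ : ⋀[ℝ]^4 V) (B : FramedSpacetime) (x u : V) (s : S) :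
    bES φ (omega B x u) s = beta φ (B.θ x u) s - spinRep (B.conn x u : V →ₗ[ℝ] V) s := by
  have h : spinRep ((-B.conn x u : V →L[ℝ] V) : V →ₗ[ℝ] V) s =
      -spinRep (B.conn x u : V →ₗ[ℝ] V) s := by
    rw [ContinuousLinearMap.toLinearMap_neg, map_neg, LinearMap.neg_apply]
  rw [sub_eq_neg_add, ← h]
  rfl

theorem mem_killingSpinors {B : SugraBackground} {φ : ⋀[ℝ]^4 V} (hφ : ∀ x, B.φ x = φ)
    {ε : V → S} : ε ∈ B.killingSpinors ↔ ContDiff ℝ ∞ ε ∧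
      ∀ x u, fderiv ℝ ε x u = bES φ (omega B.toFramedSpacetime x u) (ε x) := by
  refine and_congr_right fun _ => forall₂_congr fun x u => ?_
  rw [bES_omega, hφ, FramedSpacetime.nablaSpinor, sub_eq_zero, eq_sub_iff_add_eq]

/-- The parallel sections of the even part of the Killing superconnection. -/
def flatEven (B : FramedSpacetime) (h : Submodule ℝ (Module.End ℝ V))
    (R : V →ₗ[ℝ] V →ₗ[ℝ] Module.End ℝ V) : Submodule ℝ (V → E0) where
  carrier := {ψ | ContDiff ℝ ∞ ψ ∧ (∀ x, ((ψ x).1 : V →ₗ[ℝ] V) ∈ h) ∧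
    ∀ x u, fderiv ℝ ψ x u = bEE R (omega B x u) (ψ x)}
  zero_mem' := ⟨contDiff_const, fun _ => h.zero_mem, fun x u => by simp [Pi.zero_def]⟩
  add_mem' := by
    rintro ψ ψ' ⟨h1, h2, h3⟩ ⟨h1', h2', h3'⟩
    refine ⟨h1.add h1', fun x => h.add_mem (h2 x) (h2' x), fun x u => ?_⟩
    rw [fderiv_add (h1.differentiable (by simp)).differentiableAt
      (h1'.differentiable (by simp)).differentiableAt, Pi.add_apply, map_add, add_apply, h3, h3']
  smul_mem' := by
    rintro c ψ ⟨h1, h2, h3⟩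
    refine ⟨h1.const_smul c, fun x => h.smul_mem c (h2 x), fun x u => ?_⟩
    rw [fderiv_const_smul (h1.differentiable (by simp)).differentiableAt, Pi.smul_apply, map_smul,
      smul_apply, h3]

/-! ### Vector fields of parallel sections -/

theorem contDiff_θ_symm (B : FramedSpacetime) :
    ContDiff ℝ ∞ fun x => ((B.θ x).symm : V →L[ℝ] V) := by
  rw [contDiff_iff_contDiffAt]
  intro x
  have h := (contDiffAt_map_inverse (𝕜 := ℝ) (n := ∞) (B.θ x)).comp x
    (f := fun x => (B.θ x : V →L[ℝ] V)) B.θ_smooth.contDiffAt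
  simpa [Function.comp_def] using h

/-- The vector field defined by a section of the even part. -/
def fieldOf (B : FramedSpacetime) : (V → E0) →ₗ[ℝ] V → V where
  toFun ψ x := (B.θ x).symm (ψ x).2
  map_add' ψ ψ' := by funext x; simp
  map_smul' c ψ := by funext x; simp

theorem θ_fieldOf (B : FramedSpacetime) (ψ : V → E0) (x : V) :
    B.θ x (fieldOf B ψ x) = (ψ x).2 :=
  (B.θ x).apply_symm_apply _

theorem contDiff_fieldOf (B : FramedSpacetime) {ψ : V → E0} (hψ : ContDiff ℝ ∞ ψ) :
    ContDiff ℝ ∞ (fieldOf B ψ) :=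
  (contDiff_θ_symm B).clm_apply hψ.snd

section

variable {B : FramedSpacetime} {h : Submodule ℝ (Module.End ℝ V)}
  {R : V →ₗ[ℝ] V →ₗ[ℝ] Module.End ℝ V} {ψ ψ' : V → E0}

theorem fderiv_snd_flatEven (hψ : ψ ∈ flatEven B h R) (x u : V) :
    fderiv ℝ (fun y => (ψ y).2) x u = -B.conn x u (ψ x).2 - (ψ x).1 (B.θ x u) := by
  have hd : DifferentiableAt ℝ ψ x := (hψ.1.differentiable (by simp)).differentiableAt
  rw [fderiv.snd hd]
  exact congrArg Prod.snd (hψ.2.2 x u)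

theorem θ_fderiv_fieldOf (hψ : ψ ∈ flatEven B h R) (x u : V) :
    B.θ x (fderiv ℝ (fieldOf B ψ) x u) = -B.conn x u (ψ x).2 - (ψ x).1 (B.θ x u)
      - fderiv ℝ (fun y => (B.θ y : V →L[ℝ] V)) x u (fieldOf B ψ x) := by
  have h1 : DifferentiableAt ℝ (fun y => (B.θ y : V →L[ℝ] V)) x :=
    (B.θ_smooth.differentiable (by simp)).differentiableAt
  have h2 : DifferentiableAt ℝ (fieldOf B ψ) x :=
    ((contDiff_fieldOf B hψ.1).differentiable (by simp)).differentiableAt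
  have h3 := fderiv_snd_flatEven hψ x u
  have h4 : (fun y => (ψ y).2) = fun y => (B.θ y : V →L[ℝ] V) (fieldOf B ψ y) := by
    funext y
    exact (θ_fieldOf B ψ y).symm
  rw [h4, fderiv_clm_apply h1 h2] at h3
  rw [eq_sub_iff_add_eq, ← h3]
  rfl

theorem nablaField_fieldOf (hψ : ψ ∈ flatEven B h R) (x : V) :
    B.nablaField (fieldOf B ψ) x = -((ψ x).1 : V →ₗ[ℝ] V) := by
  refine LinearMap.ext fun v => ?_
  simp only [FramedSpacetime.nablaField, θ_fieldOf, ContinuousLinearMap.coe_coe,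
    ContinuousLinearMap.comp_apply, add_apply, ContinuousLinearEquiv.coe_coe,
    ContinuousLinearMap.flip_apply, LinearMap.neg_apply]
  rw [fderiv_snd_flatEven hψ, ContinuousLinearEquiv.apply_symm_apply]
  abel

/-- Without torsion the Lie bracket is the antisymmetrised covariant derivative, and the
endomorphism part of a parallel section is minus the derivative of its vector field. -/
theorem θ_lieBracket (hψ : ψ ∈ flatEven B h R) (hψ' : ψ' ∈ flatEven B h R) (x : V) :
    B.θ x (VectorField.lieBracket ℝ (fieldOf B ψ) (fieldOf B ψ') x) =
      (ψ x).1 (ψ' x).2 - (ψ' x).1 (ψ x).2 := by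
  have ht := B.torsion_free x (fieldOf B ψ x) (fieldOf B ψ' x)
  rw [VectorField.lieBracket, map_sub, θ_fderiv_fieldOf hψ, θ_fderiv_fieldOf hψ']
  simp only [θ_fieldOf] at ht ⊢
  linear_combination (norm := module) -ht

theorem lieBracket_fieldOf (hψ : ψ ∈ flatEven B h R) (hψ' : ψ' ∈ flatEven B h R) :
    VectorField.lieBracket ℝ (fieldOf B ψ) (fieldOf B ψ') =
      fieldOf B (fun x => bEE R (ψ x) (ψ' x)) := by
  funext x
  refine (B.θ x).injective ?_
  rw [θ_lieBracket hψ hψ', θ_fieldOf]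
  rfl

/-- The endomorphism part is -∇K, hence determined by the field K. -/
theorem fieldOf_injective (hψ : ψ ∈ flatEven B h R) (h0 : fieldOf B ψ = 0) : ψ = 0 := by
  have h1 : ∀ x, (ψ x).2 = 0 := fun x => by
    rw [← θ_fieldOf B, h0, Pi.zero_apply, map_zero]
  funext x
  refine Prod.ext (ContinuousLinearMap.ext fun v => ?_) (h1 x)
  have h2 := fderiv_snd_flatEven hψ x ((B.θ x).symm v)
  simp only [h1, map_zero, neg_zero, ContinuousLinearEquiv.apply_symm_apply, zero_sub,
    fderiv_const_apply, zero_apply] at h2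
  exact neg_eq_zero.1 h2.symm

end

section

variable {B : FramedSpacetime} {φ : ⋀[ℝ]^4 V} {h : Submodule ℝ (Module.End ℝ V)}
  {S' : Submodule ℝ S} {R : V →ₗ[ℝ] V →ₗ[ℝ] Module.End ℝ V}
  (D : IsSymmetricSymbol φ h S' R) (hB : ∀ x u, (B.conn x u : V →ₗ[ℝ] V) ∈ h)

theorem omega_mem (hB : ∀ x u, (B.conn x u : V →ₗ[ℝ] V) ∈ h) (x u : V) :
    ((omega B x u).1 : V →ₗ[ℝ] V) ∈ h :=
  h.neg_mem (hB x u)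

include D hB

/-- ω acts through the bracket, so the Jacobi identity says that it acts as a derivation of
brackets; brackets of parallel sections are therefore parallel. -/
theorem bEE_mem_flatEven {ψ ψ' : V → E0} (hψ : ψ ∈ flatEven B h R) (hψ' : ψ' ∈ flatEven B h R) :
    (fun x => bEE R (ψ x) (ψ' x)) ∈ flatEven B h R := by
  refine ⟨contDiff_bilinear _ hψ.1 hψ'.1, fun x => D.bEE_mem (hψ.2.1 x) (hψ'.2.1 x),
    fun x u => ?_⟩
  rw [fderiv_bilinear _ (hψ.1.differentiable (by simp)).differentiableAt
    (hψ'.1.differentiable (by simp)).differentiableAt, hψ.2.2, hψ'.2.2,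
    D.bEE_jacobi (omega_mem hB x u) (hψ.2.1 x) (hψ'.2.1 x)]

theorem bSS_mem_flatEven {ε ε' : V → S} (hε : ContDiff ℝ ∞ ε) (hε' : ContDiff ℝ ∞ ε')
    (hd : ∀ x u, fderiv ℝ ε x u = bES φ (omega B x u) (ε x))
    (hd' : ∀ x u, fderiv ℝ ε' x u = bES φ (omega B x u) (ε' x))
    (hS : ∀ x, ε x ∈ S') (hS' : ∀ x, ε' x ∈ S') :
    (fun x => bSS φ (ε x) (ε' x)) ∈ flatEven B h R := by
  refine ⟨contDiff_bilinear _ hε hε', fun x => D.gamma_mem _ (hS x) _ (hS' x), fun x u => ?_⟩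
  rw [fderiv_bilinear _ (hε.differentiable (by simp)).differentiableAt
    (hε'.differentiable (by simp)).differentiableAt, hd, hd',
    D.bSS_jacobi (omega_mem hB x u) (hS x) (hS' x)]

theorem fderiv_bES {ψ : V → E0} {ε : V → S} (hψ : ψ ∈ flatEven B h R) (hε : ContDiff ℝ ∞ ε)
    (hd : ∀ x u, fderiv ℝ ε x u = bES φ (omega B x u) (ε x)) (hS : ∀ x, ε x ∈ S') (x u : V) :
    fderiv ℝ (fun x => bES φ (ψ x) (ε x)) x u = bES φ (omega B x u) (bES φ (ψ x) (ε x)) := by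
  rw [fderiv_bilinear _ (hψ.1.differentiable (by simp)).differentiableAt
    (hε.differentiable (by simp)).differentiableAt, hψ.2.2, hd,
    D.bES_jacobi (omega_mem hB x u) (hψ.2.1 x) (hS x)]

end

theorem lieSpinor_fieldOf {B : SugraBackground} {φ : ⋀[ℝ]^4 V} (hφ : ∀ x, B.φ x = φ)
    {h : Submodule ℝ (Module.End ℝ V)} {R : V →ₗ[ℝ] V →ₗ[ℝ] Module.End ℝ V} {ψ : V → E0}
    (hψ : ψ ∈ flatEven B.toFramedSpacetime h R) {ε : V → S} (hε : ε ∈ B.killingSpinors) :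
    B.lieSpinor (fieldOf B.toFramedSpacetime ψ) ε = fun x => bES φ (ψ x) (ε x) := by
  funext x
  have h1 := ((mem_killingSpinors hφ).1 hε).2 x (fieldOf B.toFramedSpacetime ψ x)
  rw [bES_omega, θ_fieldOf] at h1
  rw [FramedSpacetime.lieSpinor, FramedSpacetime.nablaSpinor, h1, nablaField_fieldOf hψ, map_neg,
    LinearMap.neg_apply]
  change _ = spinRep ((ψ x).1 : V →ₗ[ℝ] V) (ε x) + beta φ (ψ x).2 (ε x)
  abel

/-! ### Invariance of the metric and of the four-form -/

theorem continuous_alternatingMap {k : ℕ} (g : V [⋀^Fin k]→ₗ[ℝ] ℝ) : Continuous g := by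
  have h : (g : (Fin k → V) → ℝ) =
      fun w => ∑ a : Fin k → Fin 11, g (fun i => e (a i)) * ∏ i, w i (a i) := by
    funext w
    exact (alternatingMap_expand g w).symm
  rw [h]
  fun_prop

theorem fderiv_alternatingMap {k : ℕ} (g : V [⋀^Fin k]→ₗ[ℝ] ℝ) {f : Fin k → V → V} {x : V}
    (hf : ∀ i, DifferentiableAt ℝ (f i) x) (u : V) :
    fderiv ℝ (fun y => g fun i => f i y) x u =
      ∑ i, g (Function.update (fun j => f j x) i (fderiv ℝ (f i) x u)) := by
  let g' : ContinuousMultilinearMap ℝ (fun _ : Fin k => V) ℝ :=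
    ⟨g.toMultilinearMap, continuous_alternatingMap g⟩
  have h := HasFDerivAt.multilinear_comp (f := g') (g := f) (x := x)
    fun i => (hf i).hasFDerivAt
  have h2 : fderiv ℝ (fun y => g fun i => f i y) x = _ := h.fderiv
  rw [h2]
  simp [ContinuousMultilinearMap.toContinuousLinearMap, g']

section

variable {B : FramedSpacetime} {h : Submodule ℝ (Module.End ℝ V)}
  {R : V →ₗ[ℝ] V →ₗ[ℝ] Module.End ℝ V} {ψ : V → E0}

/-- The Lie derivative of the coframe along the vector field of a parallel section. -/
theorem lie_coframe (hψ : ψ ∈ flatEven B h R) (x u : V) :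
    fderiv ℝ (fun y => B.θ y u) x (fieldOf B ψ x) + B.θ x (fderiv ℝ (fieldOf B ψ) x u) =
      -(B.conn x (fieldOf B ψ x) + (ψ x).1) (B.θ x u) := by
  have h1 : DifferentiableAt ℝ (fun y => (B.θ y : V →L[ℝ] V)) x :=
    (B.θ_smooth.differentiable (by simp)).differentiableAt
  have h2 : fderiv ℝ (fun y => B.θ y u) x (fieldOf B ψ x) =
      fderiv ℝ (fun y => (B.θ y : V →L[ℝ] V)) x (fieldOf B ψ x) u := by
    have := fderiv_clm_apply h1 (differentiableAt_const u)
    have h3 := congrArg (fun L : V →L[ℝ] V => L (fieldOf B ψ x)) this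
    simpa using h3
  have ht := B.torsion_free x (fieldOf B ψ x) u
  rw [h2, θ_fderiv_fieldOf hψ, add_apply]
  simp only [θ_fieldOf] at ht
  linear_combination (norm := module) ht

end

/-- The Lie derivative changes the coframe by an element of 𝔥. Such elements are skew, so the metric
is preserved, and annihilate φ, so F is preserved. -/
theorem isKillingField_fieldOf {B : SugraBackground} {φ : ⋀[ℝ]^4 V} (hφ : ∀ x, B.φ x = φ)
    {h : Submodule ℝ (Module.End ℝ V)} {R : V →ₗ[ℝ] V →ₗ[ℝ] Module.End ℝ V}
    (hso : ∀ A ∈ h, A ∈ so) (hh : ∀ A ∈ h, extAct 4 A φ = 0)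
    (hB : ∀ x u, (B.conn x u : V →ₗ[ℝ] V) ∈ h) {ψ : V → E0}
    (hψ : ψ ∈ flatEven B.toFramedSpacetime h R) :
    B.IsKillingField (fieldOf B.toFramedSpacetime ψ) := by
  have hd : ∀ x u : V, DifferentiableAt ℝ (fun y => B.θ y u) x := fun x u =>
    ((B.θ_smooth.differentiable (by simp)).differentiableAt.clm_apply (differentiableAt_const u))
  have hA : ∀ x, ((B.conn x (fieldOf B.toFramedSpacetime ψ x) + (ψ x).1 : V →L[ℝ] V) :
      V →ₗ[ℝ] V) ∈ h := fun x => h.add_mem (hB _ _) (hψ.2.1 x)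
  refine ⟨contDiff_fieldOf _ hψ.1, fun x u w => ?_, fun x u => ?_⟩
  · have hu := lie_coframe hψ x u
    have hw := lie_coframe hψ x w
    have hsk := so_iff.1 (hso _ (hA x)) (B.θ x u) (B.θ x w)
    simp only [ContinuousLinearMap.coe_coe] at hsk
    simp only [FramedSpacetime.metric]
    rw [fderiv_bilinear eta (hd x u) (hd x w)]
    have e1 := congrArg (fun z => eta z (B.θ x w)) hu
    have e2 := congrArg (fun z => eta (B.θ x u) z) hw
    simp only [map_add, map_neg, LinearMap.add_apply, LinearMap.neg_apply] at e1 e2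
    linear_combination e1 + e2 - hsk
  · simp only [SugraBackground.F, hφ]
    rw [fderiv_alternatingMap _ (fun i => hd x (u i)), ← Finset.sum_add_distrib]
    have h1 : ∀ i, formOf 4 φ (Function.update (fun j => B.θ x (u j)) i
          (fderiv ℝ (fun y => B.θ y (u i)) x (fieldOf B.toFramedSpacetime ψ x))) +
        formOf 4 φ (fun j => B.θ x (Function.update u i
          (fderiv ℝ (fieldOf B.toFramedSpacetime ψ) x (u i)) j)) =
        -formOf 4 φ (Function.update (fun j => B.θ x (u j)) i
          ((B.conn x (fieldOf B.toFramedSpacetime ψ x) + (ψ x).1) (B.θ x (u i)))) := by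
      intro i
      have h2 : (fun j => B.θ x (Function.update u i
          (fderiv ℝ (fieldOf B.toFramedSpacetime ψ) x (u i)) j)) =
          Function.update (fun j => B.θ x (u j)) i
            (B.θ x (fderiv ℝ (fieldOf B.toFramedSpacetime ψ) x (u i))) := by
        funext j
        by_cases hj : j = i
        · subst hj; simp
        · simp [hj]
      rw [h2, ← AlternatingMap.map_update_add, lie_coframe hψ x (u i), AlternatingMap.map_update_neg]
    rw [Finset.sum_congr rfl fun i _ => h1 i, Finset.sum_neg_distrib]
    have h3 := sum_formOf_update (hso _ (hA x)) φ (fun j => B.θ x (u j))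
    rw [hh _ (hA x), formOf_zero] at h3
    simpa using h3

/-- The transvection superalgebra of a background whose Killing spinors exhaust `S'`. -/
theorem transvection {B : SugraBackground} {φ : ⋀[ℝ]^4 V} {S' : Submodule ℝ S}
    {R : V →ₗ[ℝ] V →ₗ[ℝ] Module.End ℝ V} (D : IsSymmetricSymbol φ (isotropy φ S') S' R)
    (hφ : ∀ x, B.φ x = φ) (hB : ∀ x u, (B.conn x u : V →ₗ[ℝ] V) ∈ isotropy φ S')
    (hκ : ∀ v, v ∈ Submodule.span ℝ {u | ∃ s ∈ S', ∃ t ∈ S', u = kappa s t})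
    (hval : ∀ ε ∈ B.killingSpinors, ε 0 ∈ S')
    (hex : ∀ s ∈ S', ∃ ε ∈ B.killingSpinors, (∀ x, ε x ∈ S') ∧ ε 0 = s) :
    Module.finrank ℝ B.killingSpinors = Module.finrank ℝ S' ∧
      (∀ K ∈ B.transvectionEven, B.IsKillingField K) ∧
      B.HasTransvectionSuperalgebra D.deformation := by
  have hK := fun {ε : V → S} => mem_killingSpinors (ε := ε) hφ
  have hinj : ∀ ε ∈ B.killingSpinors, ∀ ε' ∈ B.killingSpinors, ε 0 = ε' 0 → ε = ε' := by
    intro ε hε ε' hε' h0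
    have h1 := hK.1 (B.killingSpinors.sub_mem hε hε')
    exact sub_eq_zero.1 (eq_zero_of_flat (bES φ) (continuous_omega B.toFramedSpacetime)
      (h1.1.differentiable (by simp)) h1.2 (by simp [h0]))
  -- A Killing spinor coincides with the S'-valued one having the same initial value.
  have hS : ∀ ε ∈ B.killingSpinors, ∀ x, ε x ∈ S' := by
    intro ε hε
    obtain ⟨ε', hε', h1, h2⟩ := hex _ (hval ε hε)
    rw [hinj ε hε ε' hε' h2.symm]
    exact h1
  let ev₁ : B.killingSpinors →ₗ[ℝ] S' :=
    { toFun := fun ε => ⟨(ε : V → S) 0, hval _ ε.2⟩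
      map_add' := fun _ _ => rfl
      map_smul' := fun _ _ => rfl }
  have hev₁ : Function.Bijective ev₁ := by
    refine ⟨fun ε ε' h => Subtype.ext (hinj _ ε.2 _ ε'.2 (congrArg Subtype.val h)), fun s => ?_⟩
    obtain ⟨ε, hε, -, h0⟩ := hex s s.2
    exact ⟨⟨ε, hε⟩, Subtype.ext h0⟩
  let F₁ := LinearEquiv.ofBijective ev₁ hev₁
  let P := flatEven B.toFramedSpacetime (isotropy φ S') R
  let ev₀ : P →ₗ[ℝ] isotropy φ S' × V :=
    { toFun := fun ψ => (⟨((ψ : V → E0) 0).1, ψ.2.2.1 0⟩, ((ψ : V → E0) 0).2)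
      map_add' := fun _ _ => rfl
      map_smul' := fun _ _ => rfl }
  have hev₀ : Function.Injective ev₀ := by
    rw [injective_iff_map_eq_zero]
    intro ψ h0
    have h1 : (ψ : V → E0) 0 = 0 := by
      have h2 := congrArg (fun t : isotropy φ S' × V => ((toC (t.1 : Module.End ℝ V), t.2) : E0)) h0
      exact h2.trans (Prod.ext (map_zero toC) rfl)
    exact Subtype.ext (eq_zero_of_flat (bEE R) (continuous_omega B.toFramedSpacetime)
      (ψ.2.1.differentiable (by simp)) ψ.2.2.2 h1)
  have hbr : ∀ ε ∈ B.killingSpinors, ∀ ε' ∈ B.killingSpinors,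
      (fun x => bSS φ (ε x) (ε' x)) ∈ P := fun ε hε ε' hε' =>
    bSS_mem_flatEven D hB (hK.1 hε).1 (hK.1 hε').1 (hK.1 hε).2 (hK.1 hε').2 (hS ε hε) (hS ε' hε')
  -- Odd generation reduces surjectivity to brackets of odd elements, which are realised by
  -- pointwise brackets of Killing spinors. The same induction shows that the vector fields obtained
  -- lie in the transvection algebra.
  have hsurj : ∀ a, ∃ ψ : P, ev₀ ψ = a ∧
      fieldOf B.toFramedSpacetime ψ ∈ B.transvectionEven := by
    intro a
    have ha : a ∈ Submodule.span ℝ {a | ∃ s t : S', a = D.deformation.b11 s t} := by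
      rw [D.oddGenerated hκ]; trivial
    induction ha using Submodule.span_induction with
    | mem x hx =>
      obtain ⟨s, t, rfl⟩ := hx
      refine ⟨⟨_, hbr _ (F₁.symm s).2 _ (F₁.symm t).2⟩, ?_,
        Submodule.subset_span ⟨_, (F₁.symm s).2, _, (F₁.symm t).2, rfl⟩⟩
      have hs : (F₁.symm s : V → S) 0 = s := congrArg Subtype.val (F₁.apply_symm_apply s)
      have ht : (F₁.symm t : V → S) 0 = t := congrArg Subtype.val (F₁.apply_symm_apply t)
      refine Prod.ext (Subtype.ext ?_) ?_
      · change gamma φ ((F₁.symm s : V → S) 0) ((F₁.symm t : V → S) 0) = gamma φ s t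
        rw [hs, ht]
      · change kappa ((F₁.symm s : V → S) 0) ((F₁.symm t : V → S) 0) = kappa s t
        rw [hs, ht]
    | zero => exact ⟨0, map_zero _, by
        rw [Submodule.coe_zero, map_zero]; exact B.transvectionEven.zero_mem⟩
    | add x y _ _ hx hy =>
      obtain ⟨ψ, h1, h2⟩ := hx
      obtain ⟨ψ', h1', h2'⟩ := hy
      exact ⟨ψ + ψ', by rw [map_add, h1, h1'], by
        rw [Submodule.coe_add, map_add]; exact B.transvectionEven.add_mem h2 h2'⟩
    | smul c x _ hx =>
      obtain ⟨ψ, h1, h2⟩ := hx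
      exact ⟨c • ψ, by rw [map_smul, h1], by
        rw [Submodule.coe_smul, map_smul]; exact B.transvectionEven.smul_mem c h2⟩
  have hfield : ∀ ψ : P, fieldOf B.toFramedSpacetime ψ ∈ B.transvectionEven := fun ψ => by
    obtain ⟨ψ', h1, h2⟩ := hsurj (ev₀ ψ)
    rwa [hev₀ h1] at h2
  let F₀ := LinearEquiv.ofBijective ev₀ ⟨hev₀, fun a => (hsurj a).imp fun _ h => h.1⟩
  let G : P →ₗ[ℝ] B.transvectionEven :=
    LinearMap.codRestrict _ (fieldOf B.toFramedSpacetime ∘ₗ P.subtype) hfield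
  have hGb : Function.Bijective G := by
    refine ⟨?_, ?_⟩
    · rw [injective_iff_map_eq_zero]
      intro ψ h0
      exact Subtype.ext (fieldOf_injective ψ.2 (congrArg Subtype.val h0))
    · rw [← LinearMap.range_eq_top, eq_top_iff]
      rintro ⟨K, hKt⟩ -
      suffices h : ∀ K ∈ B.transvectionEven, ∃ ψ : P, fieldOf B.toFramedSpacetime ψ = K by
        obtain ⟨ψ, h1⟩ := h K hKt
        exact ⟨ψ, Subtype.ext h1⟩
      intro K hKt
      induction hKt using Submodule.span_induction with
      | mem x hx =>
        obtain ⟨ε, hε, ε', hε', rfl⟩ := hx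
        exact ⟨⟨_, hbr ε hε ε' hε'⟩, rfl⟩
      | zero => exact ⟨0, by simp⟩
      | add x y _ _ hx hy =>
        obtain ⟨ψ, rfl⟩ := hx
        obtain ⟨ψ', rfl⟩ := hy
        exact ⟨ψ + ψ', by simp⟩
      | smul c x _ hx =>
        obtain ⟨ψ, rfl⟩ := hx
        exact ⟨c • ψ, by simp⟩
  let GE := LinearEquiv.ofBijective G hGb
  refine ⟨F₁.finrank_eq, fun K hKt => ?_, F₀.symm.trans GE, F₁.symm, fun a b => ?_, fun a s => ?_,
    fun s t => ?_, fun s => ?_, fun a => ?_⟩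
  · obtain ⟨ψ, h1⟩ := hGb.2 ⟨K, hKt⟩
    have h2 : fieldOf B.toFramedSpacetime ψ = K := congrArg Subtype.val h1
    rw [← h2]
    exact isKillingField_fieldOf hφ D.h_le_so D.h_phi hB ψ.2
  · obtain ⟨ψ, rfl⟩ := F₀.surjective a
    obtain ⟨ψ', rfl⟩ := F₀.surjective b
    -- Evaluation at the origin carries the pointwise bracket of sections to the algebraic bracket
    -- by definition.
    have h1 : D.deformation.b00 (F₀ ψ) (F₀ ψ') =
        F₀ ⟨_, bEE_mem_flatEven D hB ψ.2 ψ'.2⟩ := rfl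
    simp only [h1, LinearEquiv.trans_apply, LinearEquiv.symm_apply_apply]
    exact (lieBracket_fieldOf ψ.2 ψ'.2).symm
  · obtain ⟨ψ, rfl⟩ := F₀.surjective a
    obtain ⟨ε, rfl⟩ := F₁.surjective s
    have hm : (fun x => bES φ ((ψ : V → E0) x) ((ε : V → S) x)) ∈ B.killingSpinors :=
      hK.2 ⟨contDiff_bilinear _ ψ.2.1 (hK.1 ε.2).1,
        fderiv_bES D hB ψ.2 (hK.1 ε.2).1 (hK.1 ε.2).2 (hS _ ε.2)⟩
    have h1 : D.deformation.b01 (F₀ ψ) (F₁ ε) = F₁ ⟨_, hm⟩ := rfl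
    simp only [h1, LinearEquiv.trans_apply, LinearEquiv.symm_apply_apply]
    exact (lieSpinor_fieldOf hφ ψ.2 ε.2).symm
  · obtain ⟨ε, rfl⟩ := F₁.surjective s
    obtain ⟨ε', rfl⟩ := F₁.surjective t
    have h1 : D.deformation.b11 (F₁ ε) (F₁ ε') = F₀ ⟨_, hbr _ ε.2 _ ε'.2⟩ := rfl
    simp only [h1, LinearEquiv.trans_apply, LinearEquiv.symm_apply_apply]
    rfl
  · exact congrArg Subtype.val (F₁.apply_symm_apply s)
  · obtain ⟨ψ, rfl⟩ := F₀.surjective a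
    simp only [LinearEquiv.trans_apply, LinearEquiv.symm_apply_apply]
    exact θ_fieldOf B.toFramedSpacetime ψ 0

/-! ### Killing spinors of the symmetric pp-waves -/

/-- The map `BB` as a bilinear map. -/
def BBL : V →ₗ[ℝ] H4 →ₗ[ℝ] H4 :=
  LinearMap.mk₂ ℝ (fun v x => BB v x)
    (by intro v v' x; simp only [BB_apply, map_add, LinearMap.add_apply]; module)
    (by intro c v x; simp only [BB_apply, map_smul, LinearMap.smul_apply]; module)
    (by intro v x x'; simp only [map_add]) (by intro c v x; simp only [map_smul])

theorem BBL_apply (v : V) (x : H4) : BBL v x = BB v x := rfl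

/-- The exponential `exp(tJ)`. -/
def expJ (t : ℝ) (x : H4) : H4 := x - (Real.cos t - 1) • JJ (JJ x) + Real.sin t • JJ x

theorem expJ_zero (x : H4) : expJ 0 x = x := by
  simp [expJ]

/-- J³ = -J is what closes the exponential series into 1 + (1 - cos t) J² + sin t J. -/
theorem JJ_JJ_JJ (x : H4) : JJ (JJ (JJ x)) = -JJ x := by
  refine H4_ext ?_ ?_ ?_ ?_ <;> simp [qI_mul_qI_mul]

theorem contDiff_expJ (c : ℝ) (x : H4) : ContDiff ℝ ∞ fun y : V => expJ (c * y 10) x := by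
  unfold expJ
  fun_prop

theorem hasDerivAt_expJ (t : ℝ) (x : H4) : HasDerivAt (fun t => expJ t x) (JJ (expJ t x)) t := by
  have h := (((Real.hasDerivAt_cos t).sub_const 1).smul_const (JJ (JJ x))).const_sub x
  have h2 := h.add ((Real.hasDerivAt_sin t).smul_const (JJ x))
  have h3 : JJ (expJ t x) = -(-Real.sin t • JJ (JJ x)) + Real.cos t • JJ x := by
    simp only [expJ, map_add, map_sub, map_smul, JJ_JJ_JJ]
    module
  rw [h3]
  exact h2

theorem fderiv_expJ (c : ℝ) (x : H4) (y u : V) :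
    fderiv ℝ (fun y : V => expJ (c * y 10) x) y u = (c * u 10) • JJ (expJ (c * y 10) x) := by
  have h1 : HasFDerivAt (fun y : V => c * y 10)
      (c • (ContinuousLinearMap.proj 10 : V →L[ℝ] ℝ)) y :=
    ((ContinuousLinearMap.proj 10 : V →L[ℝ] ℝ).hasFDerivAt).const_smul c
  have h2 := (hasDerivAt_expJ (c * y 10) x).hasFDerivAt.comp y h1
  have h3 : fderiv ℝ (fun y : V => expJ (c * y 10) x) y = _ := h2.fderiv
  rw [h3]
  simp [mul_smul]

section

variable {c₁ c₂ c₃ : ℝ} (hc : c₁ + 4 * c₂ + 4 * c₃ = 1)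

theorem mem_killingSpinors_pp {ε : V → S} : ε ∈ (ppBackground c₁ c₂ c₃ hc).killingSpinors ↔
    ContDiff ℝ ∞ ε ∧ ∀ x u, fderiv ℝ ε x u =
      ((√2 / 12) • BB u (ε x).2 + (u 10 / 2) • JJ (ε x).1
        + (√2 / 2 * u 10) • gam (Cmap c₁ c₂ c₃ x) (ε x).2, -((u 10 / 6) • JJ (ε x).2)) := by
  rw [mem_killingSpinors (φ := phi0) (fun _ => rfl)]
  refine and_congr_right fun _ => forall₂_congr fun x u => ?_
  rw [bES_omega]
  have h1 : beta phi0 ((ppBackground c₁ c₂ c₃ hc).θ x u) (ε x) = beta phi0 u (ε x) := by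
    have h10 : (ePlus : V) 10 = 0 := by simp [e_apply]
    have hg : ∀ t : ℝ, gam (u + t • ePlus) = gam u := fun t => by
      rw [map_add, map_smul, gam_e_zero, smul_zero, add_zero]
    change beta phi0 (shear _ u) (ε x) = _
    rw [shear_apply, beta_phi0, beta_phi0]
    simp only [BB_apply, hg, Pi.add_apply, Pi.smul_apply, h10, smul_zero, add_zero]
  have h2 : spinRep (((ppBackground c₁ c₂ c₃ hc).conn x u : V →L[ℝ] V) : V →ₗ[ℝ] V) (ε x) =
      (-(√2 / 2 * u 10) • gam (Cmap c₁ c₂ c₃ x) (ε x).2, 0) := by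
    change spinRep (u 10 • nfv (Cmap c₁ c₂ c₃ x)) (ε x) = _
    rw [map_smul, LinearMap.smul_apply, nfv_apply,
      spinRep_nf 0 rfl rfl (by simp [Cmap_apply]) (by simp [Cmap_apply])]
    have h : ∀ h : H4, sigH 0 0 0 h = 0 := fun h => by
      refine H4_ext ?_ ?_ ?_ ?_ <;> simp [sigH]
    rw [h, h]
    ext1
    · simp only [Prod.smul_fst]
      module
    · simp
  rw [h1, h2, beta_phi0]
  have h3 : ∀ a b c : H4, ((a, b) : S) - (-(√2 / 2 * u 10) • c, 0) =
      (a + (√2 / 2 * u 10) • c, b) := fun a b c => by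
    ext1
    · simp only [Prod.fst_sub]
      module
    · simp
  rw [h3]

/-- The S_- part is rotated by exp(-(x⁻/6) J). The S_+ part is the rotated initial value exp((x⁻/2)
J) s_+ plus (√2/12) `BB x` applied to the S_- part; `hkey` says that the e_- derivative of this
correction absorbs the connection term. -/
theorem exists_killingSpinor {S' : Submodule ℝ S}
    (hkey : ∀ s ∈ S', ∀ w, (1 / 2 : ℝ) • JJ (BB w s.2) + (1 / 6 : ℝ) • BB w (JJ s.2) =
      -(6 : ℝ) • gam (Cmap c₁ c₂ c₃ w) s.2)
    (hS' : ∀ t h s, s ∈ S' → (h, expJ t s.2) ∈ S') {s : S} (hs : s ∈ S') :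
    ∃ ε ∈ (ppBackground c₁ c₂ c₃ hc).killingSpinors, (∀ x, ε x ∈ S') ∧ ε 0 = s := by
  let m : V → H4 := fun x => expJ (-(1 / 6) * x 10) s.2
  let p : V → H4 := fun x => expJ (1 / 2 * x 10) s.1 + (√2 / 12) • BBL x (m x)
  have hm : ContDiff ℝ ∞ m := contDiff_expJ _ _
  have hb : ContDiff ℝ ∞ fun x : V => BBL x (m x) := contDiff_bilinear BBL contDiff_id hm
  have hp : ContDiff ℝ ∞ p := (contDiff_expJ _ _).add (hb.const_smul (√2 / 12))
  have dm : ∀ x u, fderiv ℝ m x u = -((u 10 / 6) • JJ (m x)) := fun x u => by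
    rw [fderiv_expJ]
    module
  have dp : ∀ x u, fderiv ℝ p x u = (√2 / 12) • BB u (m x) + (u 10 / 2) • JJ (p x)
        + (√2 / 2 * u 10) • gam (Cmap c₁ c₂ c₃ x) (m x) := fun x u => by
    have h1 : fderiv ℝ p x u = fderiv ℝ (fun y : V => expJ (1 / 2 * y 10) s.1) x u +
        (√2 / 12) • fderiv ℝ (fun x : V => BBL x (m x)) x u := by
      have d1 : DifferentiableAt ℝ (fun y : V => expJ (1 / 2 * y 10) s.1) x :=
        ((contDiff_expJ _ _).differentiable (by simp)).differentiableAt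
      have d2 : DifferentiableAt ℝ (fun x : V => BBL x (m x)) x :=
        (hb.differentiable (by simp)).differentiableAt
      have h2 := (d1.hasFDerivAt.add (d2.hasFDerivAt.const_smul (√2 / 12))).fderiv
      have h3 : fderiv ℝ p x = _ := h2
      rw [h3]
      rfl
    have h2 := fderiv_bilinear BBL (f := fun y : V => y) (g := m) (x := x) differentiableAt_fun_id
      (hm.differentiable (by simp)).differentiableAt u
    have hk := hkey _ (hS' (-(1 / 6) * x 10) 0 s hs) x
    rw [h1, fderiv_expJ, h2, dm, fderiv_fun_id, ContinuousLinearMap.id_apply, BBL_apply, BBL_apply]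
    simp only [p, map_add, map_smul, map_neg, BBL_apply, m] at hk ⊢
    linear_combination (norm := module) -(√2 / 12 * u 10) • hk
  refine ⟨fun x => (p x, m x), ?_, fun x => hS' _ _ _ hs, ?_⟩
  · rw [mem_killingSpinors_pp]
    refine ⟨hp.prodMk hm, fun x u => ?_⟩
    have h1 := ((hp.differentiable (by simp)).differentiableAt (x := x)).hasFDerivAt.prodMk
      ((hm.differentiable (by simp)).differentiableAt (x := x)).hasFDerivAt
    rw [h1.fderiv]
    exact Prod.ext (dp x u) (dm x u)
  · have h1 : ((0 : V) 10 : ℝ) = 0 := rfl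
    simp only [p, m, h1, mul_zero, expJ_zero, map_zero, LinearMap.zero_apply, smul_zero, add_zero]

/-- A function whose derivative in the direction of `v` vanishes is constant in that direction. -/
theorem add_smul_eq_of_fderiv_eq_zero {E : Type*} [NormedAddCommGroup E] [NormedSpace ℝ E]
    {f : V → E} (hf : Differentiable ℝ f) {v : V} (hv : ∀ x, fderiv ℝ f x v = 0) (x : V) :
    f (x + v) = f x := by
  have hd : ∀ t : ℝ, HasDerivAt (fun t : ℝ => f (x + t • v)) 0 t := fun t => by
    have h2 : HasDerivAt (fun t : ℝ => x + t • v) v t := by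
      simpa using ((hasDerivAt_id t).smul_const v).const_add x
    rw [← hv (x + t • v)]
    exact (hf _).hasFDerivAt.comp_hasDerivAt t h2
  have h := is_const_of_deriv_eq_zero (fun t => (hd t).differentiableAt) (fun t => (hd t).deriv) 1 0
  simpa using h

/-- Subtracting (√2/12) `BB x` s_- from s_+ gives a function δ that, like s_-, does not change in
the direction e_1. The e_- derivative of δ contains a term linear in x; comparing its values at 0
and e_1 isolates the obstruction. -/
theorem killingSpinor_condition {ε : V → S}
    (hε : ε ∈ (ppBackground c₁ c₂ c₃ hc).killingSpinors) :
    (1 / 2 : ℝ) • JJ (BB (e 1) (ε 0).2) + (1 / 6 : ℝ) • BB (e 1) (JJ (ε 0).2) +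
      (6 : ℝ) • gam (Cmap c₁ c₂ c₃ (e 1)) (ε 0).2 = 0 := by
  rw [mem_killingSpinors_pp] at hε
  obtain ⟨h1, h2⟩ := hε
  have hd : ∀ x, DifferentiableAt ℝ ε x := fun x =>
    (h1.differentiable (by simp)).differentiableAt
  have dm : ∀ x u, fderiv ℝ (fun x => (ε x).2) x u = -((u 10 / 6) • JJ (ε x).2) := fun x u => by
    rw [fderiv.snd (hd x), ContinuousLinearMap.comp_apply, h2]
    rfl
  have dp : ∀ x u, fderiv ℝ (fun x => (ε x).1) x u = (√2 / 12) • BB u (ε x).2 +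
      (u 10 / 2) • JJ (ε x).1 + (√2 / 2 * u 10) • gam (Cmap c₁ c₂ c₃ x) (ε x).2 := fun x u => by
    rw [fderiv.fst (hd x), ContinuousLinearMap.comp_apply, h2]
    rfl
  let δ : V → H4 := fun x => (ε x).1 - (√2 / 12) • BBL x (ε x).2
  have hb : ContDiff ℝ ∞ fun x : V => BBL x (ε x).2 := contDiff_bilinear BBL contDiff_id h1.snd
  have hδ : ContDiff ℝ ∞ δ := h1.fst.sub (hb.const_smul (√2 / 12))
  have dδ : ∀ x u, fderiv ℝ δ x u = (u 10 / 2) • JJ (δ x) + (√2 / 12 * u 10) •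
      ((1 / 2 : ℝ) • JJ (BB x (ε x).2) + (1 / 6 : ℝ) • BB x (JJ (ε x).2) +
        (6 : ℝ) • gam (Cmap c₁ c₂ c₃ x) (ε x).2) := fun x u => by
    have d3 : fderiv ℝ δ x u = fderiv ℝ (fun x => (ε x).1) x u -
        (√2 / 12) • fderiv ℝ (fun x : V => BBL x (ε x).2) x u := by
      have d2 : DifferentiableAt ℝ (fun x : V => BBL x (ε x).2) x :=
        (hb.differentiable (by simp)).differentiableAt
      have h2 := ((hd x).fst.hasFDerivAt.sub (d2.hasFDerivAt.const_smul (√2 / 12))).fderiv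
      have h3 : fderiv ℝ δ x = _ := h2
      rw [h3]
      rfl
    have h2 := fderiv_bilinear BBL (f := fun y : V => y) (g := fun x => (ε x).2) (x := x)
      differentiableAt_fun_id (hd x).snd u
    rw [d3, dp, h2, dm, fderiv_fun_id, ContinuousLinearMap.id_apply, BBL_apply, BBL_apply]
    simp only [δ, map_sub, map_smul, map_neg, BBL_apply]
    module
  have e1 : (e 1 : V) 10 = 0 := by simp [e_apply]
  have e10 : (e 10 : V) 10 = 1 := by simp [e_apply]
  have cm : (ε (e 1)).2 = (ε 0).2 := by
    have := add_smul_eq_of_fderiv_eq_zero (f := fun x => (ε x).2)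
      (h1.snd.differentiable (by simp)) (v := e 1) (fun x => by rw [dm, e1]; simp) 0
    simpa using this
  have cδ : ∀ x, δ (x + e 1) = δ x := add_smul_eq_of_fderiv_eq_zero
    (hδ.differentiable (by simp)) (fun x => by rw [dδ, e1]; simp)
  have h3 : fderiv ℝ δ (0 + e 1) (e 10) = fderiv ℝ δ 0 (e 10) := by
    rw [← fderiv_comp_add_right]
    simp only [cδ]
  rw [dδ, dδ, cδ, zero_add, cm, e10] at h3
  have h4 : BB 0 = 0 := LinearMap.ext fun x => by simp [BB_apply]
  simp only [h4, map_zero, LinearMap.zero_apply, smul_zero, add_zero] at h3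
  have h5 := add_eq_left.1 h3
  exact (smul_eq_zero.1 h5).resolve_left (by positivity)

end

/-! ### The upper bound on Killing spinors -/

theorem quatA_e_one : quatA (e 1) = 0 := by
  ext <;> simp [e_apply]

theorem quatB_e_one : quatB (e 1) = 0 := by
  ext <;> simp [e_apply]

theorem Cmap_e_one (c₁ c₂ c₃ : ℝ) : Cmap c₁ c₂ c₃ (e 1) = c₁ • e 1 := by
  refine V_ext ?_ ?_ ?_ ?_ ?_ <;>
    simp [Cmap_apply, e_apply, quatA_smul, quatB_smul, quatA_e_one, quatB_e_one]

section

variable {c₁ c₂ c₃ : ℝ} (hc : c₁ + 4 * c₂ + 4 * c₃ = 1)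

/-- Along e_1 the obstruction is diagonal. For c₁ = 4/9 the factor 6c₁ - 8/3 vanishes and components
1, 3 must be zero; for c₁ = 0 it is components 0, 2. -/
theorem killingSpinor_components {ε : V → S}
    (hε : ε ∈ (ppBackground c₁ c₂ c₃ hc).killingSpinors) :
    (6 * c₁ - 8 / 3) • (ε 0).2 0 = 0 ∧ c₁ • (ε 0).2 1 = 0 ∧
      (6 * c₁ - 8 / 3) • (ε 0).2 2 = 0 ∧ c₁ • (ε 0).2 3 = 0 := by
  have h := killingSpinor_condition hc hε
  rw [Cmap_e_one] at h
  simp only [map_smul, LinearMap.smul_apply] at h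
  have h1 : (e 1 : V) 1 = 1 := by simp [e_apply]
  refine ⟨?_, ?_, ?_, ?_⟩
  · have h0 := congrFun h 0
    simp [BB_apply, h1, quatA_e_one, quatB_e_one, qI_mul_qI_mul] at h0
    linear_combination (norm := module) h0
  · have h0 := congrFun h 1
    simp [BB_apply, h1, quatA_e_one, quatB_e_one] at h0
    simpa using h0
  · have h0 := congrFun h 2
    simp [BB_apply, h1, quatA_e_one, quatB_e_one, qI_mul_qI_mul] at h0
    linear_combination (norm := module) -h0
  · have h0 := congrFun h 3
    simp [BB_apply, h1, quatA_e_one, quatB_e_one] at h0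
    simpa using h0

end

theorem givesSymmetricPPWave_S1 : GivesSymmetricPPWave phi0 S1 R1 24 := by
  have hc : (4 / 9 : ℝ) + 4 * (1 / 36) + 4 * (1 / 9) = 1 := by norm_num
  obtain ⟨h1, h2, h3⟩ := transvection (B := ppBackground (4 / 9) (1 / 36) (1 / 9) hc)
    isSymmetricSymbol_S1 (fun _ => rfl)
    (fun x u => by rw [isotropy_S1]; exact connPP_mem_N1 _ _ _ x u) kappa_S1_onto
    (fun ε hε => by
      obtain ⟨-, h1, -, h3⟩ := killingSpinor_components hc hε
      exact ⟨(smul_eq_zero.1 h1).resolve_left (by norm_num),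
        (smul_eq_zero.1 h3).resolve_left (by norm_num)⟩)
    (fun s hs => exists_killingSpinor hc
      (fun s hs w => BB_gam_S1 hs w)
      (fun t h s hs => by
        rw [mem_S1] at hs ⊢
        simp [expJ, hs.1, hs.2]) hs)
  refine ⟨isSymmetricSymbol_S1.deformation, isSymmetricSymbol_S1.realizedBy_deformation,
    isSymmetricSymbol_S1.oddGenerated kappa_S1_onto, fun v w => ?_,
    ppBackground (4 / 9) (1 / 36) (1 / 9) hc, ppSpacetime_isPPWave _ _ _,
    ppSpacetime_isLocallySymmetric _ _ _, fun _ => rfl, fun x v w => ?_, ?_, h2, h3⟩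
  · rw [isSymmetricSymbol_S1.rho_deformation, R1_eq]
  · rw [R1_eq]
    exact ppSpacetime_curvature _ _ _ x v w
  · rw [h1, finrank_S1]

theorem givesSymmetricPPWave_S2 : GivesSymmetricPPWave phi0 S2 R2 24 := by
  have hc : (0 : ℝ) + 4 * (1 / 4) + 4 * 0 = 1 := by norm_num
  obtain ⟨h1, h2, h3⟩ := transvection (B := ppBackground 0 (1 / 4) 0 hc)
    isSymmetricSymbol_S2 (fun _ => rfl)
    (fun x u => by rw [isotropy_S2]; exact connPP_mem_N2 _ x u) kappa_S2_onto
    (fun ε hε => by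
      obtain ⟨h0, -, h2, -⟩ := killingSpinor_components hc hε
      exact ⟨(smul_eq_zero.1 h0).resolve_left (by norm_num),
        (smul_eq_zero.1 h2).resolve_left (by norm_num)⟩)
    (fun s hs => exists_killingSpinor hc
      (fun s hs w => BB_gam_S2 hs w)
      (fun t h s hs => by
        rw [mem_S2] at hs ⊢
        simp [expJ, hs.1, hs.2]) hs)
  refine ⟨isSymmetricSymbol_S2.deformation, isSymmetricSymbol_S2.realizedBy_deformation,
    isSymmetricSymbol_S2.oddGenerated kappa_S2_onto, fun v w => ?_,
    ppBackground 0 (1 / 4) 0 hc, ppSpacetime_isPPWave _ _ _,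
    ppSpacetime_isLocallySymmetric _ _ _, fun _ => rfl, fun x v w => ?_, ?_, h2, h3⟩
  · rw [isSymmetricSymbol_S2.rho_deformation, R2_eq]
  · rw [R2_eq]
    exact ppSpacetime_curvature _ _ _ x v w
  · rw [h1, finrank_S2]

end Sugra

end

theorem mainTheorem7 :
    (Module.finrank ℝ S1 = 24 ∧ Module.finrank ℝ S2 = 24) ∧
    (Maximal (IsLiePair phi0) S1 ∧ Maximal (IsLiePair phi0) S2) ∧
    (IsSemidirectSum (isotropy phi0 S1) (u1 ⊔ soOf (spanIcc 6 9)) (plusWedge (spanIcc 1 9)) ∧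
      IsLieDirectSum (u1 ⊔ soOf (spanIcc 6 9)) u1 (soOf (spanIcc 6 9)) ∧
      IsSemidirectSum (isotropy phi0 S2) u1 (plusWedge (spanIcc 2 5))) ∧
    (GivesSymmetricPPWave phi0 S1 R1 24 ∧ GivesSymmetricPPWave phi0 S2 R2 24) := by
  refine ⟨⟨finrank_S1, finrank_S2⟩, ⟨maximal_S1, maximal_S2⟩,
    ⟨isSemidirectSum_S1, isLieDirectSum_u1_soOf, isSemidirectSum_S2⟩, givesSymmetricPPWave_S1,
    givesSymmetricPPWave_S2⟩
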